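/- Let $m,n\ge 0$ be integers with $m-n>2$ and let $\mathfrak g=\mathfrak{sl}(m|n)$ be the Lie superalgebra over $\mathbb C$ of $(m+n)\times(m+n)$ supermatrices with vanishing supertrace $\mathrm{str}(A)=\sum_i(-1)^{|i|}A_{ii}$, where $|i|=0$ for $i\le m$ and $|i|=1$ for $i>m$. Let $T(\mathfrak g)$ be its tensor algebra and $U(\mathfrak g)$ its universal enveloping algebra with standard filtration $U_k$; let $\langle A,B\rangle=2(m-n)\,\mathrm{str}(AB)$ be the Killing form; let $\odot^2\mathfrak g\subset\mathfrak g\otimes\mathfrak g$ be the space of supersymmetric tensors; and let $\tau$ be the canonical antiautomorphism of $U(\mathfrak g)$, i.e. the linear map with $\tau(1)=1$, $\tau(X)=-X$ for $X\in\mathfrak g$ and $\tau(uv)=(-1)^{|u||v|}\tau(v)\tau(u)$ for homogeneous $u,v$. With respect to the upper triangular Borel subalgebra and the diagonal Cartan subalgebra (with weights $\epsilon_1,\dots,\epsilon_m,\delta_1,\dots,\delta_n$ the diagonal entries), let the Cartan product $\mathfrak g\circledcirc\mathfrak g$ be the direct summand of the $\mathfrak g$-module $\mathfrak g\otimes\mathfrak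 g$ that is isomorphic to the simple module of highest weight $2\epsilon_1-\delta_{n-1}-\delta_n$ (to be read as $2\epsilon_1-\epsilon_m-\delta_1$ if $n=1$ and as $2\epsilon_1-2\epsilon_m$ if $n=0$), and for $X,Y\in\mathfrak g$ let $X\circledcirc Y$ be the component of $X\otimes Y$ in it, along the complementary subrepresentation. For $\lambda\in\mathbb C$ let $\mathcal J_\lambda$ be the two-sided ideal of $T(\mathfrak g)$ generated by the elements $$X\otimes Y-X\circledcirc Y-\tfrac12[X,Y]-\lambda\langle X,Y\rangle,\qquad X,Y\in\mathfrak g,$$ and let $J_\lambda$ be its image in $U(\mathfrak g)$. Put $\lambda^c=-\frac{1}{8(m-n+1)}$; the ideal $J_{\lambda^c}$ is called the Joseph ideal. Let $\mathfrak K\subset U(\mathfrak g)$ be a two-sided ideal of infinite codimension with $\tau(\mathfrak K)=\mathfrak K$, and let $gr(\mathfrak K)\subset gr(U(\mathfrak g))=\odot\mathfrak g$ be its graded ideal, so that $gr(\mathfrak K)\cap\odot^2\mathfrak g$ consists of the tensors in $\odot^2\mathfrak g$ whose image in $U(\mathfrak g)$ lies in $\mathfrak K+U_1$. If $$(gr(\mathfrak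 K)\cap\odot^2\mathfrak g)\oplus\mathfrak g\circledcirc\mathfrak g=\odot^2\mathfrak g,$$ then $\mathfrak K=J_{\lambda^c}$. -/

import Mathlib

open scoped TensorProduct

noncomputable section

namespace SLSuper

/-- Indices of the standard basis of `ℂ^{m|n}`: first the even ones, then the odd ones. -/
abbrev Idx (m n : ℕ) : Type := Fin m ⊕ Fin n

/-- Parity of an index. -/
def par {m n : ℕ} : Idx m n → ZMod 2 := Sum.elim (fun _ => 0) (fun _ => 1)

/-- The sign `(-1)^p`. -/
def sgn (p : ZMod 2) : ℂ := if p = 0 then 1 else -1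

/-- Supermatrices, that is `𝔤𝔩(m|n)` as a vector space. -/
abbrev Mat (m n : ℕ) : Type := Matrix (Idx m n) (Idx m n) ℂ

/-- The supertrace `∑ i, (-1)^{|i|} A i i`. -/
def str (m n : ℕ) : Mat m n →ₗ[ℂ] ℂ where
  toFun A := ∑ i, sgn (par i) * A i i
  map_add' A B := by simp [mul_add, Finset.sum_add_distrib]
  map_smul' c A := by
    simp only [Matrix.smul_apply, smul_eq_mul, RingHom.id_apply, Finset.mul_sum]
    exact Finset.sum_congr rfl fun i _ => by ring

/-- The component of parity `p` of a supermatrix. -/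
def matComp {m n : ℕ} (p : ZMod 2) : Mat m n →ₗ[ℂ] Mat m n where
  toFun A := Matrix.of fun i j => if par i + par j = p then A i j else 0
  map_add' A B := by
    ext i j
    by_cases h : par i + par j = p <;> simp [h]
  map_smul' c A := by
    ext i j
    by_cases h : par i + par j = p <;> simp [h]

/-- The supercommutator: `A B - (-1)^{|A||B|} B A` for homogeneous `A`, `B`, extended bilinearly
(in the `(i, k)` entry, `B i j` has parity `|i| + |j|` and `A j k` has parity `|j| + |k|`). -/
def matBracket (m n : ℕ) : Mat m n →ₗ[ℂ] Mat m n →ₗ[ℂ] Mat m n :=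
  LinearMap.mk₂ ℂ
    (fun A B => Matrix.of fun i k =>
      ∑ j, (A i j * B j k - sgn ((par i + par j) * (par j + par k)) * (B i j * A j k)))
    (fun A A' B => by
      ext i k
      simp only [Matrix.of_apply, Matrix.add_apply, ← Finset.sum_add_distrib]
      exact Finset.sum_congr rfl fun j _ => by ring)
    (fun c A B => by
      ext i k
      simp only [Matrix.of_apply, Matrix.smul_apply, smul_eq_mul, Finset.mul_sum]
      exact Finset.sum_congr rfl fun j _ => by ring)
    (fun A B B' => by
      ext i k
      simp only [Matrix.of_apply, Matrix.add_apply, ← Finset.sum_add_distrib]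
      exact Finset.sum_congr rfl fun j _ => by ring)
    (fun c A B => by
      ext i k
      simp only [Matrix.of_apply, Matrix.smul_apply, smul_eq_mul, Finset.mul_sum]
      exact Finset.sum_congr rfl fun j _ => by ring)

theorem zmod2_cases (p : ZMod 2) : p = 0 ∨ p = 1 := by
  revert p; decide

theorem str_matBracket {m n : ℕ} (A B : Mat m n) : str m n (matBracket m n A B) = 0 := by
  have key : ∀ i j : Idx m n,
      sgn (par i) * sgn ((par i + par j) * (par j + par i)) = sgn (par j) := by
    intro i j
    rcases zmod2_cases (par i) with hi | hi <;> rcases zmod2_cases (par j) with hj | hj <;>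
      rw [hi, hj] <;> simp [sgn, show (1 : ZMod 2) + 1 = 0 from rfl]
  have e : str m n (matBracket m n A B) =
      (∑ i, ∑ j, sgn (par i) * (A i j * B j i)) - ∑ i, ∑ j, sgn (par j) * (B i j * A j i) := by
    simp only [str, matBracket, LinearMap.coe_mk, AddHom.coe_mk, LinearMap.mk₂_apply,
      Matrix.of_apply, Finset.mul_sum, ← Finset.sum_sub_distrib]
    refine Finset.sum_congr rfl fun i _ => Finset.sum_congr rfl fun j _ => ?_
    rw [← key i j]
    ring
  rw [e, Finset.sum_comm, sub_eq_zero]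
  exact Finset.sum_congr rfl fun i _ => Finset.sum_congr rfl fun j _ => by ring

theorem str_matComp {m n : ℕ} (p : ZMod 2) (A : Mat m n) :
    str m n (matComp p A) = if p = 0 then str m n A else 0 := by
  have h : ∀ i : Idx m n, par i + par i = 0 := fun i => by
    rcases zmod2_cases (par i) with hi | hi <;> rw [hi] <;> rfl
  by_cases hp : p = 0
  · simp [str, matComp, h, hp]
  · simp [str, matComp, h, hp, Ne.symm hp]

/-- `𝔰𝔩(m|n)`: the supermatrices with vanishing supertrace. -/
def sl (m n : ℕ) : Submodule ℂ (Mat m n) := LinearMap.ker (str m n)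

/-- The homogeneous component of parity `p` of an element of `𝔰𝔩(m|n)`. -/
def comp {m n : ℕ} (p : ZMod 2) : sl m n →ₗ[ℂ] sl m n :=
  (matComp p).restrict fun A hA => by
    have hA' : str m n A = 0 := hA
    change str m n (matComp p A) = 0
    rw [str_matComp, hA', ite_self]

/-- The Lie superbracket of `𝔰𝔩(m|n)`. -/
def bracket {m n : ℕ} : sl m n →ₗ[ℂ] sl m n →ₗ[ℂ] sl m n :=
  LinearMap.mk₂ ℂ
    (fun X Y => ⟨matBracket m n X Y, str_matBracket _ _⟩)
    (fun X X' Y => Subtype.ext (by simp))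
    (fun c X Y => Subtype.ext (by simp))
    (fun X Y Y' => Subtype.ext (by simp))
    (fun c X Y => Subtype.ext (by simp))

/-- `X ∈ 𝔰𝔩(m|n)` is homogeneous of parity `p`. -/
def IsHomog {m n : ℕ} (p : ZMod 2) (X : sl m n) : Prop := comp p X = X

/-- The Killing form `⟨A, B⟩ = 2 (m - n) str (A B)`. -/
def killing {m n : ℕ} (X Y : sl m n) : ℂ :=
  2 * ((m : ℂ) - n) * str m n ((X : Mat m n) * (Y : Mat m n))

/-! ### The second tensor power -/

/-- The adjoint action of `X` on `𝔤 ⊗ 𝔤`: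
`X · (Y ⊗ Z) = [X, Y] ⊗ Z + (-1)^{|X||Y|} Y ⊗ [X, Z]` for homogeneous `X`, `Y`. -/
def act {m n : ℕ} (X : sl m n) : sl m n ⊗[ℂ] sl m n →ₗ[ℂ] sl m n ⊗[ℂ] sl m n :=
  TensorProduct.map (bracket X) LinearMap.id +
    ∑ p : ZMod 2, ∑ q : ZMod 2,
      sgn (p * q) • TensorProduct.map (comp (m := m) (n := n) q) (bracket (comp p X))

/-- The super flip `X ⊗ Y ↦ (-1)^{|X||Y|} Y ⊗ X` for homogeneous `X`, `Y`. -/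
def superSwap (m n : ℕ) : sl m n ⊗[ℂ] sl m n →ₗ[ℂ] sl m n ⊗[ℂ] sl m n :=
  ∑ p : ZMod 2, ∑ q : ZMod 2,
    sgn (p * q) • (TensorProduct.map (comp (m := m) (n := n) q) (comp (m := m) (n := n) p) ∘ₗ
      (TensorProduct.comm ℂ (sl m n) (sl m n)).toLinearMap)

/-- `⊙² 𝔤`, the supersymmetric tensors in `𝔤 ⊗ 𝔤`. -/
def symSq (m n : ℕ) : Submodule ℂ (sl m n ⊗[ℂ] sl m n) :=
  LinearMap.eqLocus (superSwap m n) LinearMap.id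

/-- The subspace `N` of `𝔤 ⊗ 𝔤` is a `𝔤`-submodule. -/
def IsStable {m n : ℕ} (N : Submodule ℂ (sl m n ⊗[ℂ] sl m n)) : Prop :=
  ∀ X : sl m n, ∀ t ∈ N, act X t ∈ N

/-- The functional `ε_i` (`1 ≤ i ≤ m`) on diagonal matrices. -/
def eps {m n : ℕ} (i : ℕ) (A : Mat m n) : ℂ :=
  if h : i - 1 < m then A (Sum.inl ⟨i - 1, h⟩) (Sum.inl ⟨i - 1, h⟩) else 0

/-- The functional `δ_j` (`1 ≤ j ≤ n`) on diagonal matrices. -/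
def del {m n : ℕ} (j : ℕ) (A : Mat m n) : ℂ :=
  if h : j - 1 < n then A (Sum.inr ⟨j - 1, h⟩) (Sum.inr ⟨j - 1, h⟩) else 0

/-- The highest weight occurring in `⊙² 𝔤`: `2ε₁ - δ_{n-1} - δ_n` if `n ≥ 2`,
`2ε₁ - ε_m - δ₁` if `n = 1`, and `2ε₁ - 2ε_m` if `n = 0`. -/
def cartanWeight (m n : ℕ) (H : Mat m n) : ℂ :=
  match n with
  | 0 => 2 * eps 1 H - 2 * eps m H
  | 1 => 2 * eps 1 H - eps m H - del 1 H
  | k + 2 => 2 * eps 1 H - del (k + 1) H - del (k + 2) H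

/-- `v ∈ 𝔤 ⊗ 𝔤` is a highest weight vector of weight `cartanWeight m n`, for the Borel subalgebra
of upper triangular matrices and the Cartan subalgebra of diagonal matrices. -/
def IsCartanHighestWeightVector {m n : ℕ} (v : sl m n ⊗[ℂ] sl m n) : Prop :=
  v ≠ 0 ∧
  (∀ X : sl m n,
    (∀ i j, finSumFinEquiv j ≤ finSumFinEquiv i → (X : Mat m n) i j = 0) → act X v = 0) ∧
  ∀ H : sl m n, (∀ i j, i ≠ j → (H : Mat m n) i j = 0) → act H v = cartanWeight m n H • v

/-- `𝔤 ⊗ 𝔤 = C ⊕ I` as `𝔤`-modules, where `C` is isomorphic to the simple module whose highest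
weight is `cartanWeight m n`. -/
structure IsCartanDecomposition {m n : ℕ} (C I : Submodule ℂ (sl m n ⊗[ℂ] sl m n)) : Prop where
  stable_left : IsStable C
  stable_right : IsStable I
  isCompl : IsCompl C I
  simple : ∀ N : Submodule ℂ (sl m n ⊗[ℂ] sl m n), IsStable N → N ≤ C → N = ⊥ ∨ N = C
  highestWeight : ∃ v ∈ C, IsCartanHighestWeightVector v

/-- The Cartan product `𝔤 ⊚ 𝔤`: the direct summand of `𝔤 ⊗ 𝔤` isomorphic to the simple module of
highest weight `cartanWeight m n` (there is exactly one if `|m - n| > 2`). -/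
def cartanProduct (m n : ℕ) : Submodule ℂ (sl m n ⊗[ℂ] sl m n) :=
  sSup {C | ∃ I, IsCartanDecomposition C I}

/-- The complementary subrepresentation of `𝔤 ⊚ 𝔤` in `𝔤 ⊗ 𝔤` (there is exactly one if
`|m - n| > 2`). -/
def cartanComplement (m n : ℕ) : Submodule ℂ (sl m n ⊗[ℂ] sl m n) :=
  sSup {I | ∃ C, IsCartanDecomposition C I}

/-- `c = X ⊚ Y`: `c` is the component of `X ⊗ Y` in `𝔤 ⊚ 𝔤`. -/
def IsCartanPart {m n : ℕ} (X Y : sl m n) (c : sl m n ⊗[ℂ] sl m n) : Prop :=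
  c ∈ cartanProduct m n ∧ X ⊗ₜ[ℂ] Y - c ∈ cartanComplement m n

/-! ### The enveloping algebra -/

/-- The tensor algebra `T(𝔤)`. -/
abbrev T (m n : ℕ) : Type := TensorAlgebra ℂ (sl m n)

/-- The inclusion `𝔤 → T(𝔤)`. -/
abbrev tι {m n : ℕ} : sl m n →ₗ[ℂ] T m n := TensorAlgebra.ι ℂ

/-- The inclusion `𝔤 ⊗ 𝔤 → T(𝔤)`. -/
def tι₂ {m n : ℕ} : sl m n ⊗[ℂ] sl m n →ₗ[ℂ] T m n :=
  TensorProduct.lift ((LinearMap.mul ℂ (T m n)).compl₁₂ tι tι)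

/-- The relations `X Y - (-1)^{|X||Y|} Y X = [X, Y]` for homogeneous `X`, `Y`. -/
def EnvRel (m n : ℕ) (a b : T m n) : Prop :=
  ∃ (p q : ZMod 2) (X Y : sl m n), IsHomog p X ∧ IsHomog q Y ∧
    a = tι X * tι Y - sgn (p * q) • (tι Y * tι X) ∧ b = tι (bracket X Y)

/-- The universal enveloping algebra `U(𝔤)` of the Lie superalgebra `𝔤 = 𝔰𝔩(m|n)`. -/
def U (m n : ℕ) : Type := RingQuot (EnvRel m n)

instance (m n : ℕ) : Ring (U m n) := inferInstanceAs (Ring (RingQuot (EnvRel m n)))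

instance (m n : ℕ) : Algebra ℂ (U m n) := inferInstanceAs (Algebra ℂ (RingQuot (EnvRel m n)))

/-- The projection `T(𝔤) → U(𝔤)`. -/
def toU (m n : ℕ) : T m n →ₐ[ℂ] U m n := RingQuot.mkAlgHom ℂ (EnvRel m n)

/-- The canonical map `𝔤 → U(𝔤)`. -/
def uι {m n : ℕ} : sl m n →ₗ[ℂ] U m n := (toU m n).toLinearMap ∘ₗ tι

theorem uι_apply {m n : ℕ} (X : sl m n) : uι X = toU m n (tι X) := rfl

theorem toU_rel {m n : ℕ} {a b : T m n} (h : EnvRel m n a b) : toU m n a = toU m n b :=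
  RingQuot.mkAlgHom_rel ℂ h

theorem uι_rel {m n : ℕ} {p q : ZMod 2} {X Y : sl m n} (hX : IsHomog p X) (hY : IsHomog q Y) :
    uι X * uι Y - sgn (p * q) • (uι Y * uι X) = uι (bracket X Y) := by
  have h := toU_rel (show EnvRel m n _ _ from ⟨p, q, X, Y, hX, hY, rfl, rfl⟩)
  rw [map_sub, map_smul, map_mul, map_mul] at h
  exact h

/-- The universal property of `U(𝔤)`. -/
def liftU {m n : ℕ} {A : Type*} [Ring A] [Algebra ℂ A] (f : sl m n →ₗ[ℂ] A)
    (hf : ∀ (p q : ZMod 2) (X Y : sl m n), IsHomog p X → IsHomog q Y →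
      f X * f Y - sgn (p * q) • (f Y * f X) = f (bracket X Y)) : U m n →ₐ[ℂ] A :=
  RingQuot.liftAlgHom ℂ ⟨TensorAlgebra.lift ℂ f, by
    rintro a b ⟨p, q, X, Y, hX, hY, rfl, rfl⟩
    rw [map_sub, map_smul, map_mul, map_mul]
    simp only [TensorAlgebra.lift_ι_apply]
    exact hf p q X Y hX hY⟩

theorem liftU_ι {m n : ℕ} {A : Type*} [Ring A] [Algebra ℂ A] (f : sl m n →ₗ[ℂ] A)
    (hf : ∀ (p q : ZMod 2) (X Y : sl m n), IsHomog p X → IsHomog q Y →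
      f X * f Y - sgn (p * q) • (f Y * f X) = f (bracket X Y)) (X : sl m n) :
    liftU f hf (uι X) = f X :=
  (RingQuot.liftAlgHom_mkAlgHom_apply ℂ (TensorAlgebra.lift ℂ f) _ _).trans
    (TensorAlgebra.lift_ι_apply f X)

theorem comp_comp {m n : ℕ} (p q : ZMod 2) (X : sl m n) :
    comp p (comp q X) = if p = q then comp q X else 0 := by
  apply Subtype.ext
  ext i j
  by_cases hpq : p = q
  · subst hpq
    by_cases h : par i + par j = p <;> simp [comp, matComp, h]
  · by_cases h : par i + par j = p
    · simp [comp, matComp, hpq, h]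
    · simp [comp, matComp, hpq, h]

theorem IsHomog.comp_eq {m n : ℕ} {q : ZMod 2} {X : sl m n} (hX : IsHomog q X) (p : ZMod 2) :
    comp p X = if p = q then X else 0 := by
  have h : comp q X = X := hX
  have h2 := comp_comp p q X
  rwa [h] at h2

theorem isHomog_comp {m n : ℕ} (p : ZMod 2) (X : sl m n) : IsHomog p (comp p X) := by
  simp [IsHomog, comp_comp]

theorem comp_zero_add_comp_one {m n : ℕ} (X : sl m n) : comp 0 X + comp 1 X = X := by
  apply Subtype.ext
  ext i j
  rcases zmod2_cases (par i + par j) with h | h <;> simp [comp, matComp, h]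

theorem IsHomog.apply_eq_zero {m n : ℕ} {p : ZMod 2} {X : sl m n} (hX : IsHomog p X)
    {i j : Idx m n} (h : par i + par j ≠ p) : (X : Mat m n) i j = 0 := by
  have h1 : comp p X = X := hX
  rw [← h1]
  simp [comp, matComp, h]

theorem IsHomog.bracket {m n : ℕ} {p q : ZMod 2} {X Y : sl m n} (hX : IsHomog p X)
    (hY : IsHomog q Y) : IsHomog (p + q) (bracket X Y) := by
  apply Subtype.ext
  ext i k
  by_cases h : par i + par k = p + q
  · simp [comp, matComp, h]
  · have h0 : (SLSuper.bracket X Y : Mat m n) i k = 0 := by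
      simp only [SLSuper.bracket, matBracket, LinearMap.mk₂_apply, Matrix.of_apply]
      refine Finset.sum_eq_zero fun j _ => ?_
      have e1 : (X : Mat m n) i j * (Y : Mat m n) j k = 0 := by
        by_cases h1 : par i + par j = p
        · rw [hY.apply_eq_zero (i := j) (j := k), mul_zero]
          intro h2
          apply h
          rw [← h1, ← h2]
          generalize par i = a
          generalize par j = b
          generalize par k = c
          revert a b c; decide
        · rw [hX.apply_eq_zero h1, zero_mul]
      have e2 : (Y : Mat m n) i j * (X : Mat m n) j k = 0 := by
        by_cases h1 : par i + par j = q
        · rw [hX.apply_eq_zero (i := j) (j := k), mul_zero]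
          intro h2
          apply h
          rw [← h1, ← h2]
          generalize par i = a
          generalize par j = b
          generalize par k = c
          revert a b c; decide
        · rw [hY.apply_eq_zero h1, zero_mul]
      rw [e1, e2]
      ring
    simp [comp, matComp, h, h0]

/-- The parity automorphism of `U(𝔤)`: it is `(-1)^p` on the part of parity `p`. -/
def parityAut (m n : ℕ) : U m n →ₐ[ℂ] U m n :=
  liftU (uι ∘ₗ (comp 0 - comp 1)) fun p q X Y hX hY => by
    have h := uι_rel hX hY
    have hXY := hX.bracket hY
    simp only [LinearMap.comp_apply, LinearMap.sub_apply, hX.comp_eq, hY.comp_eq, hXY.comp_eq]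
    rcases zmod2_cases p with rfl | rfl <;> rcases zmod2_cases q with rfl | rfl <;>
      simp [sgn, show (1 : ZMod 2) + 1 = 0 from rfl] at h ⊢ <;> rw [← h] <;> abel

/-- An auxiliary ordinary antiautomorphism of `U(𝔤)`: it is `-X` on even and `i X` on odd
elements `X` of `𝔤`. -/
def auxAnti (m n : ℕ) : U m n →ₐ[ℂ] (U m n)ᵐᵒᵖ :=
  liftU ((MulOpposite.opLinearEquiv ℂ).toLinearMap ∘ₗ uι ∘ₗ (Complex.I • comp 1 - comp 0))
    fun p q X Y hX hY => by
    have h := uι_rel hX hY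
    have hXY := hX.bracket hY
    apply MulOpposite.unop_injective
    simp only [LinearMap.comp_apply, LinearMap.sub_apply, LinearMap.smul_apply, hX.comp_eq,
      hY.comp_eq, hXY.comp_eq]
    rcases zmod2_cases p with rfl | rfl <;> rcases zmod2_cases q with rfl | rfl <;>
      simp [sgn, show (1 : ZMod 2) + 1 = 0 from rfl, smul_smul] at h ⊢ <;>
      rw [← h] <;> simp [smul_sub] <;> abel

/-- The canonical antiautomorphism `τ` of `U(𝔤)`: the linear map with `τ(X) = -X` for `X ∈ 𝔤` and
`τ(u v) = (-1)^{|u||v|} τ(v) τ(u)` for homogeneous `u`, `v`; see `tau_one`, `tau_ι`, `tau_mul`. It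
equals `auxAnti` on the even part and `i` times `auxAnti` on the odd part of `U(𝔤)`. -/
def tau (m n : ℕ) : U m n →ₗ[ℂ] U m n :=
  (MulOpposite.opLinearEquiv ℂ).symm.toLinearMap ∘ₗ (auxAnti m n).toLinearMap ∘ₗ
    (((1 + Complex.I) / 2) • LinearMap.id + ((1 - Complex.I) / 2) • (parityAut m n).toLinearMap)

theorem parityAut_ι {m n : ℕ} (X : sl m n) :
    parityAut m n (uι X) = uι (comp 0 X) - uι (comp 1 X) := by
  rw [parityAut, liftU_ι]
  simp

theorem unop_auxAnti_ι {m n : ℕ} (X : sl m n) :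
    (auxAnti m n (uι X)).unop = Complex.I • uι (comp 1 X) - uι (comp 0 X) := by
  rw [auxAnti, liftU_ι]
  simp

theorem tau_apply {m n : ℕ} (u : U m n) :
    tau m n u = ((1 + Complex.I) / 2) • (auxAnti m n u).unop +
      ((1 - Complex.I) / 2) • (auxAnti m n (parityAut m n u)).unop := by
  simp [tau]

theorem tau_one (m n : ℕ) : tau m n 1 = 1 := by
  rw [tau_apply]
  simp only [map_one, MulOpposite.unop_one, ← add_smul]
  ring_nf
  simp

theorem tau_of_homog {m n : ℕ} {p : ZMod 2} {u : U m n} (hu : parityAut m n u = sgn p • u) :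
    tau m n u = (if p = 0 then (1 : ℂ) else Complex.I) • (auxAnti m n u).unop := by
  rw [tau_apply, hu, map_smul, MulOpposite.unop_smul, smul_smul, ← add_smul]
  congr 1
  rcases zmod2_cases p with rfl | rfl <;> simp [sgn] <;> ring

theorem parityAut_of_isHomog {m n : ℕ} {p : ZMod 2} {X : sl m n} (hX : IsHomog p X) :
    parityAut m n (uι X) = sgn p • uι X := by
  rw [parityAut_ι, hX.comp_eq, hX.comp_eq]
  rcases zmod2_cases p with rfl | rfl <;> simp [sgn]

theorem tau_ι {m n : ℕ} (X : sl m n) : tau m n (uι X) = -uι X := by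
  have key : ∀ (p : ZMod 2) (Y : sl m n), IsHomog p Y → tau m n (uι Y) = -uι Y := by
    intro p Y hY
    rw [tau_of_homog (parityAut_of_isHomog hY), unop_auxAnti_ι, hY.comp_eq, hY.comp_eq]
    rcases zmod2_cases p with rfl | rfl <;> simp [smul_smul]
  rw [← comp_zero_add_comp_one X, map_add, map_add, key 0 _ (isHomog_comp 0 X),
    key 1 _ (isHomog_comp 1 X)]
  abel

theorem tau_mul {m n : ℕ} {p q : ZMod 2} {u v : U m n} (hu : parityAut m n u = sgn p • u)
    (hv : parityAut m n v = sgn q • v) :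
    tau m n (u * v) = sgn (p * q) • (tau m n v * tau m n u) := by
  have huv : parityAut m n (u * v) = sgn (p + q) • (u * v) := by
    rw [map_mul, hu, hv, smul_mul_smul_comm]
    congr 1
    rcases zmod2_cases p with rfl | rfl <;> rcases zmod2_cases q with rfl | rfl <;>
      simp [sgn, show (1 : ZMod 2) + 1 = 0 from rfl]
  rw [tau_of_homog huv, tau_of_homog hu, tau_of_homog hv, map_mul, MulOpposite.unop_mul,
    smul_mul_smul_comm, smul_smul]
  congr 1
  rcases zmod2_cases p with rfl | rfl <;> rcases zmod2_cases q with rfl | rfl <;>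
    simp [sgn, show (1 : ZMod 2) + 1 = 0 from rfl]

/-! ### Ideals -/

/-- A two-sided ideal of `U(𝔤)` as a complex vector space. -/
def idealSubmodule {m n : ℕ} (K : TwoSidedIdeal (U m n)) : Submodule ℂ (U m n) :=
  (TwoSidedIdeal.asIdeal K).restrictScalars ℂ

/-- `K` has infinite codimension in `U(𝔤)`. -/
def InfiniteCodim {m n : ℕ} (K : TwoSidedIdeal (U m n)) : Prop :=
  ¬ FiniteDimensional ℂ (U m n ⧸ idealSubmodule K)

/-- The canonical filtration of `U(𝔤)`: the span of the products of at most `k` elements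
of `𝔤`. -/
def filt (m n k : ℕ) : Submodule ℂ (U m n) :=
  ⨆ j ∈ Finset.range (k + 1), LinearMap.range (uι (m := m) (n := n)) ^ j

/-- `gr(K) ∩ ⊙² 𝔤`, the part of degree two of the graded ideal of `K`. The part of degree two of
`gr(U(𝔤)) = ⊙ 𝔤` is `U₂ / U₁`, and `⊙² 𝔤` is mapped to it by multiplication; the supersymmetric
tensors that belong to `gr(K)` are those whose image in `U(𝔤)` agrees with an element of `K` up to
terms of degree at most one. -/
def grTwo {m n : ℕ} (K : TwoSidedIdeal (U m n)) : Submodule ℂ (sl m n ⊗[ℂ] sl m n) :=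
  symSq m n ⊓
    (idealSubmodule K ⊔ filt m n 1).comap ((toU m n).toLinearMap ∘ₗ tι₂)

/-- The ideal `𝒥_c` of `T(𝔤)`, generated by the elements
`X ⊗ Y - X ⊚ Y - ½ [X, Y] - c ⟨X, Y⟩` for `X, Y ∈ 𝔤`. -/
def tensorIdeal (m n : ℕ) (c : ℂ) : TwoSidedIdeal (T m n) :=
  TwoSidedIdeal.span {t | ∃ (X Y : sl m n) (s : sl m n ⊗[ℂ] sl m n), IsCartanPart X Y s ∧
    t = tι₂ (X ⊗ₜ[ℂ] Y - s) - (1 / 2 : ℂ) • tι (bracket X Y) -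
      algebraMap ℂ (T m n) (c * killing X Y)}

/-- The ideal `J_c` of `U(𝔤)`: the image of `𝒥_c` under the projection `T(𝔤) → U(𝔤)`. -/
def quadraticIdeal (m n : ℕ) (c : ℂ) : TwoSidedIdeal (U m n) :=
  (tensorIdeal m n c).map (toU m n)

/-- The critical parameter `-1 / (8 (m - n + 1))`. -/
def criticalParam (m n : ℕ) : ℂ := -1 / (8 * ((m : ℂ) - n + 1))

/-- The Joseph ideal. -/
def josephIdeal (m n : ℕ) : TwoSidedIdeal (U m n) := quadraticIdeal m n (criticalParam m n)

end SLSuper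

end

/-!
The proof compares `K` with the Joseph ideal through their elements of degree two.

*Elements of degree two.* Since `K` has infinite codimension, it meets `𝔤` only in zero
(`eq_zero_of_uι_mem`), and since it is stable under `τ`, every tensor in `gr(K) ∩ ⊙² 𝔤` lifts to an
element of `K` that differs from its image in `U(𝔤)` by a scalar only (`exists_mulU_sub_mem`). This
scalar is an invariant functional on `𝔤 ⊗ 𝔤`, hence a multiple `c` of the Killing form
(`exists_eq_smul_killingTensor`). By assumption `gr(K) ∩ ⊙² 𝔤` is a complement of the Cartan product
in `⊙² 𝔤`, and together with the antisymmetric tensors it is the complement in `𝔤 ⊗ 𝔤`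
(`CartanIndices.isCartanDecomposition_sup`, `CartanIndices.cartanComplement_eq`). Therefore `K`
contains the generators of the quadratic ideal with parameter `c` (`quadraticIdeal_le`). No complete
reducibility is used here: the uniqueness of the Cartan product and of its complement is derived
from the vectors of highest weight.

*The parameter.* The complement of the Cartan product contains the quadratic minors
`E i j ⊗ E k l ∓ E k j ⊗ E i l`, for the projection to the Cartan product vanishes on the submodule
they span, in which the highest weight does not occur (`CartanIndices.minorTensor_mem`). After a
shift of the generators `E i j` by scalars, the relations modulo `K` say that the minors of the
matrix `F` of generators vanish up to a scalar correction; reducing `F o r * F r t * F t o` in two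
ways shows that the correction is zero, so that `c` is the critical parameter (`eq_criticalParam`).
Hence `J ≤ K` for the Joseph ideal `J`.

*Simplicity.* In `U(𝔤) / J` the generators satisfy the relations of the operators `x_i ∂_j` on
superpolynomials, homogeneous of degree `-(m - n) / 2` (`MinorGenerators`). Such an algebra is
simple (`MinorGenerators.one_mem_of_ne_zero`): for two even indices `o ≠ t` the element
`E = F o t` is no left zero divisor, after multiplication by a power of `E` every element lies in
the subalgebra generated by the `F o l` and the `F i t`, and supercommutators with suitable
generators act there like `E` times partial derivatives. So a nonzero ideal contains a nonzero
polynomial in `E`, thus a power of `E`, and finally, by `m > n`, the unit. As `1 ∉ K`, this forces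
`K = J`.
-/

open scoped TensorProduct

noncomputable section

namespace SLSuper

/-! ### Signs and eigenvectors -/

theorem sgn_zero : sgn 0 = 1 := if_pos rfl

theorem sgn_mul_sgn (p : ZMod 2) : sgn p * sgn p = 1 := by
  rcases zmod2_cases p with rfl | rfl <;> simp [sgn]

theorem sgn_add (p q : ZMod 2) : sgn (p + q) = sgn p * sgn q := by
  rcases zmod2_cases p with rfl | rfl <;> rcases zmod2_cases q with rfl | rfl <;>
    simp [sgn, show (1 : ZMod 2) + 1 = 0 from rfl]

theorem sgn_ne_zero (p : ZMod 2) : sgn p ≠ 0 := by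
  rcases zmod2_cases p with rfl | rfl <;> simp [sgn]

theorem zmod2_add_self (p : ZMod 2) : p + p = 0 := by revert p; decide

theorem zmod2_mul_self (p : ZMod 2) : p * p = p := by revert p; decide

section Eigen

variable {V ι : Type*} [AddCommGroup V] [Module ℂ V]

theorem aeval_apply_of_eigen {f : Module.End ℂ V} {c : ℂ} {v : V} (h : f v = c • v)
    (p : Polynomial ℂ) : Polynomial.aeval f p v = p.eval c • v := by
  by_cases hv : v = 0
  · simp [hv]
  · exact Module.End.aeval_apply_of_hasEigenvector ⟨Module.End.mem_eigenspace_iff.2 h, hv⟩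

open Polynomial in
theorem exists_isolating_polynomial (s : Finset ι) (μ : ι → ℂ) (c : ℂ) :
    ∃ p : ℂ[X], p.eval c = 1 ∧ ∀ i ∈ s, μ i ≠ c → p.eval (μ i) = 0 := by
  classical
  have h0 : ∏ i ∈ s with μ i ≠ c, (c - μ i) ≠ 0 :=
    Finset.prod_ne_zero_iff.2 fun i hi => sub_ne_zero.2 (Finset.mem_filter.1 hi).2.symm
  refine ⟨C (∏ i ∈ s with μ i ≠ c, (c - μ i))⁻¹ * ∏ i ∈ s with μ i ≠ c, (X - C (μ i)), ?_, ?_⟩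
  · simp [eval_prod, inv_mul_cancel₀ h0]
  · intro i hi hc
    rw [eval_mul, eval_prod _ _ (μ i)]
    exact mul_eq_zero_of_right _ (Finset.prod_eq_zero (Finset.mem_filter.2 ⟨hi, hc⟩) (by simp))

/-- A subspace stable under an endomorphism contains the sum of those summands of each of its
elements that are eigenvectors for a given eigenvalue. -/
theorem sum_eigen_mem {f : Module.End ℂ V} {W : Submodule ℂ V} (hW : ∀ x ∈ W, f x ∈ W)
    (s : Finset ι) (μ : ι → ℂ) (u : ι → V) (hu : ∀ i ∈ s, f (u i) = μ i • u i)
    (hs : ∑ i ∈ s, u i ∈ W) (c : ℂ) [DecidablePred fun i => μ i = c] :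
    ∑ i ∈ s with μ i = c, u i ∈ W := by
  obtain ⟨p, hp, hp'⟩ := exists_isolating_polynomial s μ c
  have h1 : Polynomial.aeval f p (∑ i ∈ s, u i) = ∑ i ∈ s with μ i = c, u i := by
    rw [map_sum, Finset.sum_filter]
    refine Finset.sum_congr rfl fun i hi => ?_
    rw [aeval_apply_of_eigen (hu i hi)]
    split_ifs with h
    · rw [h, hp, one_smul]
    · rw [hp' i hi h, zero_smul]
  rw [← h1]
  generalize ∑ i ∈ s, u i = x at hs
  clear h1 hp hp'
  induction p using Polynomial.induction_on' with
  | add p q h1 h2 => rw [map_add]; exact add_mem h1 h2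
  | monomial k a =>
    have h2 : (f ^ k) x ∈ W := by
      induction k with
      | zero => exact hs
      | succ k ih => rw [pow_succ']; exact hW _ ih
    rw [Polynomial.aeval_monomial]
    simpa [Algebra.algebraMap_eq_smul_one] using W.smul_mem a h2

/-- If an eigenvector is a sum of eigenvectors, then the summands with other eigenvalues may be
dropped. -/
theorem eq_sum_eigen {f : Module.End ℂ V} (s : Finset ι) (μ : ι → ℂ) (u : ι → V)
    (hu : ∀ i ∈ s, f (u i) = μ i • u i) {c : ℂ} (hc : f (∑ i ∈ s, u i) = c • ∑ i ∈ s, u i)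
    [DecidablePred fun i => μ i = c] : ∑ i ∈ s, u i = ∑ i ∈ s with μ i = c, u i := by
  obtain ⟨p, hp, hp'⟩ := exists_isolating_polynomial s μ c
  have h1 : Polynomial.aeval f p (∑ i ∈ s, u i) = ∑ i ∈ s with μ i = c, u i := by
    rw [map_sum, Finset.sum_filter]
    refine Finset.sum_congr rfl fun i hi => ?_
    rw [aeval_apply_of_eigen (hu i hi)]
    split_ifs with h
    · rw [h, hp, one_smul]
    · rw [hp' i hi h, zero_smul]
  rw [← h1, aeval_apply_of_eigen hc, hp, one_smul]

end Eigen

/-! ### Algebras generated by a supermatrix of elements -/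

/-- Elements `F i j` that generate the algebra `B` and satisfy the commutation relations of the
matrix units of `𝔤𝔩(m|n)`, where `B` has an endomorphism `π` which is the parity automorphism. -/
structure GLGenerators (m n : ℕ) (B : Type*) [Ring B] [Algebra ℂ B] where
  /-- The generators, the images of the matrix units. -/
  F : Idx m n → Idx m n → B
  /-- The parity automorphism. -/
  π : B →ₐ[ℂ] B
  π_F : ∀ i j, π (F i j) = sgn (par i + par j) • F i j
  comm : ∀ i j k l, F i j * F k l - sgn ((par i + par j) * (par k + par l)) • (F k l * F i j) =
    (if j = k then F i l else 0) -
      sgn ((par i + par j) * (par k + par l)) • (if i = l then F k j else 0)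
  gen : Algebra.adjoin ℂ (Set.range fun x : Idx m n × Idx m n => F x.1 x.2) = ⊤

namespace GLGenerators

variable {m n : ℕ} {B : Type*} [Ring B] [Algebra ℂ B] (D : GLGenerators m n B)

theorem induction {P : B → Prop} (algebraMap : ∀ c, P (algebraMap ℂ B c))
    (F : ∀ i j, P (D.F i j)) (add : ∀ x y, P x → P y → P (x + y))
    (mul : ∀ x y, P x → P y → P (x * y)) (x : B) : P x := by
  have hx : x ∈ Algebra.adjoin ℂ (Set.range fun x : Idx m n × Idx m n => D.F x.1 x.2) := by
    rw [D.gen]; trivial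
  refine Algebra.adjoin_induction ?_ algebraMap (fun x y _ _ => add x y)
    (fun x y _ _ => mul x y) hx
  rintro _ ⟨⟨i, j⟩, rfl⟩
  exact F i j

theorem comm_even {i j : Idx m n} (h : par i + par j = 0) (k l : Idx m n) :
    D.F i j * D.F k l - D.F k l * D.F i j =
      (if j = k then D.F i l else 0) - if i = l then D.F k j else 0 := by
  have := D.comm i j k l
  simpa [h, sgn_zero] using this

theorem comm_diag (i k l : Idx m n) :
    D.F i i * D.F k l - D.F k l * D.F i i =
      (if i = k then D.F k l else 0) - if i = l then D.F k l else 0 := by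
  rw [D.comm_even (zmod2_add_self _)]
  congr 1
  · split_ifs with h <;> simp [h]
  · split_ifs with h <;> simp [h]

/-- The `p`-th power of the parity automorphism. -/
def twist (p : ZMod 2) : B →ₐ[ℂ] B := if p = 0 then AlgHom.id ℂ B else D.π

theorem twist_F (p : ZMod 2) (i j : Idx m n) :
    D.twist p (D.F i j) = sgn (p * (par i + par j)) • D.F i j := by
  rcases zmod2_cases p with rfl | rfl
  · simp [twist, sgn_zero]
  · simp [twist, D.π_F]

/-- The supercommutator with an element `d` of parity `p`. -/
def sad (p : ZMod 2) (d : B) : B →ₗ[ℂ] B :=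
  LinearMap.mulLeft ℂ d - LinearMap.mulRight ℂ d ∘ₗ (D.twist p).toLinearMap

theorem sad_apply (p : ZMod 2) (d u : B) : D.sad p d u = d * u - D.twist p u * d := rfl

theorem sad_one (p : ZMod 2) (d : B) : D.sad p d 1 = 0 := by simp [sad_apply]

theorem sad_mul (p : ZMod 2) (d u v : B) :
    D.sad p d (u * v) = D.sad p d u * v + D.twist p u * D.sad p d v := by
  simp only [sad_apply, map_mul]
  noncomm_ring

theorem sad_F (i j k l : Idx m n) :
    D.sad (par i + par j) (D.F i j) (D.F k l) = (if j = k then D.F i l else 0) -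
      sgn ((par i + par j) * (par k + par l)) • (if i = l then D.F k j else 0) := by
  rw [← D.comm, sad_apply, twist_F, smul_mul_assoc]

/-- The degree for the grading of `𝔤𝔩(m|n)` in which the odd matrix units have degrees `±1`. -/
def oddDegree (i : Idx m n) : ℤ := if par i = 0 then 0 else 1

/-- The sum of the odd diagonal matrix units; its adjoint action detects parity. -/
def grading : B := ∑ i, (oddDegree i : ℂ) • D.F i i

theorem grading_comm (k l : Idx m n) :
    D.grading * D.F k l - D.F k l * D.grading =
      ((oddDegree k - oddDegree l : ℤ) : ℂ) • D.F k l := by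
  simp only [grading, Finset.sum_mul, Finset.mul_sum, ← Finset.sum_sub_distrib, smul_mul_assoc,
    mul_smul_comm, ← smul_sub, D.comm_diag]
  simp [smul_sub, Finset.sum_sub_distrib, sub_smul]

/-- The part of `B` of degree `k` for the grading of `𝔤𝔩(m|n)` with odd matrix units in degrees
`±1`. -/
def degreePart (k : ℤ) : Submodule ℂ B where
  carrier := {u | D.grading * u - u * D.grading = (k : ℂ) • u ∧ D.π u = sgn (k : ZMod 2) • u}
  zero_mem' := by simp
  add_mem' := by
    rintro u v ⟨h1, h2⟩ ⟨h3, h4⟩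
    exact ⟨by rw [smul_add, ← h1, ← h3]; noncomm_ring, by rw [map_add, h2, h4, smul_add]⟩
  smul_mem' := by
    rintro c u ⟨h1, h2⟩
    refine ⟨?_, by rw [map_smul, h2, smul_comm]⟩
    rw [smul_comm, ← h1, mul_smul_comm, smul_mul_assoc, smul_sub]

theorem mul_mem_degreePart {k l : ℤ} {u v : B} (hu : u ∈ D.degreePart k)
    (hv : v ∈ D.degreePart l) : u * v ∈ D.degreePart (k + l) := by
  obtain ⟨h1, h2⟩ := hu
  obtain ⟨h3, h4⟩ := hv
  constructor
  · have : D.grading * (u * v) - u * v * D.grading =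
        (D.grading * u - u * D.grading) * v + u * (D.grading * v - v * D.grading) := by
      noncomm_ring
    rw [this, h1, h3, smul_mul_assoc, mul_smul_comm, ← add_smul]
    push_cast
    rfl
  · rw [map_mul, h2, h4, smul_mul_smul_comm, ← sgn_add]
    push_cast
    rfl

theorem iSup_degreePart : ⨆ k, D.degreePart k = ⊤ := by
  rw [eq_top_iff]
  rintro u -
  have hle := fun k => le_iSup D.degreePart k
  refine D.induction (P := fun u => u ∈ ⨆ k, D.degreePart k) ?_ ?_ ?_ ?_ u
  · intro c
    refine hle 0 ⟨?_, ?_⟩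
    · rw [Algebra.commutes]; simp
    · simp [sgn_zero]
  · intro i j
    refine hle (oddDegree i - oddDegree j) ⟨D.grading_comm i j, ?_⟩
    rw [D.π_F]
    congr 2
    unfold oddDegree
    rcases zmod2_cases (par i) with h | h <;> rcases zmod2_cases (par j) with h' | h' <;>
      simp [h, h', show (1 : ZMod 2) + 1 = 0 from rfl]
  · exact fun x y => add_mem
  · intro x y hx hy
    refine Submodule.iSup_induction _ (motive := fun x => x * y ∈ ⨆ k, D.degreePart k) hx ?_
      (by simp) (fun a b ha hb => by rw [add_mul]; exact add_mem ha hb)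
    intro k x hx
    refine Submodule.iSup_induction _ (motive := fun y => x * y ∈ ⨆ k, D.degreePart k) hy ?_
      (by simp) (fun a b ha hb => by rw [mul_add]; exact add_mem ha hb)
    exact fun l y hy => hle _ (D.mul_mem_degreePart hx hy)

/-- Every two-sided ideal is stable under the parity automorphism, because the parity can be read
off from the inner derivation `D.grading`. -/
theorem π_mem (I : Ideal B) [I.IsTwoSided] {u : B} (hu : u ∈ I) : D.π u ∈ I := by
  classical
  have hu' : u ∈ ⨆ k, D.degreePart k := by rw [D.iSup_degreePart]; trivial
  obtain ⟨f, hf, rfl⟩ := (Submodule.mem_iSup_iff_exists_finsupp _ _).1 hu'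
  have key : ∀ k ∈ f.support, f k ∈ I := by
    intro k hk
    have := sum_eigen_mem (W := I.restrictScalars ℂ)
      (f := LinearMap.mulLeft ℂ D.grading - LinearMap.mulRight ℂ D.grading)
      (fun x hx => I.sub_mem (I.mul_mem_left _ hx) (I.mul_mem_right _ hx)) f.support
      (fun k => (k : ℂ)) f (fun i _ => (hf i).1) hu (k : ℂ)
    simpa [Finset.filter_eq', Finsupp.mem_support_iff.1 hk] using this
  rw [Finsupp.sum, map_sum]
  refine I.sum_mem fun k hk => ?_
  rw [(hf k).2]
  exact Submodule.smul_of_tower_mem I _ (key k hk)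

theorem twist_mem (I : Ideal B) [I.IsTwoSided] (p : ZMod 2) {u : B} (hu : u ∈ I) :
    D.twist p u ∈ I := by
  rcases zmod2_cases p with rfl | rfl
  · simpa [twist] using hu
  · simpa [twist] using D.π_mem I hu

theorem sad_mem (I : Ideal B) [I.IsTwoSided] (p : ZMod 2) (d : B) {u : B} (hu : u ∈ I) :
    D.sad p d u ∈ I :=
  I.sub_mem (I.mul_mem_left _ hu) (I.mul_mem_right _ (D.twist_mem I p hu))

end GLGenerators
end SLSuper

namespace SLSuper

/-! ### Descending a filtration with an Euler operator -/

namespace GLGenerators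

variable {m n : ℕ} {B : Type*} [Ring B] [Algebra ℂ B] (D : GLGenerators m n B)

/-- Letters `g z` of weight zero and `g j` of weight one, together with elements `d j` whose
superderivations `[d j, ·]` behave like `E ∂/∂(g j)` on the words in these letters, modulo words
of smaller weight. -/
structure EulerSystem (E : B) (Z J : Type*) [DecidableEq J] where
  /-- The letters. -/
  g : Z ⊕ J → B
  /-- The parities of the letters. -/
  q : Z ⊕ J → ZMod 2
  /-- The elements whose supercommutators differentiate words. -/
  d : J → B
  /-- The parities of the elements `d j`. -/
  p : J → ZMod 2
  twist_g : ∀ r t, D.twist r (g t) = sgn (r * q t) • g t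
  sad_inl : ∀ j z, D.sad (p j) (d j) (g (Sum.inl z)) = 0
  sad_inr : ∀ j i, D.sad (p j) (d j) (g (Sum.inr i)) = if j = i then E else 0
  E_mem : E ∈ Submodule.span ℂ {x | ∃ l : List (Z ⊕ J),
    (l.map (Sum.elim (fun _ => 0) fun _ => 1)).sum < 1 ∧ x = (l.map g).prod}
  comm_E : ∀ t, g t * E - E * g t ∈ Submodule.span ℂ {x | ∃ l : List (Z ⊕ J),
    (l.map (Sum.elim (fun _ => 0) fun _ => 1)).sum < Sum.elim (fun _ => 0) (fun _ => 1) t ∧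
      x = (l.map g).prod}
  comm_g : ∀ j t, sgn (p j * q t) • (g (Sum.inr j) * g t) - g t * g (Sum.inr j) ∈
    Submodule.span ℂ {x | ∃ l : List (Z ⊕ J), (l.map (Sum.elim (fun _ => 0) fun _ => 1)).sum <
      Sum.elim (fun _ => 0) (fun _ => 1) t + 1 ∧ x = (l.map g).prod}

namespace EulerSystem

variable {D} {E : B} {Z J : Type*}

/-- The weight of a word. -/
def weight (l : List (Z ⊕ J)) : ℕ := (l.map (Sum.elim (fun _ => 0) fun _ => 1)).sum

theorem weight_append (l l' : List (Z ⊕ J)) : weight (l ++ l') = weight l + weight l' := by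
  simp [weight]

theorem weight_cons (t : Z ⊕ J) (l : List (Z ⊕ J)) : weight (t :: l) = weight [t] + weight l := by
  simp [weight]

variable [DecidableEq J] (X : EulerSystem D E Z J)

/-- The product of the letters of a word. -/
def word (l : List (Z ⊕ J)) : B := (l.map X.g).prod

/-- The span of the words of weight less than `s`. -/
def below (s : ℕ) : Submodule ℂ B := Submodule.span ℂ {x | ∃ l, weight l < s ∧ x = X.word l}

theorem word_mem {l : List (Z ⊕ J)} {s : ℕ} (h : weight l < s) : X.word l ∈ X.below s :=
  Submodule.subset_span ⟨l, h, rfl⟩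

theorem below_mono {s t : ℕ} (h : s ≤ t) : X.below s ≤ X.below t :=
  Submodule.span_mono fun _ ⟨l, hl, hx⟩ => ⟨l, hl.trans_le h, hx⟩

theorem below_zero : X.below 0 = ⊥ := by
  rw [below, Submodule.span_eq_bot]
  rintro x ⟨l, hl, -⟩
  exact absurd hl (Nat.not_lt_zero _)

theorem word_append (l l' : List (Z ⊕ J)) : X.word (l ++ l') = X.word l * X.word l' := by
  simp [word]

theorem mul_mem {a b : ℕ} {x y : B} (hx : x ∈ X.below (a + 1)) (hy : y ∈ X.below b) :
    x * y ∈ X.below (a + b) := by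
  refine Submodule.span_induction (p := fun x _ => x * y ∈ X.below (a + b)) ?_ (by simp)
    (fun x x' _ _ h h' => by rw [add_mul]; exact add_mem h h')
    (fun c x _ h => by rw [smul_mul_assoc]; exact Submodule.smul_mem _ _ h) hx
  rintro x ⟨l, hl, rfl⟩
  refine Submodule.span_induction (p := fun y _ => X.word l * y ∈ X.below (a + b)) ?_ (by simp)
    (fun y y' _ _ h h' => by rw [mul_add]; exact add_mem h h')
    (fun c y _ h => by rw [mul_smul_comm]; exact Submodule.smul_mem _ _ h) hy
  rintro y ⟨l', hl', rfl⟩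
  rw [← X.word_append]
  exact X.word_mem (by rw [weight_append]; omega)

theorem g_mem (t : Z ⊕ J) : X.g t ∈ X.below (weight [t] + 1) := by
  have := X.word_mem (l := [t]) (Nat.lt_succ_self _)
  simpa [word] using this

theorem word_cons (t : Z ⊕ J) (l : List (Z ⊕ J)) : X.word (t :: l) = X.g t * X.word l := by
  simp [word]

theorem exists_mem_below {x : B} (hx : x ∈ Algebra.adjoin ℂ (Set.range X.g)) :
    ∃ s, x ∈ X.below (s + 1) := by
  refine Algebra.adjoin_induction ?_ ?_ ?_ ?_ hx
  · rintro _ ⟨t, rfl⟩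
    exact ⟨_, X.g_mem t⟩
  · intro c
    refine ⟨0, ?_⟩
    rw [Algebra.algebraMap_eq_smul_one]
    exact Submodule.smul_mem _ _ (X.word_mem (l := []) (by simp [weight]))
  · rintro x y - - ⟨s, hs⟩ ⟨t, ht⟩
    exact ⟨max s t, add_mem (X.below_mono (by simp) hs) (X.below_mono (by simp) ht)⟩
  · rintro x y - - ⟨s, hs⟩ ⟨t, ht⟩
    exact ⟨s + t, X.mul_mem (b := t + 1) hs ht⟩

theorem sad_word_mem (j : J) (l : List (Z ⊕ J)) :
    D.sad (X.p j) (X.d j) (X.word l) ∈ X.below (weight l) := by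
  induction l with
  | nil => simp [word, sad_one]
  | cons t l ih =>
    rw [word_cons, sad_mul, X.twist_g, weight_cons]
    refine add_mem ?_ ?_
    · rcases t with z | i
      · simp [X.sad_inl]
      · rw [X.sad_inr]
        split_ifs
        · have := X.mul_mem (a := 0) (b := weight l + 1) X.E_mem (X.word_mem (Nat.lt_succ_self _))
          refine X.below_mono ?_ this
          simp [weight]
        · simp
    · rw [smul_mul_assoc]
      exact Submodule.smul_mem _ _ (X.mul_mem (X.g_mem t) ih)

/-- Euler's identity modulo words of smaller weight. -/
theorem euler_word [Fintype J] (l : List (Z ⊕ J)) :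
    ∑ j, X.g (Sum.inr j) * D.sad (X.p j) (X.d j) (X.word l) - (weight l : ℂ) • (E * X.word l) ∈
      X.below (weight l) := by
  induction l with
  | nil => simp [word, sad_one, weight]
  | cons t l ih =>
    have h1 : ∑ j, X.g (Sum.inr j) * D.sad (X.p j) (X.d j) (X.word (t :: l)) -
        (weight (t :: l) : ℂ) • (E * X.word (t :: l)) =
        (∑ j, X.g (Sum.inr j) * D.sad (X.p j) (X.d j) (X.g t) * X.word l -
          (weight [t] : ℂ) • (E * X.g t * X.word l)) +
        ∑ j, (sgn (X.p j * X.q t) • (X.g (Sum.inr j) * X.g t) - X.g t * X.g (Sum.inr j)) *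
          D.sad (X.p j) (X.d j) (X.word l) +
        X.g t * (∑ j, X.g (Sum.inr j) * D.sad (X.p j) (X.d j) (X.word l) -
          (weight l : ℂ) • (E * X.word l)) +
        (weight l : ℂ) • ((X.g t * E - E * X.g t) * X.word l) := by
      have h2 : ∑ j, X.g (Sum.inr j) * D.sad (X.p j) (X.d j) (X.word (t :: l)) =
          ∑ j, X.g (Sum.inr j) * D.sad (X.p j) (X.d j) (X.g t) * X.word l +
          (∑ j, (sgn (X.p j * X.q t) • (X.g (Sum.inr j) * X.g t) - X.g t * X.g (Sum.inr j)) *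
            D.sad (X.p j) (X.d j) (X.word l) +
          X.g t * ∑ j, X.g (Sum.inr j) * D.sad (X.p j) (X.d j) (X.word l)) := by
        rw [Finset.mul_sum, ← Finset.sum_add_distrib, ← Finset.sum_add_distrib]
        refine Finset.sum_congr rfl fun j _ => ?_
        rw [word_cons, sad_mul, X.twist_g]
        simp only [mul_add, sub_mul, smul_mul_assoc, mul_smul_comm, mul_assoc]
        abel
      rw [h2, weight_cons, word_cons]
      push_cast
      simp only [mul_sub, sub_mul, add_smul, smul_sub, mul_smul_comm, mul_assoc]
      abel
    rw [h1, weight_cons]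
    have hwl : X.word l ∈ X.below (weight l + 1) := X.word_mem (Nat.lt_succ_self _)
    -- `[g t, E]` has smaller weight than `g t`.
    have hE : (X.g t * E - E * X.g t) * X.word l ∈ X.below (weight [t] + weight l) := by
      have h2 := X.comm_E t
      rcases t with z | i
      · have h3 : X.g (Sum.inl z) * E - E * X.g (Sum.inl z) ∈ X.below 0 := h2
        rw [below_zero, Submodule.mem_bot] at h3
        simp [h3]
      · have := X.mul_mem (a := 0) h2 hwl
        refine X.below_mono ?_ this
        simp [weight]
    refine add_mem (add_mem (add_mem ?_ ?_) (X.mul_mem (X.g_mem t) ih))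
      (Submodule.smul_mem _ _ hE)
    · rcases t with z | i
      · simp [X.sad_inl, weight]
      · have h3 : ∑ j, X.g (Sum.inr j) * D.sad (X.p j) (X.d j) (X.g (Sum.inr i)) * X.word l -
            (weight [(Sum.inr i : Z ⊕ J)] : ℂ) • (E * X.g (Sum.inr i) * X.word l) =
            (X.g (Sum.inr i) * E - E * X.g (Sum.inr i)) * X.word l := by
          simp [X.sad_inr, weight, sub_mul]
        rw [h3]
        exact hE
    · refine Submodule.sum_mem _ fun j _ => X.mul_mem ?_ (X.sad_word_mem j l)
      have := X.comm_g j t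
      refine X.below_mono (le_of_eq ?_) this
      simp [weight]

theorem sad_mem_below (j : J) {s : ℕ} {u : B} (hu : u ∈ X.below (s + 1)) :
    D.sad (X.p j) (X.d j) u ∈ X.below s := by
  have : X.below (s + 1) ≤ (X.below s).comap (D.sad (X.p j) (X.d j)) := by
    refine Submodule.span_le.2 ?_
    rintro _ ⟨l, hl, rfl⟩
    exact X.below_mono (Nat.lt_succ_iff.1 hl) (X.sad_word_mem j l)
  exact this hu

theorem euler [Fintype J] {s : ℕ} {u : B} (hu : u ∈ X.below (s + 1)) :
    ∑ j, X.g (Sum.inr j) * D.sad (X.p j) (X.d j) u - (s : ℂ) • (E * u) ∈ X.below s := by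
  refine Submodule.span_induction (p := fun u _ => ∑ j, X.g (Sum.inr j) *
    D.sad (X.p j) (X.d j) u - (s : ℂ) • (E * u) ∈ X.below s) ?_ (by simp) ?_ ?_ hu
  · rintro _ ⟨l, hl, rfl⟩
    rcases (Nat.lt_succ_iff.1 hl).eq_or_lt with h | h
    · rw [← h]
      exact X.euler_word l
    · have h1 := X.below_mono h.le (X.euler_word l)
      have h2 : E * X.word l ∈ X.below s := by
        simpa using X.mul_mem (a := 0) X.E_mem (X.word_mem h)
      have h3 := add_mem h1 (Submodule.smul_mem _ ((weight l : ℂ) - s) h2)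
      convert! h3 using 1
      module
  · intro x y _ _ h1 h2
    have h3 := add_mem h1 h2
    convert! h3 using 1
    simp only [map_add, mul_add, Finset.sum_add_distrib]
    module
  · intro c x _ h1
    have h3 := Submodule.smul_mem _ c h1
    convert! h3 using 1
    simp only [map_smul, mul_smul_comm, ← Finset.smul_sum]
    module

/-- A two-sided ideal that meets the span of all words meets the span of the words of weight zero,
provided that `E` is not a left zero divisor: as long as some `[d j, a]` is nonzero, it replaces
`a`; otherwise, by Euler's identity, `E a` has smaller weight. -/
theorem exists_mem_below_one [Fintype J] (hE : ∀ b, E * b = 0 → b = 0) (I : Ideal B)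
    [I.IsTwoSided] {s : ℕ} {a : B} (ha : a ∈ X.below (s + 1)) (haI : a ∈ I) (h0 : a ≠ 0) :
    ∃ b ∈ X.below 1, b ∈ I ∧ b ≠ 0 := by
  induction s generalizing a with
  | zero => exact ⟨a, ha, haI, h0⟩
  | succ s ih =>
    by_cases h : ∀ j, D.sad (X.p j) (X.d j) a = 0
    · have h1 := X.euler ha
      simp only [h, mul_zero, Finset.sum_const_zero, zero_sub] at h1
      refine ih h1 (I.neg_mem (Submodule.smul_of_tower_mem I _ (I.mul_mem_left _ haI))) ?_
      rw [neg_ne_zero]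
      refine smul_ne_zero (by exact_mod_cast Nat.succ_ne_zero s) fun h2 => h0 (hE a h2)
    · push Not at h
      obtain ⟨j, hj⟩ := h
      exact ih (X.sad_mem_below j ha) (D.sad_mem I _ _ haI) hj

end EulerSystem
end GLGenerators
end SLSuper

namespace SLSuper

/-! ### The quotient by the ideal of quadratic minors -/

/-- Generators as in `GLGenerators` that behave like the differential operators `x_i ∂_j` on
superpolynomials that are homogeneous of degree `-(m - n) / 2`: the normally ordered products
`x_i x_k ∂_j ∂_l` are supersymmetric in `x_i`, `x_k`, and the Euler operator is a scalar. -/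
structure MinorGenerators (m n : ℕ) (B : Type*) [Ring B] [Algebra ℂ B] extends
    GLGenerators m n B where
  minor : ∀ i j k l, F i j * F k l - (if j = k then F i l else 0) =
    sgn (par i * par j + par j * par k + par i * par k) •
      (F k j * F i l - if i = j then F k l else 0)
  trace : ∑ i, F i i = algebraMap ℂ B (-((m : ℂ) - n) / 2)

theorem sum_sgn_par (m n : ℕ) : ∑ i : Idx m n, sgn (par i) = (m : ℂ) - n := by
  simp [par, sgn, sub_eq_add_neg]

namespace MinorGenerators

variable {m n : ℕ} {B : Type*} [Ring B] [Algebra ℂ B] (D : MinorGenerators m n B)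
  {o t : Idx m n}

theorem comm_E (ho : par o = 0) (ht : par t = 0) (k l : Idx m n) :
    D.F o t * D.F k l - D.F k l * D.F o t =
      (if t = k then D.F o l else 0) - if o = l then D.F k t else 0 :=
  D.comm_even (by rw [ho, ht, add_zero]) k l

theorem E_mul (ho : par o = 0) (ht : par t = 0) (hot : o ≠ t) (k l : Idx m n) :
    D.F o t * D.F k l = D.F k t * D.F o l + if t = k then D.F o l else 0 := by
  have := D.minor o t k l
  rw [sub_eq_iff_eq_add] at this
  simpa [ho, ht, hot, sgn_zero] using this

/-- An ideal that contains a positive power of `F o t` contains the preceding power. -/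
theorem pow_mem_of_pow_succ_mem (hmn : n < m) (ho : par o = 0) (ht : par t = 0) (hot : o ≠ t)
    (I : Ideal B) [I.IsTwoSided] (k : ℕ) (hk : D.F o t ^ (k + 1) ∈ I) : D.F o t ^ k ∈ I := by
  have hto := hot.symm
  set E := D.F o t with hE
  have hk0 : (k : ℂ) + 1 ≠ 0 := Nat.cast_add_one_ne_zero k
  -- The commutator with `F t o`.
  have r1 : (D.F o o - D.F t t - (k : ℂ) • 1) * E ^ k ∈ I := by
    have h1 : E * D.F t o - D.F t o * E = D.F o o - D.F t t := by
      simpa using D.comm_E ho ht t o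
    have h2 : E * (D.F o o - D.F t t) - (D.F o o - D.F t t) * E = (-2 : ℂ) • E := by
      have h3 := D.comm_E ho ht o o
      have h4 := D.comm_E ho ht t t
      simp only [hto, hot, if_true, if_false] at h3 h4
      rw [mul_sub, sub_mul, sub_sub_sub_comm, h3, h4, hE]
      module
    have h3 : ∀ j : ℕ, E ^ j * (D.F o o - D.F t t) =
        (D.F o o - D.F t t - (2 * j : ℂ) • 1) * E ^ j := by
      intro j
      induction j with
      | zero => simp
      | succ j ih =>
        rw [pow_succ', mul_assoc, ih, ← mul_assoc, mul_sub, sub_eq_iff_eq_add.1 h2]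
        simp only [add_mul, sub_mul, smul_mul_assoc, mul_smul_comm, mul_one, one_mul, mul_assoc]
        push_cast
        module
    have h4 : ∀ j : ℕ, E ^ (j + 1) * D.F t o = D.F t o * E ^ (j + 1) +
        ((j : ℂ) + 1) • ((D.F o o - D.F t t - (j : ℂ) • 1) * E ^ j) := by
      intro j
      induction j with
      | zero => simp [← h1]
      | succ j ih =>
        rw [pow_succ, mul_assoc, sub_eq_iff_eq_add.1 h1, mul_add, ← mul_assoc (E ^ (j + 1)), ih,
          h3]
        simp only [add_mul, sub_mul, smul_mul_assoc, mul_assoc, one_mul, ← pow_succ]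
        push_cast
        module
    have h5 := I.sub_mem (I.mul_mem_right (D.F t o) hk) (I.mul_mem_left (D.F t o) hk)
    rw [h4, add_sub_cancel_left] at h5
    have h6 := Submodule.smul_of_tower_mem I ((k : ℂ) + 1)⁻¹ h5
    rwa [inv_smul_smul₀ hk0] at h6
  -- The commutators with `F i o` for the other indices `i`.
  have r2 : ∀ i, i ≠ o → i ≠ t → D.F i t * E ^ k ∈ I := by
    intro i hio hit
    have h1 : E * D.F i o - D.F i o * E = -D.F i t := by
      simpa [hit.symm] using D.comm_E ho ht i o
    have h2 : E * D.F i t - D.F i t * E = 0 := by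
      simpa [hit.symm, hot] using D.comm_E ho ht i t
    have h3 : ∀ j : ℕ, E ^ j * D.F i t = D.F i t * E ^ j := fun j =>
      (Commute.pow_left (sub_eq_zero.1 h2) j)
    have h4 : ∀ j : ℕ, E ^ (j + 1) * D.F i o = D.F i o * E ^ (j + 1) -
        ((j : ℂ) + 1) • (D.F i t * E ^ j) := by
      intro j
      induction j with
      | zero => simp [sub_eq_iff_eq_add.1 h1]; abel
      | succ j ih =>
        rw [pow_succ, mul_assoc, sub_eq_iff_eq_add.1 h1, mul_add, ← mul_assoc (E ^ (j + 1)), ih,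
          mul_neg, ← pow_succ, h3]
        simp only [sub_mul, smul_mul_assoc, mul_assoc, ← pow_succ]
        push_cast
        module
    have h5 := I.sub_mem (I.mul_mem_right (D.F i o) hk) (I.mul_mem_left (D.F i o) hk)
    rw [h4, sub_sub_cancel_left] at h5
    have h6 := Submodule.smul_of_tower_mem I (-((k : ℂ) + 1)⁻¹) h5
    rwa [neg_smul_neg, inv_smul_smul₀ hk0] at h6
  -- Their supercommutators with `F t i` relate `F i i` to `F t t`.
  have r3 : ∀ i, i ≠ o → i ≠ t →
      D.F i i * E ^ k - (sgn (par i) / ((k : ℂ) + 1)) • (D.F t t * E ^ k) ∈ I := by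
    intro i hio hit
    have h1 : E * D.F t i - D.F t i * E = D.F o i := by
      simpa [hio.symm] using D.comm_E ho ht t i
    have h2 : D.F i t * D.F o i = D.F i i * E := by
      have h3 := D.E_mul ho ht hot i i
      have h4 := D.comm_E ho ht i i
      simp only [hit.symm, hio.symm, if_false, add_zero, sub_zero] at h3 h4
      rw [← h3, ← sub_eq_zero, ← h4]
    have h3 : E * D.F i t - D.F i t * E = 0 := by
      simpa [hit.symm, hot] using D.comm_E ho ht i t
    have h3' : ∀ j : ℕ, E ^ j * D.F i t = D.F i t * E ^ j := fun j =>
      (Commute.pow_left (sub_eq_zero.1 h3) j)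
    have h6 : E * D.F o i - D.F o i * E = 0 := by
      simpa [hto, hio.symm] using D.comm_E ho ht o i
    have h6' : ∀ j : ℕ, E ^ j * D.F o i = D.F o i * E ^ j := fun j =>
      (Commute.pow_left (sub_eq_zero.1 h6) j)
    have h4 : ∀ j : ℕ, D.F i t * E ^ j * D.F t i =
        D.F i t * D.F t i * E ^ j + (j : ℂ) • (D.F i i * E ^ j) := by
      intro j
      induction j with
      | zero => simp
      | succ j ih =>
        rw [pow_succ, ← mul_assoc, mul_assoc _ E, sub_eq_iff_eq_add.1 h1, mul_add,
          ← mul_assoc _ (D.F t i), ih, mul_assoc (D.F i t) (E ^ j) (D.F o i), h6', ← mul_assoc,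
          h2]
        simp only [add_mul, smul_mul_assoc, mul_assoc, ← pow_succ, ← pow_succ']
        push_cast
        module
    have h5 : D.F t i * D.F i t - sgn (par i) • (D.F i t * D.F t i) =
        D.F t t - sgn (par i) • D.F i i := by
      have := D.comm t i i t
      simpa [ht, zmod2_mul_self] using this
    have h7 := I.sub_mem (I.mul_mem_left (D.F t i) (r2 i hio hit))
      (Submodule.smul_of_tower_mem I (sgn (par i)) (I.mul_mem_right (D.F t i) (r2 i hio hit)))
    have h8 : D.F t i * (D.F i t * E ^ k) - sgn (par i) • (D.F i t * E ^ k * D.F t i) =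
        D.F t t * E ^ k - (sgn (par i) * (k + 1)) • (D.F i i * E ^ k) := by
      have h9 : D.F t i * (D.F i t * E ^ k) = (D.F t i * D.F i t) * E ^ k := (mul_assoc _ _ _).symm
      rw [h9, sub_eq_iff_eq_add.1 h5, h4]
      simp only [add_mul, sub_mul, smul_mul_assoc]
      module
    rw [h8] at h7
    have h9 := Submodule.smul_of_tower_mem I (-(sgn (par i) / ((k : ℂ) + 1))) h7
    convert! h9 using 1
    rw [smul_sub, smul_smul]
    have h10 : -(sgn (par i) / ((k : ℂ) + 1)) * (sgn (par i) * (k + 1)) = -1 := by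
      have := sgn_mul_sgn (par i)
      field_simp
      linear_combination -this
    rw [h10]
    module
  have r4 : (D.F o o + 1) * (D.F t t * E ^ k) ∈ I := by
    have h1 := D.minor t o o t
    simp only [ho, ht, if_true, hto, if_false, mul_zero, add_zero, sgn_zero, one_smul,
      sub_zero] at h1
    have h2 := I.mul_mem_left (D.F t o) hk
    rw [pow_succ', ← mul_assoc, sub_eq_iff_eq_add.1 h1] at h2
    convert! h2 using 1
    noncomm_ring
  -- Work in the quotient: everything is expressed through the classes of `E ^ k` and `F t t E ^ k`.
  let q := Ideal.Quotient.mkₐ ℂ I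
  have hq : ∀ x, x ∈ I ↔ q x = 0 := fun x => (Ideal.Quotient.eq_zero_iff_mem (I := I)).symm
  set s : ℂ := -((m : ℂ) - n) / 2 with hs
  set μ : ℂ := 1 + (m - n - 2) / (k + 1) with hμ
  rw [hq] at r1 r4 ⊢
  have hoo : q (D.F o o) * q (E ^ k) = s • q (E ^ k) - μ • (q (D.F t t) * q (E ^ k)) := by
    have h1 : ∀ i ∈ (Finset.univ.erase o).erase t, q (D.F i i) * q (E ^ k) =
        (sgn (par i) / ((k : ℂ) + 1)) • (q (D.F t t) * q (E ^ k)) := by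
      intro i hi
      have h2 := (hq _).1 (r3 i (Finset.mem_erase.1 (Finset.mem_erase.1 hi).2).1
        (Finset.mem_erase.1 hi).1)
      rw [map_sub, map_smul, map_mul, map_mul] at h2
      exact sub_eq_zero.1 h2
    have htm : t ∈ Finset.univ.erase o := Finset.mem_erase.2 ⟨hto, Finset.mem_univ _⟩
    have h2 := D.trace
    rw [← Finset.add_sum_erase _ _ (Finset.mem_univ o), ← Finset.add_sum_erase _ _ htm] at h2
    have h3 := congrArg (fun x => q x * q (E ^ k)) h2
    simp only [map_add, map_sum, add_mul, Finset.sum_mul, AlgHom.commutes] at h3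
    rw [Finset.sum_congr rfl h1, ← Finset.sum_smul, ← Finset.sum_div, ← hs,
      ← Algebra.smul_def] at h3
    have h4 : ∑ i ∈ (Finset.univ.erase o).erase t, sgn (par i) = (m : ℂ) - n - 2 := by
      have h5 := sum_sgn_par m n
      rw [← Finset.add_sum_erase _ _ (Finset.mem_univ o), ← Finset.add_sum_erase _ _ htm, ho, ht,
        sgn_zero] at h5
      linear_combination h5
    rw [h4] at h3
    rw [hμ, ← h3]
    module
  simp only [map_mul, map_add, map_sub, map_smul, add_mul, sub_mul, smul_mul_assoc,
    one_mul] at r1 r4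
  have e1 : (s - k) • q (E ^ k) = (μ + 1) • (q (D.F t t) * q (E ^ k)) := by
    rw [hoo] at r1
    linear_combination (norm := module) r1
  have e2 := congrArg (fun x => q (D.F o o) * x) e1
  simp only [mul_smul_comm, hoo] at e2
  rw [eq_neg_of_add_eq_zero_left r4] at e2
  have e3 : ((s - k) * (s + 1 + (k + 1) * μ)) • q (E ^ k) = 0 := by
    linear_combination (norm := module) (μ + 1) • e2 + (-((s - k) * μ) + μ + 1) • e1
  refine (smul_eq_zero.1 e3).resolve_left ?_
  have h1 : (s - k) * (s + 1 + (k + 1) * μ) = -(((m - n : ℂ) / 2 + k) ^ 2) := by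
    rw [hμ, hs]
    field_simp
    ring
  rw [h1, ← ne_eq, neg_ne_zero]
  refine pow_ne_zero 2 ?_
  have h2 : ((m : ℂ) - n) / 2 + k = ((((m - n : ℕ) : ℝ) / 2 + k : ℝ) : ℂ) := by
    push_cast [Nat.cast_sub hmn.le]
    ring
  rw [h2, Complex.ofReal_ne_zero]
  have h3 : (0 : ℝ) < ((m - n : ℕ) : ℝ) := by exact_mod_cast Nat.sub_pos_of_lt hmn
  positivity

theorem one_mem_of_pow_mem (hmn : n < m) (ho : par o = 0) (ht : par t = 0) (hot : o ≠ t)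
    (I : Ideal B) [I.IsTwoSided] (k : ℕ) (hk : D.F o t ^ k ∈ I) : (1 : B) ∈ I := by
  induction k with
  | zero => simpa using hk
  | succ k ih => exact ih (D.pow_mem_of_pow_succ_mem hmn ho ht hot I k hk)

end MinorGenerators
end SLSuper

namespace SLSuper
namespace MinorGenerators

variable {m n : ℕ} {B : Type*} [Ring B] [Algebra ℂ B] (D : MinorGenerators m n B)
  {o t : Idx m n}

/-! ### Localization at an even root vector -/

/-- The elements that are moved into `W` by a power of `E`. -/
def saturation (E : B) (W : Submodule ℂ B) (hW : ∀ w ∈ W, E * w ∈ W) : Submodule ℂ B where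
  carrier := {b | ∃ N : ℕ, E ^ N * b ∈ W}
  zero_mem' := ⟨0, by simp⟩
  add_mem' := by
    have key : ∀ (N : ℕ) (b : B), E ^ N * b ∈ W → ∀ k, E ^ (k + N) * b ∈ W := by
      intro N b h k
      induction k with
      | zero => simpa using h
      | succ k ih => rw [add_right_comm, pow_succ', mul_assoc]; exact hW _ ih
    rintro a b ⟨M, hM⟩ ⟨N, hN⟩
    refine ⟨N + M, ?_⟩
    rw [mul_add]
    exact add_mem (key M a hM N) (by rw [add_comm]; exact key N b hN M)
  smul_mem' := by
    rintro c a ⟨N, hN⟩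
    exact ⟨N, by rw [mul_smul_comm]; exact W.smul_mem c hN⟩

theorem le_saturation {E : B} {W : Submodule ℂ B} (hW : ∀ w ∈ W, E * w ∈ W) :
    W ≤ saturation E W hW := fun w hw => ⟨0, by simpa using hw⟩

theorem mem_saturation_of_mul_mem {E : B} {W : Submodule ℂ B} (hW : ∀ w ∈ W, E * w ∈ W) {b : B}
    (h : E * b ∈ saturation E W hW) : b ∈ saturation E W hW := by
  obtain ⟨N, hN⟩ := h
  exact ⟨N + 1, by rwa [pow_succ, mul_assoc]⟩

/-- Left multiplication by `x` preserves the saturation of `W` if it maps `W` into the saturation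
and if left multiplication by `[E, x]` preserves the saturation. -/
theorem mul_mem_saturation_of_comm {E : B} {W : Submodule ℂ B} (hW : ∀ w ∈ W, E * w ∈ W) {x : B}
    (hx : ∀ w ∈ W, x * w ∈ saturation E W hW)
    (hy : ∀ b ∈ saturation E W hW, (E * x - x * E) * b ∈ saturation E W hW) :
    ∀ b ∈ saturation E W hW, x * b ∈ saturation E W hW := by
  rintro b ⟨N, hN⟩
  induction N generalizing b with
  | zero => exact hx b (by simpa using hN)
  | succ N ih =>
    refine mem_saturation_of_mul_mem hW ?_
    have h1 : E * (x * b) = x * (E * b) + (E * x - x * E) * b := by noncomm_ring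
    rw [h1]
    refine add_mem (ih _ ?_) (hy b ⟨N + 1, hN⟩)
    rwa [← mul_assoc, ← pow_succ]

/-- Since `F o t` is ad-nilpotent of order three on the generators, the saturation of a subspace
is a left ideal as soon as the generators map the subspace into it. -/
theorem mul_mem_saturation (ho : par o = 0) (ht : par t = 0) (hot : o ≠ t) {W : Submodule ℂ B}
    (hW : ∀ w ∈ W, D.F o t * w ∈ W)
    (h : ∀ i j, ∀ w ∈ W, D.F i j * w ∈ saturation (D.F o t) W hW) (x : B) :
    ∀ b ∈ saturation (D.F o t) W hW, x * b ∈ saturation (D.F o t) W hW := by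
  have h0 : ∀ b ∈ saturation (D.F o t) W hW, D.F o t * b ∈ saturation (D.F o t) W hW :=
    mul_mem_saturation_of_comm hW (h o t) (by simp)
  have h1 : ∀ l, ∀ b ∈ saturation (D.F o t) W hW, D.F o l * b ∈ saturation (D.F o t) W hW := by
    intro l
    refine mul_mem_saturation_of_comm hW (h o l) fun b hb => ?_
    rw [D.comm_E ho ht, if_neg hot.symm]
    split_ifs
    · rw [zero_sub, neg_mul]; exact neg_mem (h0 b hb)
    · simp
  have h2 : ∀ k, ∀ b ∈ saturation (D.F o t) W hW, D.F k t * b ∈ saturation (D.F o t) W hW := by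
    intro k
    refine mul_mem_saturation_of_comm hW (h k t) fun b hb => ?_
    rw [D.comm_E ho ht, if_neg hot, sub_zero]
    split_ifs
    · exact h0 b hb
    · simp
  have h3 : ∀ k l, ∀ b ∈ saturation (D.F o t) W hW,
      D.F k l * b ∈ saturation (D.F o t) W hW := by
    intro k l
    refine mul_mem_saturation_of_comm hW (h k l) fun b hb => ?_
    rw [D.comm_E ho ht, sub_mul]
    refine sub_mem ?_ ?_
    · split_ifs
      · exact h1 l b hb
      · simp
    · split_ifs
      · exact h2 k b hb
      · simp
  refine D.induction (P := fun x => ∀ b ∈ saturation (D.F o t) W hW,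
    x * b ∈ saturation (D.F o t) W hW) ?_ h3 ?_ ?_ x
  · intro c b hb
    rw [← Algebra.smul_def]
    exact Submodule.smul_mem _ c hb
  · intro x y hx hy b hb
    rw [add_mul]
    exact add_mem (hx b hb) (hy b hb)
  · intro x y hx hy b hb
    rw [mul_assoc]
    exact hx _ (hy b hb)

/-- The span of the unit and the generators. -/
def linearPart : Submodule ℂ B :=
  Submodule.span ℂ (insert 1 (Set.range fun x : Idx m n × Idx m n => D.F x.1 x.2))

theorem one_mem_linearPart : (1 : B) ∈ D.linearPart :=
  Submodule.subset_span (Set.mem_insert _ _)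

theorem F_mem_linearPart (i j : Idx m n) : D.F i j ∈ D.linearPart :=
  Submodule.subset_span (Set.mem_insert_of_mem _ ⟨(i, j), rfl⟩)

theorem linearPart_pow_mono {k l : ℕ} (h : k ≤ l) : D.linearPart ^ k ≤ D.linearPart ^ l :=
  pow_le_pow_right' (Submodule.one_le.2 D.one_mem_linearPart) h

theorem exists_mem_linearPart_pow (b : B) : ∃ k, b ∈ D.linearPart ^ k := by
  refine D.induction (P := fun b => ∃ k, b ∈ D.linearPart ^ k) ?_ ?_ ?_ ?_ b
  · intro c
    exact ⟨0, by rw [pow_zero]; exact Submodule.algebraMap_mem c⟩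
  · intro i j
    exact ⟨1, by rw [pow_one]; exact D.F_mem_linearPart i j⟩
  · rintro x y ⟨k, hk⟩ ⟨l, hl⟩
    exact ⟨max k l, add_mem (D.linearPart_pow_mono (le_max_left _ _) hk)
      (D.linearPart_pow_mono (le_max_right _ _) hl)⟩
  · rintro x y ⟨k, hk⟩ ⟨l, hl⟩
    exact ⟨k + l, by rw [pow_add]; exact Submodule.mul_mem_mul hk hl⟩

theorem twist_mem_linearPart_pow (p : ZMod 2) (k : ℕ) {b : B} (hb : b ∈ D.linearPart ^ k) :
    D.twist p b ∈ D.linearPart ^ k := by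
  have h1 : D.linearPart.map (D.twist p).toLinearMap ≤ D.linearPart := by
    conv_lhs => rw [linearPart]
    rw [Submodule.map_span_le]
    rintro _ (rfl | ⟨⟨i, j⟩, rfl⟩)
    · simpa using D.one_mem_linearPart
    · simpa [D.twist_F] using Submodule.smul_mem _ _ (D.F_mem_linearPart i j)
  have h2 : (D.linearPart ^ k).map (D.twist p).toLinearMap ≤ D.linearPart ^ k := by
    rw [Submodule.map_pow]
    exact pow_le_pow_left' h1 k
  exact h2 ⟨b, hb, rfl⟩

theorem sad_mem_linearPart_pow (i j : Idx m n) (k : ℕ) {b : B} (hb : b ∈ D.linearPart ^ k) :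
    D.sad (par i + par j) (D.F i j) b ∈ D.linearPart ^ k := by
  induction k generalizing b with
  | zero =>
    rw [pow_zero] at hb
    obtain ⟨c, rfl⟩ := Submodule.mem_one.1 hb
    rw [Algebra.algebraMap_eq_smul_one, map_smul, D.sad_one, smul_zero]
    exact zero_mem _
  | succ k ih =>
    rw [pow_succ] at hb ⊢
    refine Submodule.mul_induction_on hb ?_ fun x y hx hy => by rw [map_add]; exact add_mem hx hy
    intro x hx y hy
    rw [D.sad_mul]
    refine add_mem (Submodule.mul_mem_mul (ih hx) hy)
      (Submodule.mul_mem_mul (D.twist_mem_linearPart_pow _ k hx) ?_)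
    have h1 : D.linearPart ≤ D.linearPart.comap (D.sad (par i + par j) (D.F i j)) := by
      conv_lhs => rw [linearPart]
      rw [Submodule.span_le]
      rintro _ (rfl | ⟨⟨k, l⟩, rfl⟩)
      · simp [D.sad_one]
      · rw [SetLike.mem_coe, Submodule.mem_comap, D.sad_F]
        refine sub_mem ?_ (Submodule.smul_mem _ _ ?_)
        · split_ifs
          exacts [D.F_mem_linearPart _ _, zero_mem _]
        · split_ifs
          exacts [D.F_mem_linearPart _ _, zero_mem _]
    exact h1 hy

/-- The even root vector `F o t` is not a left zero divisor. The elements killed by its powers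
form a two-sided ideal; on the finite-dimensional part of bounded degree of this ideal one power
of `F o t` vanishes, and the left annihilator of this part is a two-sided ideal since the part is
stable under supercommutators with the generators. -/
theorem eq_zero_of_E_mul (hmn : n < m) (ho : par o = 0) (ht : par t = 0) (hot : o ≠ t) {b : B}
    (hb : D.F o t * b = 0) : b = 0 := by
  have hW : ∀ w ∈ (⊥ : Submodule ℂ B), D.F o t * w ∈ (⊥ : Submodule ℂ B) := by simp
  have hmul := D.mul_mem_saturation ho ht hot hW (fun i j w hw => by
    rw [(Submodule.mem_bot ℂ).1 hw, mul_zero]; exact zero_mem _)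
  let tors : Ideal B :=
    { carrier := saturation (D.F o t) ⊥ hW
      zero_mem' := zero_mem _
      add_mem' := add_mem
      smul_mem' := fun x b hb => hmul x b hb }
  have htors : ∀ b, b ∈ tors ↔ ∃ N : ℕ, D.F o t ^ N * b = 0 := fun b => Iff.rfl
  have : tors.IsTwoSided := ⟨by
    intro a b ha
    obtain ⟨N, hN⟩ := (htors _).1 ha
    exact (htors _).2 ⟨N, by rw [← mul_assoc, hN, zero_mul]⟩⟩
  have hbt : b ∈ tors := (htors b).2 ⟨1, by rwa [pow_one]⟩
  obtain ⟨k, hk⟩ := D.exists_mem_linearPart_pow b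
  let L : Submodule ℂ B := D.linearPart ^ k ⊓ tors.restrictScalars ℂ
  have hbL : b ∈ L := ⟨hk, hbt⟩
  have hfin : FiniteDimensional ℂ (D.linearPart ^ k : Submodule ℂ B) := by
    refine Module.Finite.iff_fg.2 (Submodule.FG.pow ?_ k)
    exact Submodule.fg_span ((Set.finite_range _).insert _)
  have hLfg : L.FG := by
    have : FiniteDimensional ℂ L := Submodule.finiteDimensional_of_le inf_le_left
    exact Module.Finite.iff_fg.1 this
  obtain ⟨N, hN⟩ : ∃ N : ℕ, ∀ l ∈ L, D.F o t ^ N * l = 0 := by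
    obtain ⟨s, hs⟩ := hLfg
    have h1 : ∀ l : B, ∃ N : ℕ, l ∈ s → D.F o t ^ N * l = 0 := by
      intro l
      by_cases hl : l ∈ s
      · have h2 : l ∈ L := hs ▸ Submodule.subset_span hl
        obtain ⟨N, hN⟩ := (htors l).1 h2.2
        exact ⟨N, fun _ => hN⟩
      · exact ⟨0, fun h => absurd h hl⟩
    choose N hN using h1
    refine ⟨s.sup N, fun l hl => ?_⟩
    rw [← hs] at hl
    refine Submodule.span_induction (p := fun l _ => D.F o t ^ s.sup N * l = 0) ?_ (by simp)
      (fun x y _ _ hx hy => by rw [mul_add, hx, hy, add_zero])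
      (fun c x _ hx => by rw [mul_smul_comm, hx, smul_zero]) hl
    intro l hl
    obtain ⟨r, hr⟩ := Nat.exists_eq_add_of_le (Finset.le_sup (f := N) hl)
    rw [hr, add_comm, pow_add, mul_assoc, hN l hl, mul_zero]
  let ann : Ideal B :=
    { carrier := {c | ∀ l ∈ L, c * l = 0}
      zero_mem' := by simp
      add_mem' := fun {x y} hx hy l hl => by rw [add_mul, hx l hl, hy l hl, add_zero]
      smul_mem' := fun x c hc l hl => by rw [smul_eq_mul, mul_assoc, hc l hl, mul_zero] }
  have : ann.IsTwoSided := ⟨by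
    intro c x hc
    refine D.induction (P := fun x => ∀ c ∈ ann, c * x ∈ ann) ?_ ?_ ?_ ?_ x c hc
    · intro a c hc l hl
      rw [mul_assoc, ← Algebra.smul_def]
      exact hc _ (Submodule.smul_mem _ _ hl)
    · intro i j c hc l hl
      have h1 : D.sad (par i + par j) (D.F i j) l ∈ L :=
        ⟨D.sad_mem_linearPart_pow i j k hl.1, D.sad_mem tors _ _ hl.2⟩
      have h2 : D.twist (par i + par j) l ∈ L :=
        ⟨D.twist_mem_linearPart_pow _ k hl.1, D.twist_mem tors _ hl.2⟩
      have h3 : D.F i j * l = D.sad (par i + par j) (D.F i j) l +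
          D.twist (par i + par j) l * D.F i j := by
        rw [D.sad_apply, sub_add_cancel]
      rw [mul_assoc, h3, mul_add, hc _ h1, ← mul_assoc, hc _ h2, zero_mul, add_zero]
    · intro x y hx hy c hc
      rw [mul_add]
      exact ann.add_mem (hx c hc) (hy c hc)
    · intro x y hx hy c hc
      rw [← mul_assoc]
      exact hy _ (hx c hc)⟩
  have h1 : (1 : B) ∈ ann := D.one_mem_of_pow_mem hmn ho ht hot ann N hN
  simpa using h1 b hbL

/-- The words in the "derivatives" `F o l`, of weight zero, and in the elements `F i t`, of weight
one. -/
def derivativeSystem (ho : par o = 0) (ht : par t = 0) (hot : o ≠ t) :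
    D.EulerSystem (D.F o t) {l : Idx m n // l ≠ o} {i : Idx m n // i ≠ o} :=
  let g : {l : Idx m n // l ≠ o} ⊕ {i : Idx m n // i ≠ o} → B :=
    Sum.elim (fun l => D.F o l) fun i => D.F i t
  have hz : ∀ z : {l : Idx m n // l ≠ o}, ∀ s : ℕ, D.F o z ∈ Submodule.span ℂ
      {x | ∃ l : List ({l : Idx m n // l ≠ o} ⊕ {i : Idx m n // i ≠ o}),
        (l.map (Sum.elim (fun _ => 0) fun _ => 1)).sum < s + 1 ∧ x = (l.map g).prod} :=
    fun z s => Submodule.subset_span ⟨[Sum.inl z], by simp, by simp [g]⟩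
  have hj : ∀ j : {i : Idx m n // i ≠ o}, D.F j t ∈ Submodule.span ℂ
      {x | ∃ l : List ({l : Idx m n // l ≠ o} ⊕ {i : Idx m n // i ≠ o}),
        (l.map (Sum.elim (fun _ => 0) fun _ => 1)).sum < 1 + 1 ∧ x = (l.map g).prod} :=
    fun j => Submodule.subset_span ⟨[Sum.inr j], by simp, by simp [g]⟩
  { g := g
    q := Sum.elim (fun l => par l.1) fun i => par i.1
    d := fun j => D.F o j
    p := fun j => par j.1
    twist_g := by
      rintro r (z | i)
      · simp [g, D.twist_F, ho]
      · simp [g, D.twist_F, ht]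
    sad_inl := by
      rintro j z
      have := D.sad_F o j o z
      simpa [g, ho, j.2, z.2.symm] using this
    sad_inr := by
      rintro j i
      have := D.sad_F o j i t
      simpa [g, ho, hot, Subtype.ext_iff] using this
    E_mem := hz ⟨t, hot.symm⟩ 0
    comm_E := by
      rintro (z | i)
      · have := D.comm_E ho ht o z
        simp only [hot.symm, z.2.symm, if_false, sub_zero] at this
        rw [← neg_sub]
        simp [g, this]
      · have := D.comm_E ho ht i t
        simp only [hot, if_false, sub_zero] at this
        rw [← neg_sub]
        simp only [g, Sum.elim_inr, this]
        refine neg_mem ?_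
        split_ifs
        · exact hz ⟨t, hot.symm⟩ 0
        · exact zero_mem _
    comm_g := by
      rintro j (z | i)
      · have h := D.comm j t o z
        simp only [ht, ho, add_zero, zero_add, hot.symm, if_false, zero_sub] at h
        have h1 : sgn (par j.1 * par z.1) • (D.F j t * D.F o z) - D.F o z * D.F j t =
            -(if j.1 = z.1 then D.F o t else 0) := by
          have h2 := sgn_mul_sgn (par j.1 * par z.1)
          rw [sub_eq_iff_eq_add.1 h]
          simp only [smul_add, smul_neg, smul_smul, h2, one_smul]
          abel
        simp only [g, Sum.elim_inl, Sum.elim_inr, h1]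
        refine neg_mem ?_
        split_ifs
        · exact hz ⟨t, hot.symm⟩ 0
        · exact zero_mem _
      · have h := D.comm j t i t
        simp only [ht, add_zero] at h
        have h1 : sgn (par j.1 * par i.1) • (D.F j t * D.F i t) - D.F i t * D.F j t =
            sgn (par j.1 * par i.1) • (if t = i.1 then D.F j t else 0) -
              (if j.1 = t then D.F i t else 0) := by
          have h2 := sgn_mul_sgn (par j.1 * par i.1)
          rw [sub_eq_iff_eq_add.1 h]
          simp only [smul_add, smul_sub, smul_smul, h2, one_smul]
          abel
        simp only [g, Sum.elim_inr, h1]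
        refine sub_mem (Submodule.smul_mem _ _ ?_) ?_
        · split_ifs
          · exact hj j
          · exact zero_mem _
        · split_ifs
          · exact hj i
          · exact zero_mem _ }

/-- The words in `F o t`, of weight zero, and in the other "derivatives" `F o l`, of weight one. -/
def symbolSystem (ho : par o = 0) (ht : par t = 0) (hot : o ≠ t) :
    D.EulerSystem (D.F o t) Unit {l : Idx m n // l ≠ o ∧ l ≠ t} :=
  let g : Unit ⊕ {l : Idx m n // l ≠ o ∧ l ≠ t} → B :=
    Sum.elim (fun _ => D.F o t) fun l => D.F o l
  have hcomm : ∀ i j, i ≠ o → j ≠ o →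
      sgn (par i * par j) • (D.F o i * D.F o j) - D.F o j * D.F o i = 0 := by
    intro i j hi hj
    have h := D.comm o i o j
    simp only [ho, zero_add, hi, hj.symm, if_false, smul_zero, sub_zero] at h
    rw [sub_eq_zero.1 h, smul_smul, sgn_mul_sgn, one_smul, sub_self]
  { g := g
    q := Sum.elim (fun _ => 0) fun l => par l.1
    d := fun j => (-sgn (par j.1)) • D.F j t
    p := fun j => par j.1
    twist_g := by
      rintro r (z | i)
      · simp [g, D.twist_F, ho, ht]
      · simp [g, D.twist_F, ho]
    sad_inl := by
      rintro j z
      have := D.sad_F j t o t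
      simp only [ho, ht, add_zero, hot.symm, j.2.2, if_false, smul_zero, sub_zero] at this
      simp only [D.sad_apply] at this
      simp only [g, Sum.elim_inl, D.sad_apply, smul_mul_assoc, mul_smul_comm]
      rw [← smul_sub, this, smul_zero]
    sad_inr := by
      rintro j i
      have := D.sad_F j t o i
      simp only [ho, ht, add_zero, zero_add, hot.symm, if_false, zero_sub] at this
      simp only [D.sad_apply] at this
      simp only [g, Sum.elim_inr, D.sad_apply, smul_mul_assoc, mul_smul_comm]
      rw [← smul_sub, this]
      simp only [Subtype.ext_iff]
      split_ifs with h
      · rw [h, zmod2_mul_self, neg_smul, smul_neg, neg_neg, smul_smul, sgn_mul_sgn, one_smul]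
      · simp
    E_mem := Submodule.subset_span ⟨[Sum.inl ()], by simp, by simp [g]⟩
    comm_E := by
      have h0 : ∀ i, i ≠ o → D.F o i * D.F o t - D.F o t * D.F o i = 0 := by
        intro i hi
        have := hcomm i t hi hot.symm
        simpa [ht, sgn_zero] using this
      rintro (z | i)
      · simp [g]
      · simp [g, h0 _ i.2.1]
    comm_g := by
      rintro j (z | i)
      · have := hcomm j t j.2.1 hot.symm
        rw [ht] at this
        simp only [g, Sum.elim_inl, Sum.elim_inr, this]
        exact zero_mem _
      · simp only [g, Sum.elim_inr, hcomm j i j.2.1 i.2.1]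
        exact zero_mem _ }

end MinorGenerators
end SLSuper

namespace SLSuper

namespace GLGenerators.EulerSystem

variable {m n : ℕ} {B : Type*} [Ring B] [Algebra ℂ B] {D : GLGenerators m n B} {E : B}
  {Z J : Type*} [DecidableEq J] (X : EulerSystem D E Z J)

/-- The words of weight zero involve the letters of weight zero only. -/
theorem below_one_le {A : Subalgebra ℂ B} (h : ∀ z, X.g (Sum.inl z) ∈ A) :
    X.below 1 ≤ Subalgebra.toSubmodule A := by
  refine Submodule.span_le.2 ?_
  rintro _ ⟨l, hl, rfl⟩
  induction l with
  | nil => simp [word, one_mem]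
  | cons t l ih =>
    rw [weight_cons] at hl
    rw [X.word_cons]
    refine A.mul_mem ?_ (ih (by omega))
    rcases t with z | j
    · exact h z
    · simp [weight] at hl

end GLGenerators.EulerSystem

namespace MinorGenerators

variable {m n : ℕ} {B : Type*} [Ring B] [Algebra ℂ B] (D : MinorGenerators m n B)
  {o t : Idx m n}

/-- Every element is moved by a power of `F o t` into the subalgebra generated by the `F o l` and
the `F i t`. -/
theorem exists_pow_mul_mem (ho : par o = 0) (ht : par t = 0) (hot : o ≠ t) (a : B) :
    ∃ N : ℕ, D.F o t ^ N * a ∈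
      Algebra.adjoin ℂ (Set.range (D.derivativeSystem ho ht hot).g) := by
  set S := Algebra.adjoin ℂ (Set.range (D.derivativeSystem ho ht hot).g) with hS
  have hol : ∀ l, l ≠ o → D.F o l ∈ S := fun l hl => Algebra.subset_adjoin ⟨Sum.inl ⟨l, hl⟩, rfl⟩
  have hE : D.F o t ∈ S := hol t hot.symm
  have hit : ∀ i, D.F i t ∈ S := by
    intro i
    by_cases hi : i = o
    · rwa [hi]
    · exact Algebra.subset_adjoin ⟨Sum.inr ⟨i, hi⟩, rfl⟩
  have h1 : ∀ i j, j ≠ o → D.F o t * D.F i j ∈ S := by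
    intro i j hj
    rw [D.E_mul ho ht hot]
    refine add_mem (mul_mem (hit i) (hol j hj)) ?_
    split_ifs
    exacts [hol j hj, zero_mem _]
  have h2 : D.F o t * D.F o o ∈ S := by
    have h3 := D.trace
    rw [← Finset.add_sum_erase _ _ (Finset.mem_univ o)] at h3
    rw [eq_sub_of_add_eq h3, mul_sub, Finset.mul_sum]
    exact sub_mem (mul_mem hE (S.algebraMap_mem _))
      (sum_mem fun k hk => h1 k k (Finset.ne_of_mem_erase hk))
  have h3 : ∀ i, D.F o t * (D.F o t * D.F i o) ∈ S := by
    intro i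
    have h4 := D.comm_E ho ht i t
    rw [if_neg hot, sub_zero] at h4
    rw [D.E_mul ho ht hot, mul_add, ← mul_assoc, sub_eq_iff_eq_add.1 h4, add_mul, mul_assoc]
    refine add_mem (add_mem ?_ (mul_mem (hit i) h2)) ?_
    · split_ifs
      · exact h2
      · rw [zero_mul]; exact zero_mem _
    · split_ifs
      · exact h2
      · rw [mul_zero]; exact zero_mem _
  have hW : ∀ w ∈ Subalgebra.toSubmodule S, D.F o t * w ∈ Subalgebra.toSubmodule S :=
    fun w hw => S.mul_mem hE hw
  have h4 : ∀ i j, ∀ w ∈ Subalgebra.toSubmodule S,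
      D.F i j * w ∈ saturation (D.F o t) (Subalgebra.toSubmodule S) hW := by
    intro i j w hw
    refine ⟨2, ?_⟩
    rw [pow_two, ← mul_assoc, mul_assoc (D.F o t)]
    refine S.mul_mem ?_ hw
    by_cases hj : j = o
    · rw [hj]; exact h3 i
    · exact mul_mem hE (h1 i j hj)
  have h5 := D.mul_mem_saturation ho ht hot hW h4 a 1 (le_saturation hW S.one_mem)
  rwa [mul_one] at h5

/-- The algebra is simple. A nonzero element of an ideal is moved by a power of `F o t` into the
span of the words of `derivativeSystem`; the differentiations of this system and then of
`symbolSystem` lower its weight to zero, which leaves a polynomial in `F o t`. -/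
theorem one_mem_of_ne_zero (D : MinorGenerators m n B) (hmn : n < m) (ho : par o = 0)
    (ht : par t = 0) (hot : o ≠ t) (I : Ideal B) [I.IsTwoSided] {a : B} (haI : a ∈ I) (ha : a ≠ 0) :
    (1 : B) ∈ I := by
  have hE : ∀ b, D.F o t * b = 0 → b = 0 := fun b => D.eq_zero_of_E_mul hmn ho ht hot
  obtain ⟨N, hN⟩ := D.exists_pow_mul_mem ho ht hot a
  have ha' : D.F o t ^ N * a ≠ 0 := by
    clear hN
    induction N with
    | zero => simpa using ha
    | succ N ih =>
      rw [pow_succ', mul_assoc]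
      exact fun h => ih (hE _ h)
  obtain ⟨s, hs⟩ := (D.derivativeSystem ho ht hot).exists_mem_below hN
  obtain ⟨b, hb, hbI, hb0⟩ := (D.derivativeSystem ho ht hot).exists_mem_below_one hE I hs
    (I.mul_mem_left _ haI) ha'
  have hb' : b ∈ Algebra.adjoin ℂ (Set.range (D.symbolSystem ho ht hot).g) := by
    refine (Subalgebra.mem_toSubmodule _).1
      ((D.derivativeSystem ho ht hot).below_one_le (fun z => ?_) hb)
    by_cases hz : z.1 = t
    · exact Algebra.subset_adjoin ⟨Sum.inl (), by
        change D.F o t = D.F o z; rw [hz]⟩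
    · exact Algebra.subset_adjoin ⟨Sum.inr ⟨z, z.2, hz⟩, rfl⟩
  obtain ⟨r, hr⟩ := (D.symbolSystem ho ht hot).exists_mem_below hb'
  obtain ⟨c, hc, hcI, hc0⟩ := (D.symbolSystem ho ht hot).exists_mem_below_one hE I hr hbI hb0
  have hc' : c ∈ (Polynomial.aeval (R := ℂ) (D.F o t)).range :=
    (Subalgebra.mem_toSubmodule _).1 ((D.symbolSystem ho ht hot).below_one_le
      (fun _ => (AlgHom.mem_range _).2 ⟨Polynomial.X, Polynomial.aeval_X _⟩) hc)
  obtain ⟨p, rfl⟩ := hc'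
  -- The powers of `F o t` are eigenvectors of `[F t t, ·]` with distinct eigenvalues.
  have hpow : ∀ k : ℕ, D.F t t * D.F o t ^ k - D.F o t ^ k * D.F t t =
      (-(k : ℂ)) • D.F o t ^ k := by
    have h1 := D.comm_diag t o t
    simp only [hot.symm, if_false, if_true, zero_sub] at h1
    intro k
    induction k with
    | zero => simp
    | succ k ih =>
      have h2 : D.F t t * D.F o t ^ (k + 1) - D.F o t ^ (k + 1) * D.F t t =
          (D.F t t * D.F o t ^ k - D.F o t ^ k * D.F t t) * D.F o t +
            D.F o t ^ k * (D.F t t * D.F o t - D.F o t * D.F t t) := by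
        rw [pow_succ]; noncomm_ring
      rw [h2, ih, h1, smul_mul_assoc, mul_neg, ← pow_succ]
      push_cast
      module
  change Polynomial.aeval (D.F o t) p ∈ I at hcI
  change Polynomial.aeval (D.F o t) p ≠ 0 at hc0
  rw [Polynomial.aeval_eq_sum_range] at hcI hc0
  obtain ⟨k, hk, hk0⟩ := Finset.exists_ne_zero_of_sum_ne_zero hc0
  have h1 := sum_eigen_mem (W := I.restrictScalars ℂ)
    (f := LinearMap.mulLeft ℂ (D.F t t) - LinearMap.mulRight ℂ (D.F t t))
    (fun x hx => I.sub_mem (I.mul_mem_left _ hx) (I.mul_mem_right _ hx)) _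
    (fun k : ℕ => -(k : ℂ)) (fun k => p.coeff k • D.F o t ^ k) (fun i _ => by
      simp only [LinearMap.sub_apply, LinearMap.mulLeft_apply, LinearMap.mulRight_apply,
        mul_smul_comm, smul_mul_assoc]
      rw [← smul_sub, hpow, smul_comm]) hcI (-(k : ℂ))
  simp only [neg_inj, Nat.cast_inj, Finset.filter_eq', hk, if_true, Finset.sum_singleton] at h1
  have h2 : D.F o t ^ k ∈ I := by
    have h3 := Submodule.smul_of_tower_mem I (p.coeff k)⁻¹ h1
    rwa [inv_smul_smul₀ (left_ne_zero_of_smul hk0)] at h3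
  exact D.one_mem_of_pow_mem hmn ho ht hot I k h2

end MinorGenerators
end SLSuper

namespace SLSuper

/-! ### Traceless matrix units and the second tensor power -/

variable {m n : ℕ}

/-- A shortcut instance: unification does not see through the additive structure of the matrices
underlying `𝔰𝔩(m|n)`. -/
instance tensorAddCommGroup : AddCommGroup (sl m n ⊗[ℂ] sl m n) := TensorProduct.addCommGroup

theorem matBracket_apply (A B : Mat m n) (i k : Idx m n) : matBracket m n A B i k =
    ∑ j, (A i j * B j k - sgn ((par i + par j) * (par j + par k)) * (B i j * A j k)) := rfl

theorem coe_bracket (X Y : sl m n) : (bracket X Y : Mat m n) = matBracket m n X Y := rfl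

theorem matBracket_one_left (B : Mat m n) : matBracket m n 1 B = 0 := by
  ext i k
  simp [matBracket_apply, Matrix.one_apply, Finset.sum_sub_distrib, zmod2_add_self, sgn_zero]

theorem matBracket_one_right (A : Mat m n) : matBracket m n A 1 = 0 := by
  ext i k
  simp [matBracket_apply, Matrix.one_apply, Finset.sum_sub_distrib, zmod2_add_self, sgn_zero]

theorem matBracket_single (i j k l : Idx m n) :
    matBracket m n (Matrix.single i j 1) (Matrix.single k l 1) =
      (if j = k then Matrix.single i l 1 else 0) -
        sgn ((par i + par j) * (par k + par l)) • (if i = l then Matrix.single k j 1 else 0) := by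
  ext p q
  have h1 : ∑ r, (Matrix.single i j (1 : ℂ)) p r * (Matrix.single k l (1 : ℂ)) r q =
      (if j = k then Matrix.single i l (1 : ℂ) else 0) p q := by
    rw [← Matrix.mul_apply]
    split_ifs with h
    · subst h; simp
    · rw [Matrix.single_mul_single_of_ne _ _ _ _ h]
  have h2 : ∑ r, (Matrix.single k l (1 : ℂ)) p r * (Matrix.single i j (1 : ℂ)) r q =
      (if i = l then Matrix.single k j (1 : ℂ) else 0) p q := by
    rw [← Matrix.mul_apply]
    split_ifs with h
    · subst h; simp
    · rw [Matrix.single_mul_single_of_ne _ _ _ _ (Ne.symm h)]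
  rw [matBracket_apply, Finset.sum_sub_distrib, h1, Matrix.sub_apply, Matrix.smul_apply,
    smul_eq_mul, ← h2, Finset.mul_sum]
  congr 1
  refine Finset.sum_congr rfl fun r _ => ?_
  by_cases h : k = p ∧ l = r
  · by_cases h' : i = r ∧ j = q
    · obtain ⟨rfl, rfl⟩ := h
      obtain ⟨rfl, rfl⟩ := h'
      rw [mul_comm (par i + par j), add_comm (par k)]
    · simp [Matrix.single_apply, h']
  · simp [Matrix.single_apply, h]

theorem str_one : str m n 1 = (m : ℂ) - n := by
  rw [← sum_sgn_par]
  simp [str]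

theorem str_single (i j : Idx m n) :
    str m n (Matrix.single i j 1) = if i = j then sgn (par i) else 0 := by
  split_ifs with h
  · subst h
    simp [str, Matrix.single_apply, -Fintype.sum_sum_type]
  · have : ∀ k, ¬ (i = k ∧ j = k) := fun k hk => h (hk.1.trans hk.2.symm)
    simp [str, this]

theorem sub_ne_zero_of_fact [hmn : Fact (n < m)] : (m : ℂ) - n ≠ 0 :=
  sub_ne_zero.2 (Nat.cast_injective.ne hmn.out.ne')

section Project

variable [hmn : Fact (n < m)]

/-- The projection of `𝔤𝔩(m|n)` to `𝔰𝔩(m|n)` along the scalar matrices. -/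
def project (m n : ℕ) [Fact (n < m)] : Mat m n →ₗ[ℂ] sl m n :=
  LinearMap.codRestrict _ (LinearMap.id - (((m : ℂ) - n)⁻¹ • str m n).smulRight (1 : Mat m n))
    fun A => by
      change str m n (A - (((m : ℂ) - n)⁻¹ * str m n A) • (1 : Mat m n)) = 0
      rw [map_sub, map_smul, str_one, smul_eq_mul]
      field_simp [sub_ne_zero_of_fact (m := m) (n := n)]
      ring

theorem coe_project (A : Mat m n) :
    (project m n A : Mat m n) = A - (((m : ℂ) - n)⁻¹ * str m n A) • (1 : Mat m n) := rfl

theorem project_coe (X : sl m n) : project m n X = X := by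
  apply Subtype.ext
  have h : str m n (X : Mat m n) = 0 := X.2
  rw [coe_project, h, mul_zero, zero_smul, sub_zero]

theorem project_one : project m n 1 = 0 := by
  apply Subtype.ext
  rw [coe_project, str_one, inv_mul_cancel₀ sub_ne_zero_of_fact, one_smul, sub_self]
  rfl

theorem bracket_project (A B : Mat m n) :
    bracket (project m n A) (project m n B) = project m n (matBracket m n A B) := by
  apply Subtype.ext
  rw [coe_bracket, coe_project, coe_project, coe_project, str_matBracket]
  simp [matBracket_one_left, matBracket_one_right]

/-- The image of a matrix unit under the projection of `𝔤𝔩(m|n)` to `𝔰𝔩(m|n)`. -/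
def slUnit (i j : Idx m n) : sl m n := project m n (Matrix.single i j 1)

theorem coe_slUnit (i j : Idx m n) : (slUnit i j : Mat m n) = Matrix.single i j 1 -
    (((m : ℂ) - n)⁻¹ * if i = j then sgn (par i) else 0) • (1 : Mat m n) := by
  rw [slUnit, coe_project, str_single]

theorem bracket_slUnit (i j k l : Idx m n) : bracket (slUnit i j) (slUnit k l) =
    (if j = k then slUnit i l else 0) -
      sgn ((par i + par j) * (par k + par l)) • (if i = l then slUnit k j else 0) := by
  rw [slUnit, slUnit, bracket_project, matBracket_single, map_sub, map_smul]
  congr 2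
  · split_ifs <;> simp [slUnit]
  · split_ifs <;> simp [slUnit]

theorem isHomog_slUnit (i j : Idx m n) : IsHomog (par i + par j) (slUnit i j) := by
  apply Subtype.ext
  ext k l
  change (if par k + par l = par i + par j then (slUnit i j : Mat m n) k l else 0) = _
  split_ifs with h
  · rfl
  · rw [coe_slUnit]
    have h1 : Matrix.single i j (1 : ℂ) k l = 0 := by
      rw [Matrix.single_apply, if_neg]
      rintro ⟨rfl, rfl⟩
      exact h rfl
    rw [Matrix.sub_apply, Matrix.smul_apply, h1, Matrix.one_apply]
    by_cases hkl : k = l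
    · rw [if_pos hkl, if_neg]
      · simp
      · rintro rfl
        rw [hkl, zmod2_add_self, zmod2_add_self] at h
        exact h rfl
    · simp [hkl]

theorem sum_slUnit : ∑ i : Idx m n, slUnit i i = 0 := by
  have h : ∑ i : Idx m n, Matrix.single i i (1 : ℂ) = 1 := by
    ext p q
    by_cases hpq : p = q
    · simp [Matrix.sum_apply, Matrix.single_apply, Matrix.one_apply, hpq, -Fintype.sum_sum_type]
    · have : ∀ i, ¬ (i = p ∧ i = q) := fun i hi => hpq (hi.1.symm.trans hi.2)
      simp [Matrix.sum_apply, hpq, this, -Fintype.sum_sum_type]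
  simp only [slUnit, ← map_sum, h, project_one]

theorem project_eq_sum (A : Mat m n) : project m n A = ∑ i, ∑ j, A i j • slUnit i j := by
  conv_lhs => rw [Matrix.matrix_eq_sum_single A]
  simp only [map_sum, slUnit, ← map_smul, Matrix.smul_single, smul_eq_mul, mul_one]

theorem eq_sum_slUnit (X : sl m n) : X = ∑ i, ∑ j, (X : Mat m n) i j • slUnit i j := by
  rw [← project_eq_sum, project_coe]

theorem slUnit_ne_zero {i j : Idx m n} (h : i ≠ j) : slUnit i j ≠ 0 := by
  intro h1
  have h2 := congrArg (fun X : sl m n => (X : Mat m n) i j) h1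
  simp [coe_slUnit, h] at h2

/-- Linear maps on `𝔤 ⊗ 𝔤` agree if they agree on the tensors of matrix units. -/
theorem tensor_ext {V : Type*} [AddCommMonoid V] [Module ℂ V]
    {f g : sl m n ⊗[ℂ] sl m n →ₗ[ℂ] V}
    (h : ∀ i j k l, f (slUnit i j ⊗ₜ slUnit k l) = g (slUnit i j ⊗ₜ slUnit k l)) : f = g := by
  ext X Y
  change f (X ⊗ₜ Y) = g (X ⊗ₜ Y)
  rw [eq_sum_slUnit X, eq_sum_slUnit Y]
  simp only [TensorProduct.sum_tmul, TensorProduct.tmul_sum, map_sum, ← TensorProduct.smul_tmul',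
    TensorProduct.tmul_smul, map_smul, h]

end Project

theorem sum_zmod2 {V : Type*} [AddCommMonoid V] (f : ZMod 2 → V) : ∑ p, f p = f 0 + f 1 :=
  Fin.sum_univ_two f

/-- The adjoint action on `𝔤 ⊗ 𝔤` as a linear map. -/
def actHom (m n : ℕ) : sl m n →ₗ[ℂ] Module.End ℂ (sl m n ⊗[ℂ] sl m n) where
  toFun := act
  map_add' X Y := by
    simp only [act, map_add, TensorProduct.map_add_left, TensorProduct.map_add_right, sum_zmod2,
      smul_add]
    abel
  map_smul' c X := by
    simp only [act, map_smul, TensorProduct.map_smul_left, TensorProduct.map_smul_right,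
      sum_zmod2, smul_add, RingHom.id_apply, smul_comm _ c]

theorem actHom_apply (X : sl m n) : actHom m n X = act X := rfl

theorem act_tmul {p q : ZMod 2} {X Y : sl m n} (hX : IsHomog p X) (hY : IsHomog q Y)
    (Z : sl m n) : act X (Y ⊗ₜ Z) = bracket X Y ⊗ₜ Z + sgn (p * q) • (Y ⊗ₜ bracket X Z) := by
  simp only [act, LinearMap.add_apply, TensorProduct.map_tmul, LinearMap.id_apply, sum_zmod2,
    LinearMap.smul_apply, hX.comp_eq, hY.comp_eq]
  rcases zmod2_cases p with rfl | rfl <;> rcases zmod2_cases q with rfl | rfl <;> simp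

theorem superSwap_tmul {p q : ZMod 2} {X Y : sl m n} (hX : IsHomog p X) (hY : IsHomog q Y) :
    superSwap m n (X ⊗ₜ Y) = sgn (p * q) • (Y ⊗ₜ X) := by
  simp only [superSwap, sum_zmod2, LinearMap.add_apply, LinearMap.smul_apply,
    LinearMap.comp_apply, LinearEquiv.coe_coe, TensorProduct.comm_tmul, TensorProduct.map_tmul,
    hX.comp_eq, hY.comp_eq]
  rcases zmod2_cases p with rfl | rfl <;> rcases zmod2_cases q with rfl | rfl <;> simp

theorem mem_symSq {t : sl m n ⊗[ℂ] sl m n} : t ∈ symSq m n ↔ superSwap m n t = t := Iff.rfl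

section Units

variable [hmn : Fact (n < m)]

theorem act_slUnit (p q i j k l : Idx m n) :
    act (slUnit p q) (slUnit i j ⊗ₜ slUnit k l) =
      (if q = i then slUnit p j ⊗ₜ slUnit k l else 0) -
      sgn ((par p + par q) * (par i + par j)) •
        (if p = j then slUnit i q ⊗ₜ slUnit k l else 0) +
      sgn ((par p + par q) * (par i + par j)) • ((if q = k then slUnit i j ⊗ₜ slUnit p l else 0) -
        sgn ((par p + par q) * (par k + par l)) •
          (if p = l then slUnit i j ⊗ₜ slUnit k q else 0)) := by
  rw [act_tmul (isHomog_slUnit p q) (isHomog_slUnit i j), bracket_slUnit, bracket_slUnit,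
    TensorProduct.sub_tmul, TensorProduct.tmul_sub, ← TensorProduct.smul_tmul',
    TensorProduct.tmul_smul]
  congr 3
  all_goals split_ifs <;> simp

theorem superSwap_slUnit (i j k l : Idx m n) : superSwap m n (slUnit i j ⊗ₜ slUnit k l) =
    sgn ((par i + par j) * (par k + par l)) • (slUnit k l ⊗ₜ slUnit i j) :=
  superSwap_tmul (isHomog_slUnit i j) (isHomog_slUnit k l)

theorem act_eq_sum (X : sl m n) (t : sl m n ⊗[ℂ] sl m n) :
    act X t = ∑ i, ∑ j, (X : Mat m n) i j • act (slUnit i j) t := by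
  rw [← actHom_apply]
  conv_lhs => rw [eq_sum_slUnit X]
  simp only [map_sum, map_smul, LinearMap.sum_apply, LinearMap.smul_apply, actHom_apply]

theorem isStable_of_slUnit {N : Submodule ℂ (sl m n ⊗[ℂ] sl m n)}
    (h : ∀ i j, ∀ t ∈ N, act (slUnit i j) t ∈ N) : IsStable N := by
  intro X t ht
  rw [act_eq_sum]
  exact sum_mem fun i _ => sum_mem fun j _ => N.smul_mem _ (h i j t ht)

/-- A diagonal matrix acts on tensors of matrix units through the differences of its entries. -/
theorem act_project_diagonal (h : Idx m n → ℂ) (i j k l : Idx m n) :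
    act (project m n (Matrix.diagonal h)) (slUnit i j ⊗ₜ slUnit k l) =
      (h i - h j + h k - h l) • (slUnit i j ⊗ₜ slUnit k l) := by
  have h1 : project m n (Matrix.diagonal h) = ∑ p, h p • slUnit p p := by
    rw [project_eq_sum]
    refine Finset.sum_congr rfl fun p _ => ?_
    rw [Finset.sum_eq_single p]
    · simp
    · intro b _ hb; simp [hb.symm]
    · simp
  rw [← actHom_apply, h1, map_sum, LinearMap.sum_apply]
  have h2 : ∀ p, (actHom m n (h p • slUnit p p)) (slUnit i j ⊗ₜ slUnit k l) =
      ((if p = i then h p else 0) - (if p = j then h p else 0) + (if p = k then h p else 0) -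
        (if p = l then h p else 0)) • (slUnit i j ⊗ₜ slUnit k l) := by
    intro p
    rw [map_smul, LinearMap.smul_apply, actHom_apply, act_slUnit, zmod2_add_self, zero_mul,
      zero_mul, sgn_zero, one_smul, one_smul, one_smul]
    have e1 : (if p = i then slUnit p j ⊗ₜ[ℂ] slUnit k l else 0) =
        if p = i then slUnit i j ⊗ₜ[ℂ] slUnit k l else 0 := by
      split_ifs with e <;> simp [e]
    have e2 : (if p = j then slUnit i p ⊗ₜ[ℂ] slUnit k l else 0) =
        if p = j then slUnit i j ⊗ₜ[ℂ] slUnit k l else 0 := by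
      split_ifs with e <;> simp [e]
    have e3 : (if p = k then slUnit i j ⊗ₜ[ℂ] slUnit p l else 0) =
        if p = k then slUnit i j ⊗ₜ[ℂ] slUnit k l else 0 := by
      split_ifs with e <;> simp [e]
    have e4 : (if p = l then slUnit i j ⊗ₜ[ℂ] slUnit k p else 0) =
        if p = l then slUnit i j ⊗ₜ[ℂ] slUnit k l else 0 := by
      split_ifs with e <;> simp [e]
    rw [e1, e2, e3, e4]
    generalize slUnit i j ⊗ₜ[ℂ] slUnit k l = T
    split_ifs <;> module
  rw [Finset.sum_congr rfl fun p _ => h2 p, ← Finset.sum_smul]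
  congr 1
  simp [Finset.sum_add_distrib, Finset.sum_sub_distrib, -Fintype.sum_sum_type]

/-- The super flip is a homomorphism of `𝔤`-modules. -/
theorem superSwap_act (X : sl m n) (t : sl m n ⊗[ℂ] sl m n) :
    superSwap m n (act X t) = act X (superSwap m n t) := by
  have key : ∀ p q : Idx m n, superSwap m n ∘ₗ act (slUnit p q) =
      act (slUnit p q) ∘ₗ superSwap m n := by
    intro p q
    refine tensor_ext fun i j k l => ?_
    have hX := isHomog_slUnit p q
    have hY := isHomog_slUnit i j
    have hZ := isHomog_slUnit k l
    rw [LinearMap.comp_apply, LinearMap.comp_apply, act_tmul hX hY, superSwap_tmul hY hZ, map_add,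
      map_smul, map_smul, superSwap_tmul (hX.bracket hY) hZ, superSwap_tmul hY (hX.bracket hZ),
      act_tmul hX hZ, smul_add, smul_smul, smul_smul, add_comm]
    generalize par p + par q = a
    generalize par i + par j = b
    generalize par k + par l = c
    congr 2
    · rcases zmod2_cases a with rfl | rfl <;> rcases zmod2_cases b with rfl | rfl <;>
        rcases zmod2_cases c with rfl | rfl <;>
        simp [sgn, show (1 : ZMod 2) + 1 = 0 from rfl]
    · rcases zmod2_cases a with rfl | rfl <;> rcases zmod2_cases b with rfl | rfl <;>
        rcases zmod2_cases c with rfl | rfl <;>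
        simp [sgn, show (1 : ZMod 2) + 1 = 0 from rfl]
  rw [act_eq_sum, act_eq_sum X]
  simp only [map_sum, map_smul]
  refine Finset.sum_congr rfl fun p _ => Finset.sum_congr rfl fun q _ => ?_
  exact congrArg _ (LinearMap.congr_fun (key p q) t)

theorem superSwap_superSwap (t : sl m n ⊗[ℂ] sl m n) : superSwap m n (superSwap m n t) = t := by
  have : superSwap m n ∘ₗ superSwap m n = LinearMap.id := by
    refine tensor_ext fun i j k l => ?_
    rw [LinearMap.comp_apply, superSwap_slUnit, map_smul, superSwap_slUnit, smul_smul,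
      mul_comm (par k + par l), sgn_mul_sgn, one_smul, LinearMap.id_apply]
  exact LinearMap.congr_fun this t

theorem isStable_symSq : IsStable (symSq m n) := fun X t ht => by
  rw [mem_symSq] at ht ⊢
  rw [superSwap_act, ht]

end Units
end SLSuper

namespace SLSuper

/-! ### The Cartan product -/

variable {m n : ℕ}

/-- The super-antisymmetric tensors in `𝔤 ⊗ 𝔤`. -/
def altSq (m n : ℕ) : Submodule ℂ (sl m n ⊗[ℂ] sl m n) :=
  LinearMap.eqLocus (superSwap m n) (-LinearMap.id)

theorem mem_altSq {t : sl m n ⊗[ℂ] sl m n} : t ∈ altSq m n ↔ superSwap m n t = -t := Iff.rfl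

section Weights

variable [hmn : Fact (n < m)]

theorem isStable_altSq : IsStable (altSq m n) := fun X t ht => by
  rw [mem_altSq] at ht ⊢
  rw [superSwap_act, ht, map_neg]

/-- The even index `o` and the last two indices `b`, `a` (with `a = b` if `n = 0`) that describe
the highest weight of the Cartan product, which is the weight of `slUnit o a ⊗ slUnit o b`. -/
structure CartanIndices (o a b : Idx m n) : Prop where
  par_o : par o = 0
  o_ne_a : o ≠ a
  o_ne_b : o ≠ b
  last : (a = b ∧ par a = 0) ∨
    (par a = 1 ∧ a ≠ b ∧ (finSumFinEquiv b : Fin (m + n)) < finSumFinEquiv a)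
  weight : ∀ h : Idx m n → ℂ,
    cartanWeight m n (project m n (Matrix.diagonal h) : Mat m n) = 2 * h o - h a - h b

theorem exists_cartanIndices (h2 : n + 2 < m) : ∃ o a b : Idx m n, CartanIndices o a b := by
  rcases n with _ | _ | k
  · refine ⟨Sum.inl ⟨0, by omega⟩, Sum.inl ⟨m - 1, by omega⟩, Sum.inl ⟨m - 1, by omega⟩,
      rfl, ?_, ?_, Or.inl ⟨rfl, rfl⟩, fun h => ?_⟩
    · simp; omega
    · simp; omega
    · have e1 : 0 < m := by omega
      simp [cartanWeight, eps, coe_project, e1]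
      ring
  · refine ⟨Sum.inl ⟨0, by omega⟩, Sum.inr ⟨0, by omega⟩, Sum.inl ⟨m - 1, by omega⟩,
      rfl, by simp, ?_, Or.inr ⟨rfl, by simp, ?_⟩, fun h => ?_⟩
    · simp; omega
    · simp [Fin.lt_def]; omega
    · have e1 : 0 < m := by omega
      simp [cartanWeight, eps, del, coe_project, e1]
      ring
  · refine ⟨Sum.inl ⟨0, by omega⟩, Sum.inr ⟨k + 1, by omega⟩, Sum.inr ⟨k, by omega⟩,
      rfl, by simp, by simp, Or.inr ⟨rfl, by simp, ?_⟩, fun h => ?_⟩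
    · simp [Fin.lt_def]
    · have e1 : 0 < m := by omega
      simp [cartanWeight, eps, del, coe_project, e1]
      ring

variable {o a b : Idx m n}

/-- A weight that separates the weight of the Cartan product from the other weights of
`𝔤 ⊗ 𝔤`. -/
def genericWeight (o a b i : Idx m n) : ℤ :=
  (if i = o then 10 else 0) - (if i = a then 2 else 0) - if i = b then 1 else 0

theorem CartanIndices.eq_of_genericWeight (H : CartanIndices o a b) {i j k l : Idx m n}
    (h : genericWeight o a b i - genericWeight o a b j + genericWeight o a b k -
      genericWeight o a b l =
      2 * genericWeight o a b o - genericWeight o a b a - genericWeight o a b b) :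
    i = o ∧ k = o ∧ (j = a ∧ l = b ∨ j = b ∧ l = a) := by
  have hoa := H.o_ne_a
  have hob := H.o_ne_b
  have ho : genericWeight o a b o = 10 := by simp [genericWeight, hoa, hob]
  have h1 : ∀ i, (i = o ∧ genericWeight o a b i = 10) ∨ genericWeight o a b i ≤ 0 := by
    intro i
    by_cases hi : i = o
    · left; exact ⟨hi, by rw [hi, ho]⟩
    · right; unfold genericWeight; split_ifs <;> simp
  have ha : genericWeight o a b a = -2 - if a = b then 1 else 0 := by
    simp [genericWeight, hoa.symm]
  have hb : genericWeight o a b b = (-if a = b then 2 else 0) - 1 := by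
    simp [genericWeight, hob.symm, eq_comm (a := b)]
  rw [ho] at h
  by_cases hab : a = b
  · simp only [hab, if_true] at ha hb
    subst hab
    have h2 : ∀ j, (j = a ∧ genericWeight o a a j = -3) ∨ 0 ≤ genericWeight o a a j := by
      intro j
      by_cases hj : j = a
      · left; exact ⟨hj, by rw [hj, hb]; rfl⟩
      · right; unfold genericWeight; simp only [hj, if_false]; split_ifs <;> simp
    rw [hb] at h
    have hi := (h1 i).imp_left And.right
    have hk := (h1 k).imp_left And.right
    have hj := (h2 j).imp_left And.right
    have hl := (h2 l).imp_left And.right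
    exact ⟨((h1 i).resolve_right (by omega)).1, ((h1 k).resolve_right (by omega)).1,
      Or.inl ⟨((h2 j).resolve_right (by omega)).1, ((h2 l).resolve_right (by omega)).1⟩⟩
  · simp only [hab, if_false] at ha hb
    have h2 : ∀ j, (j = a ∧ genericWeight o a b j = -2) ∨ (j = b ∧ genericWeight o a b j = -1) ∨
        0 ≤ genericWeight o a b j := by
      intro j
      by_cases hj : j = b
      · right; left; exact ⟨hj, by rw [hj, hb]; rfl⟩
      · by_cases hj' : j = a
        · left; exact ⟨hj', by rw [hj', ha]; rfl⟩
        · right; right; unfold genericWeight; simp only [hj, hj', if_false]; split_ifs <;> simp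
    rw [ha, hb] at h
    have hi := (h1 i).imp_left And.right
    have hk := (h1 k).imp_left And.right
    have hj := (h2 j).imp And.right (Or.imp_left And.right)
    have hl := (h2 l).imp And.right (Or.imp_left And.right)
    refine ⟨((h1 i).resolve_right (by omega)).1, ((h1 k).resolve_right (by omega)).1, ?_⟩
    rcases h2 j with ⟨ej, hj'⟩ | ⟨ej, hj'⟩ | hj'
    · exact Or.inl ⟨ej, (((h2 l).resolve_left (by omega)).resolve_right (by omega)).1⟩
    · exact Or.inr ⟨ej, ((h2 l).resolve_right (by omega)).1⟩
    · omega

/-- A family of weight vectors, indexed like the tensors of matrix units, that span a submodule of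
a module that is simple of highest weight `cartanWeight m n` vanishes if its members of that weight
vanish. -/
theorem CartanIndices.family_eq_zero (H : CartanIndices o a b)
    {C : Submodule ℂ (sl m n ⊗[ℂ] sl m n)}
    (simple : ∀ N : Submodule ℂ (sl m n ⊗[ℂ] sl m n), IsStable N → N ≤ C → N = ⊥ ∨ N = C)
    (highestWeight : ∃ v ∈ C, IsCartanHighestWeightVector v)
    (u : Idx m n × Idx m n × Idx m n × Idx m n → sl m n ⊗[ℂ] sl m n) (hu : ∀ x, u x ∈ C)
    (hst : IsStable (Submodule.span ℂ (Set.range u)))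
    (hH : ∀ h : Idx m n → ℂ, ∀ x, act (project m n (Matrix.diagonal h)) (u x) =
      (h x.1 - h x.2.1 + h x.2.2.1 - h x.2.2.2) • u x)
    (h1 : u (o, a, o, b) = 0) (h2 : u (o, b, o, a) = 0) (x) : u x = 0 := by
  classical
  rcases simple _ hst (Submodule.span_le.2 (by rintro _ ⟨x, rfl⟩; exact hu x)) with h | h
  · rw [Submodule.span_eq_bot] at h
    exact h _ ⟨x, rfl⟩
  · exfalso
    obtain ⟨v, hv, hv0, -, hvH⟩ := highestWeight
    rw [← h] at hv
    obtain ⟨c, rfl⟩ := (Submodule.mem_span_range_iff_exists_fun ℂ).1 hv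
    apply hv0
    set g : Idx m n → ℂ := fun i => (genericWeight o a b i : ℂ)
    have h3 := hvH (project m n (Matrix.diagonal g)) (by
      intro i j hij
      simp [coe_project, hij])
    rw [H.weight] at h3
    rw [eq_sum_eigen Finset.univ (fun x => g x.1 - g x.2.1 + g x.2.2.1 - g x.2.2.2) _
      (fun x _ => by rw [map_smul, hH, smul_comm]) h3]
    refine Finset.sum_eq_zero ?_
    rintro ⟨i, j, k, l⟩ hx
    have h4 := (Finset.mem_filter.1 hx).2
    have h5 := H.eq_of_genericWeight (i := i) (j := j) (k := k) (l := l) (by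
      simp only [g] at h4
      exact_mod_cast h4)
    obtain ⟨rfl, rfl, ⟨rfl, rfl⟩ | ⟨rfl, rfl⟩⟩ := h5
    · rw [h1, smul_zero]
    · rw [h2, smul_zero]

theorem span_slUnit_tmul : Submodule.span ℂ (Set.range
    fun x : Idx m n × Idx m n × Idx m n × Idx m n =>
      slUnit x.1 x.2.1 ⊗ₜ[ℂ] slUnit x.2.2.1 x.2.2.2) = ⊤ := by
  rw [eq_top_iff]
  rintro t -
  induction t with
  | zero => exact zero_mem _
  | add x y hx hy => exact add_mem hx hy
  | tmul X Y =>
    rw [eq_sum_slUnit X, eq_sum_slUnit Y]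
    simp only [TensorProduct.sum_tmul, TensorProduct.tmul_sum, ← TensorProduct.smul_tmul',
      TensorProduct.tmul_smul]
    refine sum_mem fun k _ => sum_mem fun l _ => Submodule.smul_mem _ _ (sum_mem fun i _ =>
      sum_mem fun j _ => Submodule.smul_mem _ _ (Submodule.subset_span ⟨(i, j, k, l), rfl⟩))

theorem CartanIndices.mem_span_of_weight (H : CartanIndices o a b) {t : sl m n ⊗[ℂ] sl m n}
    (ht : ∀ h : Idx m n → ℂ, act (project m n (Matrix.diagonal h)) t = (2 * h o - h a - h b) • t) :
    ∃ c d : ℂ, c • (slUnit o a ⊗ₜ[ℂ] slUnit o b) + d • (slUnit o b ⊗ₜ[ℂ] slUnit o a) = t := by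
  classical
  have hv : t ∈ Submodule.span ℂ (Set.range
    fun x : Idx m n × Idx m n × Idx m n × Idx m n =>
      slUnit x.1 x.2.1 ⊗ₜ[ℂ] slUnit x.2.2.1 x.2.2.2) := by rw [span_slUnit_tmul]; trivial
  obtain ⟨c, rfl⟩ := (Submodule.mem_span_range_iff_exists_fun ℂ).1 hv
  rw [← Submodule.mem_span_pair]
  set g : Idx m n → ℂ := fun i => (genericWeight o a b i : ℂ)
  rw [eq_sum_eigen Finset.univ (fun x => g x.1 - g x.2.1 + g x.2.2.1 - g x.2.2.2) _
      (fun x _ => by rw [map_smul, act_project_diagonal, smul_comm]) (ht g)]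
  refine sum_mem ?_
  rintro ⟨i, j, k, l⟩ hx
  have h4 := (Finset.mem_filter.1 hx).2
  have h5 := H.eq_of_genericWeight (i := i) (j := j) (k := k) (l := l) (by
    simp only [g] at h4
    exact_mod_cast h4)
  obtain ⟨rfl, rfl, ⟨rfl, rfl⟩ | ⟨rfl, rfl⟩⟩ := h5
  · exact Submodule.smul_mem _ _ (Submodule.subset_span (by simp))
  · exact Submodule.smul_mem _ _ (Submodule.subset_span (by simp))

/-- The supersymmetric (for `ε = 1`) or super-antisymmetric (for `ε = -1`) vector of weight
`cartanWeight m n`. -/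
def topVector (o a b : Idx m n) (ε : ℂ) : sl m n ⊗[ℂ] sl m n :=
  slUnit o a ⊗ₜ slUnit o b + (ε * sgn (par a * par b)) • (slUnit o b ⊗ₜ slUnit o a)

theorem superSwap_topVector (ho : par o = 0) {ε : ℂ} (hε : ε * ε = 1) :
    superSwap m n (topVector o a b ε) = ε • topVector o a b ε := by
  have h := sgn_mul_sgn (par a * par b)
  rw [topVector, map_add, map_smul, superSwap_slUnit, superSwap_slUnit, ho, zero_add, zero_add,
    mul_comm (par b), smul_add, smul_smul, smul_smul, mul_assoc, h, ← mul_assoc, hε, mul_one,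
    one_mul, add_comm]

theorem combination_eq (c d : ℂ) :
    c • (slUnit o a ⊗ₜ[ℂ] slUnit o b) + d • (slUnit o b ⊗ₜ[ℂ] slUnit o a) =
      ((c + d * sgn (par a * par b)) / 2) • topVector o a b 1 +
        ((c - d * sgn (par a * par b)) / 2) • topVector o a b (-1) := by
  have h := sgn_mul_sgn (par a * par b)
  simp only [topVector, smul_add, smul_smul]
  rw [add_add_add_comm, ← add_smul, ← add_smul]
  congr 2
  · ring
  · linear_combination (-d) * h

/-- For `n > 0`, the antisymmetric vector of weight `cartanWeight m n` and the tensor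
`slUnit o a ⊗ slUnit o a` generate the same submodule. -/
theorem CartanIndices.lower_raise (H : CartanIndices o a b) (ha : par a = 1) (hab : a ≠ b) :
    act (slUnit b a) (topVector o a b 1) = 0 ∧
    (∃ c : ℂ, c ≠ 0 ∧
      act (slUnit b a) (topVector o a b (-1)) = c • (slUnit o a ⊗ₜ[ℂ] slUnit o a)) ∧
    act (slUnit a b) (slUnit o a ⊗ₜ[ℂ] slUnit o a) = -topVector o a b (-1) := by
  have hao := H.o_ne_a.symm
  have hbo := H.o_ne_b.symm
  have hba := hab.symm
  have e0 : (1 : ZMod 2) + 1 = 0 := rfl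
  refine ⟨?_, ⟨2 * sgn (par b * par a), ?_, ?_⟩, ?_⟩
  · rw [topVector, map_add, map_smul, act_slUnit, act_slUnit]
    rcases zmod2_cases (par b) with hb | hb <;>
      simp [hao, hba, H.par_o, ha, hb, sgn, e0]
  · exact mul_ne_zero two_ne_zero (sgn_ne_zero _)
  · rw [topVector, map_add, map_smul, act_slUnit, act_slUnit]
    rcases zmod2_cases (par b) with hb | hb <;>
      simp [hao, hba, H.par_o, ha, hb, sgn, e0] <;> module
  · rw [act_slUnit, topVector]
    rcases zmod2_cases (par b) with hb | hb <;>
      simp [hbo, H.par_o, ha, hb, sgn, e0]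

end Weights
end SLSuper

namespace SLSuper

variable {m n : ℕ}

theorem sub_projection_mem {C I : Submodule ℂ (sl m n ⊗[ℂ] sl m n)} (h : IsCompl C I)
    (t : sl m n ⊗[ℂ] sl m n) : t - C.projection I h t ∈ I := by
  rw [← Submodule.projection_apply_eq_zero_iff h, map_sub,
    Submodule.projection_apply_of_mem_left h (Submodule.projection_apply_mem h t), sub_self]

theorem projection_act {C I : Submodule ℂ (sl m n ⊗[ℂ] sl m n)} (hC : IsStable C)
    (hI : IsStable I) (h : IsCompl C I) (X : sl m n) (t : sl m n ⊗[ℂ] sl m n) :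
    C.projection I h (act X t) = act X (C.projection I h t) := by
  have h1 : act X t = act X (C.projection I h t) + act X (t - C.projection I h t) := by
    rw [← map_add, add_sub_cancel]
  rw [h1, map_add, Submodule.projection_apply_of_mem_left h
    (hC X _ (Submodule.projection_apply_mem h t)),
    (Submodule.projection_apply_eq_zero_iff h).2 (hI X _ (sub_projection_mem h t)), add_zero]

section

variable [hmn : Fact (n < m)] {o a b : Idx m n}

theorem CartanIndices.topVector_mem_altSq (H : CartanIndices o a b) :
    topVector o a b (-1) ∈ altSq m n := by
  rw [mem_altSq, superSwap_topVector H.par_o (by norm_num), neg_one_smul]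

theorem CartanIndices.topVector_mem_symSq (H : CartanIndices o a b) :
    topVector o a b 1 ∈ symSq m n := by
  rw [mem_symSq, superSwap_topVector H.par_o (by norm_num), one_smul]

theorem CartanIndices.topVector_eq_zero (H : CartanIndices o a b) (h : a = b) :
    topVector o a b (-1) = 0 := by
  rcases H.last with ⟨-, ha⟩ | ⟨-, h', -⟩
  · simp [topVector, ← h, ha, sgn_zero]
  · exact absurd h h'

/-- The highest weight vectors of the Cartan product are the multiples of `topVector o a b 1`. -/
theorem CartanIndices.eq_smul_topVector (H : CartanIndices o a b) {v : sl m n ⊗[ℂ] sl m n}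
    (hv : IsCartanHighestWeightVector v) : ∃ c : ℂ, c ≠ 0 ∧ v = c • topVector o a b 1 := by
  obtain ⟨hv0, hvU, hvH⟩ := hv
  obtain ⟨c, d, hcd⟩ := H.mem_span_of_weight (t := v) fun h => by
    rw [← H.weight h]
    refine hvH _ fun i j hij => ?_
    simp [coe_project, hij]
  rw [combination_eq] at hcd
  generalize (c + d * sgn (par a * par b)) / 2 = c' at hcd
  generalize (c - d * sgn (par a * par b)) / 2 = d' at hcd
  suffices h : v = c' • topVector o a b 1 by
    refine ⟨c', ?_, h⟩
    rintro rfl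
    exact hv0 (by rw [h, zero_smul])
  suffices h : d' • topVector o a b (-1) = 0 by rw [← hcd, h, add_zero]
  rcases H.last with ⟨hab, -⟩ | ⟨ha, hab, hlt⟩
  · rw [H.topVector_eq_zero hab, smul_zero]
  · obtain ⟨h1, ⟨e, he, h2⟩, h3⟩ := H.lower_raise ha hab
    have h4 := hvU (slUnit b a) (by
      intro i j hij
      rw [coe_slUnit, if_neg hab.symm, mul_zero, zero_smul, sub_zero, Matrix.single_apply, if_neg]
      rintro ⟨rfl, rfl⟩
      exact absurd hij (not_le.2 hlt))
    rw [← hcd, map_add, map_smul, map_smul, h1, h2, smul_zero, zero_add, smul_comm,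
      smul_eq_zero_iff_right he] at h4
    rw [← neg_eq_zero, ← smul_neg, ← h3, ← map_smul, h4, map_zero]

section Decomposition

variable {C I : Submodule ℂ (sl m n ⊗[ℂ] sl m n)}

theorem CartanIndices.topVector_mem (H : CartanIndices o a b) (h : IsCartanDecomposition C I) :
    topVector o a b 1 ∈ C := by
  obtain ⟨v, hv, hv'⟩ := h.highestWeight
  obtain ⟨c, hc, rfl⟩ := H.eq_smul_topVector hv'
  have := C.smul_mem c⁻¹ hv
  rwa [inv_smul_smul₀ hc] at this

theorem CartanIndices.topVector_ne_zero (H : CartanIndices o a b)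
    (h : IsCartanDecomposition C I) : topVector o a b 1 ≠ 0 := by
  obtain ⟨v, -, hv⟩ := h.highestWeight
  obtain ⟨c, hc, hvc⟩ := H.eq_smul_topVector hv
  intro h0
  exact hv.1 (by rw [hvc, h0, smul_zero])

theorem CartanIndices.left_le (H : CartanIndices o a b) (h : IsCartanDecomposition C I)
    {N : Submodule ℂ (sl m n ⊗[ℂ] sl m n)} (hN : IsStable N) (hv : topVector o a b 1 ∈ N) :
    C ≤ N := by
  rcases h.simple (N ⊓ C) (fun X t ht => ⟨hN X t ht.1, h.stable_left X t ht.2⟩) inf_le_right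
    with h1 | h1
  · exfalso
    have h2 : topVector o a b 1 ∈ N ⊓ C := ⟨hv, H.topVector_mem h⟩
    rw [h1, Submodule.mem_bot] at h2
    exact H.topVector_ne_zero h h2
  · rw [← h1]; exact inf_le_left

theorem CartanIndices.left_le_symSq (H : CartanIndices o a b) (h : IsCartanDecomposition C I) :
    C ≤ symSq m n := H.left_le h isStable_symSq H.topVector_mem_symSq

/-- An endomorphism of `𝔤 ⊗ 𝔤` with image in the Cartan product vanishes if it kills the vectors
of the highest weight. -/
theorem CartanIndices.operator_eq_zero (H : CartanIndices o a b) (h : IsCartanDecomposition C I)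
    (S : Module.End ℂ (sl m n ⊗[ℂ] sl m n)) (hS : ∀ X t, S (act X t) = act X (S t))
    (hSC : ∀ t, S t ∈ C) (h1 : S (topVector o a b 1) = 0) (h2 : S (topVector o a b (-1)) = 0)
    (t : sl m n ⊗[ℂ] sl m n) : S t = 0 := by
  have h3 : ∀ c d : ℂ, S (c • (slUnit o a ⊗ₜ[ℂ] slUnit o b) +
      d • (slUnit o b ⊗ₜ[ℂ] slUnit o a)) = 0 := by
    intro c d
    rw [combination_eq, map_add, map_smul, map_smul, h1, h2, smul_zero, smul_zero, add_zero]
  have h4 : S = 0 := by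
    refine tensor_ext fun i j k l => ?_
    have hst : IsStable (Submodule.span ℂ (Set.range
        fun x : Idx m n × Idx m n × Idx m n × Idx m n =>
          S (slUnit x.1 x.2.1 ⊗ₜ[ℂ] slUnit x.2.2.1 x.2.2.2))) := by
      have h5 : Submodule.span ℂ (Set.range
          fun x : Idx m n × Idx m n × Idx m n × Idx m n =>
            S (slUnit x.1 x.2.1 ⊗ₜ[ℂ] slUnit x.2.2.1 x.2.2.2)) = LinearMap.range S := by
        rw [LinearMap.range_eq_map, ← span_slUnit_tmul, Submodule.map_span, ← Set.range_comp]
        rfl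
      rw [h5]
      rintro X _ ⟨t, rfl⟩
      exact ⟨act X t, hS X t⟩
    refine H.family_eq_zero h.simple h.highestWeight
      (fun x => S (slUnit x.1 x.2.1 ⊗ₜ[ℂ] slUnit x.2.2.1 x.2.2.2)) (fun x => hSC _) hst
      (fun g x => ?_) ?_ ?_ (i, j, k, l)
    · rw [← hS, act_project_diagonal, map_smul]
    · simpa using h3 1 0
    · simpa using h3 0 1
  rw [h4, LinearMap.zero_apply]

/-- The complement of the Cartan product is unique. -/
theorem CartanIndices.right_eq (H : CartanIndices o a b) (h : IsCartanDecomposition C I)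
    {I' : Submodule ℂ (sl m n ⊗[ℂ] sl m n)} (h' : IsCartanDecomposition C I')
    (hI' : altSq m n ≤ I') : I = I' := by
  set P := C.projection I h.isCompl with hP
  set P' := C.projection I' h'.isCompl with hP'
  have hPact := projection_act h.stable_left h.stable_right h.isCompl
  have hPact' := projection_act h'.stable_left h'.stable_right h'.isCompl
  -- The projection kills the antisymmetric vector of the highest weight, since this vector is
  -- obtained from `slUnit o a ⊗ slUnit o a`, which the projection kills.
  have hPw : P (topVector o a b (-1)) = 0 := by
    rcases H.last with ⟨hab, -⟩ | ⟨ha, hab, hlt⟩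
    · rw [H.topVector_eq_zero hab, map_zero]
    · obtain ⟨h1, ⟨e, he, h2⟩, h3⟩ := H.lower_raise ha hab
      have h4 : act (slUnit b a) (P (topVector o a b (-1))) = 0 := by
        obtain ⟨c, d, hcd⟩ := H.mem_span_of_weight (t := P (topVector o a b (-1))) fun g => by
          rw [← hPact, topVector, map_add, map_smul, act_project_diagonal, act_project_diagonal,
            ← map_smul]
          congr 1
          module
        have hsym : P (topVector o a b (-1)) ∈ symSq m n :=
          H.left_le_symSq h (Submodule.projection_apply_mem _ _)
        rw [combination_eq] at hcd
        generalize (c + d * sgn (par a * par b)) / 2 = c' at hcd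
        generalize (c - d * sgn (par a * par b)) / 2 = d' at hcd
        rw [mem_symSq, ← hcd, map_add, map_smul, map_smul, mem_symSq.1 H.topVector_mem_symSq,
          mem_altSq.1 H.topVector_mem_altSq, smul_neg] at hsym
        have h5 : d' • topVector o a b (-1) = 0 := by
          have h6 := add_left_cancel hsym
          rw [neg_eq_iff_add_eq_zero, ← two_smul ℂ] at h6
          exact (smul_eq_zero_iff_right two_ne_zero).1 h6
        rw [← hcd, h5, add_zero, map_smul, h1, smul_zero]
      rw [← hPact, h2, map_smul, smul_eq_zero_iff_right he] at h4
      rw [← neg_eq_zero, ← map_neg, ← h3, hPact, h4, map_zero]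
  have hzero : ∀ t, P (t - P' t) = 0 := by
    refine H.operator_eq_zero h (P ∘ₗ (LinearMap.id - P')) (fun X t => ?_)
      (fun t => Submodule.projection_apply_mem _ _) ?_ ?_
    · simp only [LinearMap.comp_apply, LinearMap.sub_apply, LinearMap.id_apply]
      rw [hPact', ← map_sub, hPact]
    · simp only [LinearMap.comp_apply, LinearMap.sub_apply, LinearMap.id_apply]
      rw [Submodule.projection_apply_of_mem_left _ (H.topVector_mem h), sub_self, map_zero]
    · simp only [LinearMap.comp_apply, LinearMap.sub_apply, LinearMap.id_apply]
      rw [(Submodule.projection_apply_eq_zero_iff _).2 (hI' H.topVector_mem_altSq), sub_zero, hPw]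
  have hle : I' ≤ I := by
    intro t ht
    have h1 := hzero t
    rw [(Submodule.projection_apply_eq_zero_iff h'.isCompl).2 ht, sub_zero] at h1
    exact (Submodule.projection_apply_eq_zero_iff _).1 h1
  refine le_antisymm (fun t ht => ?_) hle
  have h1 := I.sub_mem ht (hle (sub_projection_mem h'.isCompl t))
  rw [sub_sub_cancel] at h1
  have h2 : P' t = 0 :=
    (Submodule.disjoint_def.1 h.isCompl.disjoint) _ (Submodule.projection_apply_mem _ _) h1
  exact (Submodule.projection_apply_eq_zero_iff _).1 h2

/-- A complement of the Cartan product in `⊙² 𝔤` gives a complement in `𝔤 ⊗ 𝔤`. -/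
theorem CartanIndices.isCartanDecomposition_sup (H : CartanIndices o a b)
    (h : IsCartanDecomposition C I) {N : Submodule ℂ (sl m n ⊗[ℂ] sl m n)} (hN : IsStable N)
    (hd : Disjoint N C) (hs : N ⊔ C = symSq m n) :
    IsCartanDecomposition C (N ⊔ altSq m n) where
  stable_left := h.stable_left
  stable_right := by
    intro X t ht
    obtain ⟨x, hx, y, hy, rfl⟩ := Submodule.mem_sup.1 ht
    rw [map_add]
    exact Submodule.add_mem_sup (hN X x hx) (isStable_altSq X y hy)
  simple := h.simple
  highestWeight := h.highestWeight
  isCompl := by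
    have hNs : N ≤ symSq m n := hs ▸ le_sup_left
    constructor
    · rw [Submodule.disjoint_def]
      intro t htC ht
      obtain ⟨x, hx, y, hy, rfl⟩ := Submodule.mem_sup.1 ht
      have h1 := H.left_le_symSq h htC
      rw [mem_symSq, map_add, hNs hx, mem_altSq.1 hy] at h1
      have h2 : y = 0 := by
        have h3 := add_left_cancel h1
        rw [neg_eq_iff_add_eq_zero, ← two_smul ℂ] at h3
        exact (smul_eq_zero_iff_right two_ne_zero).1 h3
      rw [h2, add_zero] at htC ⊢
      exact Submodule.disjoint_def.1 hd x hx htC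
    · rw [codisjoint_iff, eq_top_iff]
      rintro t -
      have h1 : (1 / 2 : ℂ) • (t + superSwap m n t) ∈ symSq m n := by
        rw [mem_symSq, map_smul, map_add, superSwap_superSwap, add_comm]
      have h2 : (1 / 2 : ℂ) • (t - superSwap m n t) ∈ altSq m n := by
        rw [mem_altSq, map_smul, map_sub, superSwap_superSwap, ← smul_neg, neg_sub]
      have h3 : t = (1 / 2 : ℂ) • (t + superSwap m n t) + (1 / 2 : ℂ) • (t - superSwap m n t) := by
        module
      rw [h3, sup_comm C, sup_right_comm, hs]
      exact Submodule.add_mem_sup h1 h2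

/-- With a decomposition `𝔤 ⊗ 𝔤 = C ⊕ I` at hand, in which `I` contains the antisymmetric tensors,
the Cartan product is `C` and its complement is `I`. -/
theorem CartanIndices.cartanProduct_eq (H : CartanIndices o a b) (h : IsCartanDecomposition C I) :
    cartanProduct m n = C := by
  refine le_antisymm (sSup_le ?_) (le_sSup ⟨I, h⟩)
  rintro C' ⟨I', h'⟩
  exact H.left_le h' h.stable_left (H.topVector_mem h)

theorem CartanIndices.cartanComplement_eq (H : CartanIndices o a b)
    (h : IsCartanDecomposition C I) (hI : altSq m n ≤ I) : cartanComplement m n = I := by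
  refine le_antisymm (sSup_le ?_) (le_sSup ⟨C, h⟩)
  rintro I' ⟨C', h'⟩
  have hC : C' = C := le_antisymm (H.left_le h' h.stable_left (H.topVector_mem h))
    (H.left_le h h'.stable_left (H.topVector_mem h'))
  subst hC
  exact (H.right_eq h' h hI).le

end Decomposition

/-! ### Quadratic minors -/

/-- The sign in the super-antisymmetrization of `E i j ⊗ E k l` in `i` and `k`. -/
def minorSign (i j k : Idx m n) : ℂ := sgn (par i * par j + par j * par k + par i * par k)

/-- The quadratic minors `E i j ⊗ E k l ∓ E k j ⊗ E i l`. -/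
def minorTensor (i j k l : Idx m n) : sl m n ⊗[ℂ] sl m n :=
  slUnit i j ⊗ₜ slUnit k l - minorSign i j k • (slUnit k j ⊗ₜ slUnit i l)

theorem act_minorTensor (p q i j k l : Idx m n) : act (slUnit p q) (minorTensor i j k l) =
    (if q = i then minorTensor p j k l else 0) -
    sgn ((par p + par q) * (par i + par j)) • (if p = j then minorTensor i q k l else 0) +
    sgn ((par p + par q) * (par i + par j)) • ((if q = k then minorTensor i j p l else 0) -
      sgn ((par p + par q) * (par k + par l)) • (if p = l then minorTensor i j k q else 0)) := by
  have z1 : ∀ p i j k : ZMod 2, (i * j + j * k + i * k) + (p + i) * (k + j) =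
      p * j + j * k + p * k := by decide
  have z2 : ∀ q i j k : ZMod 2, (i * j + j * k + i * k) + (j + q) * (k + j) =
      (j + q) * (i + j) + (i * q + q * k + i * k) := by decide
  have z3 : ∀ p i j k : ZMod 2, i * j + j * k + i * k =
      (p + k) * (i + j) + (i * j + j * p + i * p) := by decide
  have z4 : ∀ p q i j k l : ZMod 2, (i * j + j * k + i * k) + (p + q) * (k + j) +
      (p + q) * (i + l) = (p + q) * (i + j) + (p + q) * (k + l) + (i * j + j * k + i * k) := by
    decide
  have e1 : q = i → minorSign i j k * sgn ((par p + par q) * (par k + par j)) =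
      minorSign p j k := by
    rintro rfl
    rw [minorSign, ← sgn_add, z1, minorSign]
  have e2 : p = j → minorSign i j k * sgn ((par p + par q) * (par k + par j)) =
      sgn ((par p + par q) * (par i + par j)) * minorSign i q k := by
    rintro rfl
    rw [minorSign, ← sgn_add, z2, sgn_add, minorSign]
  have e3 : q = k → minorSign i j k =
      sgn ((par p + par q) * (par i + par j)) * minorSign i j p := by
    rintro rfl
    rw [minorSign, z3 (par p), sgn_add, minorSign]
  have e4 : minorSign i j k * sgn ((par p + par q) * (par k + par j)) *
      sgn ((par p + par q) * (par i + par l)) = sgn ((par p + par q) * (par i + par j)) *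
      sgn ((par p + par q) * (par k + par l)) * minorSign i j k := by
    rw [minorSign, ← sgn_add, ← sgn_add, ← sgn_add, ← sgn_add, z4]
  have f1 : (if q = i then slUnit p j ⊗ₜ[ℂ] slUnit k l else 0) -
      (minorSign i j k * sgn ((par p + par q) * (par k + par j))) •
        (if q = i then slUnit k j ⊗ₜ[ℂ] slUnit p l else 0) =
      if q = i then minorTensor p j k l else 0 := by
    split_ifs with h
    · rw [e1 h, minorTensor]
    · simp
  have f2 : sgn ((par p + par q) * (par i + par j)) •
      (if p = j then slUnit i q ⊗ₜ[ℂ] slUnit k l else 0) -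
      (minorSign i j k * sgn ((par p + par q) * (par k + par j))) •
        (if p = j then slUnit k q ⊗ₜ[ℂ] slUnit i l else 0) =
      sgn ((par p + par q) * (par i + par j)) • if p = j then minorTensor i q k l else 0 := by
    split_ifs with h
    · rw [e2 h, minorTensor, smul_sub, smul_smul]
    · simp
  have f3 : sgn ((par p + par q) * (par i + par j)) •
      (if q = k then slUnit i j ⊗ₜ[ℂ] slUnit p l else 0) -
      minorSign i j k • (if q = k then slUnit p j ⊗ₜ[ℂ] slUnit i l else 0) =
      sgn ((par p + par q) * (par i + par j)) • if q = k then minorTensor i j p l else 0 := by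
    split_ifs with h
    · rw [e3 h, minorTensor, smul_sub, smul_smul]
    · simp
  have f4 : (sgn ((par p + par q) * (par i + par j)) * sgn ((par p + par q) * (par k + par l))) •
      (if p = l then slUnit i j ⊗ₜ[ℂ] slUnit k q else 0) -
      (minorSign i j k * sgn ((par p + par q) * (par k + par j)) *
      sgn ((par p + par q) * (par i + par l))) •
        (if p = l then slUnit k j ⊗ₜ[ℂ] slUnit i q else 0) =
      (sgn ((par p + par q) * (par i + par j)) * sgn ((par p + par q) * (par k + par l))) •
        if p = l then minorTensor i j k q else 0 := by
    rw [e4]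
    split_ifs with h
    · rw [minorTensor, smul_sub, smul_smul]
    · simp
  rw [smul_sub, smul_smul, ← f1, ← f2, ← f3, ← f4, minorTensor, map_sub, map_smul, act_slUnit,
    act_slUnit]
  simp only [smul_sub, smul_add, smul_smul, mul_assoc]
  abel

theorem act_project_diagonal_minorTensor (h : Idx m n → ℂ) (i j k l : Idx m n) :
    act (project m n (Matrix.diagonal h)) (minorTensor i j k l) =
      (h i - h j + h k - h l) • minorTensor i j k l := by
  rw [minorTensor, map_sub, map_smul, act_project_diagonal, act_project_diagonal, smul_sub,
    smul_comm (minorSign i j k)]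
  congr 2
  ring

/-- The minors lie in the complement of the Cartan product, because they span a submodule in which
the highest weight of the Cartan product does not occur. -/
theorem CartanIndices.minorTensor_mem (H : CartanIndices o a b)
    {C I : Submodule ℂ (sl m n ⊗[ℂ] sl m n)} (h : IsCartanDecomposition C I)
    (i j k l : Idx m n) : minorTensor i j k l ∈ I := by
  rw [← Submodule.projection_apply_eq_zero_iff h.isCompl]
  set P := C.projection I h.isCompl with hP
  have hPact := projection_act h.stable_left h.stable_right h.isCompl
  have hmem : ∀ i j k l : Idx m n, P (minorTensor i j k l) ∈ Submodule.span ℂ (Set.range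
      fun x : Idx m n × Idx m n × Idx m n × Idx m n =>
        P (minorTensor x.1 x.2.1 x.2.2.1 x.2.2.2)) :=
    fun i j k l => Submodule.subset_span ⟨(i, j, k, l), rfl⟩
  refine H.family_eq_zero h.simple h.highestWeight
    (fun x => P (minorTensor x.1 x.2.1 x.2.2.1 x.2.2.2))
    (fun x => Submodule.projection_apply_mem _ _) ?_ (fun g x => ?_) ?_ ?_ (i, j, k, l)
  · refine isStable_of_slUnit fun p q => ?_
    change Submodule.span ℂ _ ≤ (Submodule.span ℂ _).comap (act (slUnit p q))
    rw [Submodule.span_le]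
    rintro _ ⟨⟨i, j, k, l⟩, rfl⟩
    rw [SetLike.mem_coe, Submodule.mem_comap, ← hPact, act_minorTensor]
    have hite : ∀ (c : Prop) [Decidable c] (i j k l : Idx m n),
        P (if c then minorTensor i j k l else 0) ∈ Submodule.span ℂ (Set.range
          fun x : Idx m n × Idx m n × Idx m n × Idx m n =>
            P (minorTensor x.1 x.2.1 x.2.2.1 x.2.2.2)) := by
      intro c _ i j k l
      split_ifs
      · exact hmem i j k l
      · rw [map_zero]; exact zero_mem _
    simp only [map_add, map_sub, map_smul]
    exact add_mem (sub_mem (hite _ _ _ _ _) (Submodule.smul_mem _ _ (hite _ _ _ _ _)))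
      (Submodule.smul_mem _ _ (sub_mem (hite _ _ _ _ _) (Submodule.smul_mem _ _ (hite _ _ _ _ _))))
  · rw [← hPact, act_project_diagonal_minorTensor, map_smul]
  · simp [minorTensor, minorSign, H.par_o, sgn_zero]
  · simp [minorTensor, minorSign, H.par_o, sgn_zero]

end
end SLSuper

namespace SLSuper

/-! ### The enveloping algebra and its ideals of infinite codimension -/

variable {m n : ℕ}

/-- Multiplication `𝔤 ⊗ 𝔤 → U(𝔤)`. -/
def mulU (m n : ℕ) : sl m n ⊗[ℂ] sl m n →ₗ[ℂ] U m n := (toU m n).toLinearMap ∘ₗ tι₂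

theorem mulU_tmul (X Y : sl m n) : mulU m n (X ⊗ₜ Y) = uι X * uι Y := by
  simp [mulU, tι₂, uι_apply]

/-- The bracket as a linear map on `𝔤 ⊗ 𝔤`. -/
def bracketTensor (m n : ℕ) : sl m n ⊗[ℂ] sl m n →ₗ[ℂ] sl m n := TensorProduct.lift bracket

theorem bracketTensor_tmul (X Y : sl m n) : bracketTensor m n (X ⊗ₜ Y) = bracket X Y :=
  TensorProduct.lift.tmul _ _

theorem mem_idealSubmodule {K : TwoSidedIdeal (U m n)} {u : U m n} :
    u ∈ idealSubmodule K ↔ u ∈ K := by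
  rw [idealSubmodule, Submodule.restrictScalars_mem, TwoSidedIdeal.mem_asIdeal]

theorem mem_filt_one {u : U m n} :
    u ∈ filt m n 1 ↔ ∃ (c : ℂ) (X : sl m n), u = algebraMap ℂ (U m n) c + uι X := by
  have h : filt m n 1 = 1 ⊔ LinearMap.range (uι (m := m) (n := n)) := by
    simp [filt, Finset.range_add_one, iSup_or, iSup_sup_eq, sup_comm]
  rw [h, Submodule.mem_sup]
  constructor
  · rintro ⟨_, hy, _, ⟨X, rfl⟩, rfl⟩
    obtain ⟨c, rfl⟩ := Submodule.mem_one.1 hy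
    exact ⟨c, X, rfl⟩
  · rintro ⟨c, X, rfl⟩
    exact ⟨_, Submodule.mem_one.2 ⟨c, rfl⟩, _, ⟨X, rfl⟩, rfl⟩

instance : FiniteDimensional ℂ (filt m n 1) := by
  have h : filt m n 1 = LinearMap.range ((Algebra.linearMap ℂ (U m n)).coprod uι) := by
    ext u
    rw [mem_filt_one, LinearMap.mem_range]
    constructor
    · rintro ⟨c, X, rfl⟩
      exact ⟨(c, X), rfl⟩
    · rintro ⟨⟨c, X⟩, rfl⟩
      exact ⟨c, X, rfl⟩
  rw [h]
  infer_instance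

section

variable [hmn : Fact (n < m)]

/-- The images of the matrix units in `U(𝔤)`. -/
def envelopingGenerators (m n : ℕ) [Fact (n < m)] : GLGenerators m n (U m n) where
  F i j := uι (slUnit i j)
  π := parityAut m n
  π_F i j := parityAut_of_isHomog (isHomog_slUnit i j)
  comm i j k l := by
    rw [uι_rel (isHomog_slUnit i j) (isHomog_slUnit k l), bracket_slUnit, map_sub, map_smul]
    congr 2
    · split_ifs <;> simp
    · split_ifs <;> simp
  gen := by
    rw [eq_top_iff]
    rintro u -
    obtain ⟨t, rfl⟩ := RingQuot.mkAlgHom_surjective ℂ (EnvRel m n) u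
    change toU m n t ∈ _
    induction t using TensorAlgebra.induction with
    | algebraMap c => rw [AlgHom.commutes]; exact Subalgebra.algebraMap_mem _ c
    | ι X =>
      rw [← uι_apply, eq_sum_slUnit X, map_sum]
      refine sum_mem fun i _ => ?_
      rw [map_sum]
      refine sum_mem fun j _ => ?_
      rw [map_smul]
      exact Subalgebra.smul_mem _ (Algebra.subset_adjoin (Set.mem_range_self (i, j))) _
    | mul a b ha hb => rw [map_mul]; exact mul_mem ha hb
    | add a b ha hb => rw [map_add]; exact add_mem ha hb

theorem envelopingGenerators_F (i j : Idx m n) :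
    (envelopingGenerators m n).F i j = uι (slUnit i j) := rfl

theorem sad_uι (p q : Idx m n) (X : sl m n) :
    (envelopingGenerators m n).sad (par p + par q) (uι (slUnit p q)) (uι X) =
      uι (bracket (slUnit p q) X) := by
  have key : ∀ k l : Idx m n,
      (envelopingGenerators m n).sad (par p + par q) (uι (slUnit p q)) (uι (slUnit k l)) =
      uι (bracket (slUnit p q) (slUnit k l)) := by
    intro k l
    rw [GLGenerators.sad_apply, ← envelopingGenerators_F, ← envelopingGenerators_F,
      GLGenerators.twist_F, smul_mul_assoc, envelopingGenerators_F, envelopingGenerators_F,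
      uι_rel (isHomog_slUnit p q) (isHomog_slUnit k l)]
  rw [eq_sum_slUnit X]
  simp only [map_sum, map_smul, key]

theorem sad_mulU (p q : Idx m n) (t : sl m n ⊗[ℂ] sl m n) :
    (envelopingGenerators m n).sad (par p + par q) (uι (slUnit p q)) (mulU m n t) =
      mulU m n (act (slUnit p q) t) := by
  have key : (envelopingGenerators m n).sad (par p + par q) (uι (slUnit p q)) ∘ₗ mulU m n =
      mulU m n ∘ₗ act (slUnit p q) := by
    refine tensor_ext fun i j k l => ?_
    rw [LinearMap.comp_apply, LinearMap.comp_apply, mulU_tmul, GLGenerators.sad_mul, sad_uι,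
      sad_uι, ← envelopingGenerators_F i j, GLGenerators.twist_F, envelopingGenerators_F,
      act_tmul (isHomog_slUnit p q) (isHomog_slUnit i j), map_add, map_smul, mulU_tmul, mulU_tmul,
      smul_mul_assoc]
  exact LinearMap.congr_fun key t

theorem mulU_superSwap (t : sl m n ⊗[ℂ] sl m n) :
    mulU m n (superSwap m n t) = mulU m n t - uι (bracketTensor m n t) := by
  have key : mulU m n ∘ₗ superSwap m n = mulU m n - uι ∘ₗ bracketTensor m n := by
    refine tensor_ext fun i j k l => ?_
    have h := uι_rel (isHomog_slUnit i j) (isHomog_slUnit k l)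
    rw [LinearMap.comp_apply, LinearMap.sub_apply, LinearMap.comp_apply, superSwap_slUnit,
      map_smul, mulU_tmul, mulU_tmul, bracketTensor_tmul, ← h, sub_sub_cancel]
  exact LinearMap.congr_fun key t

theorem sad_mem_idealSubmodule {K : TwoSidedIdeal (U m n)} (p : ZMod 2) (d : U m n) {u : U m n}
    (hu : u ∈ idealSubmodule K) : (envelopingGenerators m n).sad p d u ∈ idealSubmodule K :=
  (envelopingGenerators m n).sad_mem (TwoSidedIdeal.asIdeal K) p d hu

/-- An ideal has finite codimension if some finite-dimensional space spans a left ideal with it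
that contains `1`. -/
theorem not_infiniteCodim {K : TwoSidedIdeal (U m n)} (V : Submodule ℂ (U m n))
    [FiniteDimensional ℂ V] (h1 : 1 ∈ idealSubmodule K ⊔ V)
    (h : ∀ i j, ∀ v ∈ V, uι (slUnit i j) * v ∈ idealSubmodule K ⊔ V) : ¬ InfiniteCodim K := by
  have key : ∀ u : U m n, ∀ w ∈ idealSubmodule K ⊔ V, u * w ∈ idealSubmodule K ⊔ V := by
    intro u
    refine (envelopingGenerators m n).induction
      (P := fun u => ∀ w ∈ idealSubmodule K ⊔ V, u * w ∈ idealSubmodule K ⊔ V) ?_ ?_ ?_ ?_ u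
    · intro c w hw
      rw [← Algebra.smul_def]
      exact Submodule.smul_mem _ c hw
    · intro i j w hw
      obtain ⟨x, hx, v, hv, rfl⟩ := Submodule.mem_sup.1 hw
      rw [mul_add]
      exact add_mem (Submodule.mem_sup_left ((TwoSidedIdeal.asIdeal K).mul_mem_left _ hx))
        (h i j v hv)
    · intro x y hx hy w hw
      rw [add_mul]
      exact add_mem (hx w hw) (hy w hw)
    · intro x y hx hy w hw
      rw [mul_assoc]
      exact hx _ (hy w hw)
  rw [InfiniteCodim, not_not]
  refine Module.Finite.of_surjective ((idealSubmodule K).mkQ ∘ₗ V.subtype) fun u => ?_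
  obtain ⟨u, rfl⟩ := Submodule.Quotient.mk_surjective _ u
  have hu := key u 1 h1
  rw [mul_one] at hu
  obtain ⟨x, hx, v, hv, rfl⟩ := Submodule.mem_sup.1 hu
  refine ⟨⟨v, hv⟩, ?_⟩
  rw [LinearMap.comp_apply, Submodule.mkQ_apply, Submodule.Quotient.eq]
  simpa using hx

theorem one_notMem {K : TwoSidedIdeal (U m n)} (hK : InfiniteCodim K) : (1 : U m n) ∉ K := by
  intro h
  exact not_infiniteCodim (K := K) ⊥ (Submodule.mem_sup_left (mem_idealSubmodule.2 h))
    (by simp) hK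

theorem coe_bracket_slUnit_self (p : Idx m n) (X : sl m n) (a b : Idx m n) :
    (bracket (slUnit p p) X : Mat m n) a b =
      ((if p = a then 1 else 0) - if p = b then 1 else 0) * (X : Mat m n) a b := by
  have h : bracket (slUnit p p) X =
      ∑ i, ∑ j, (((if p = i then 1 else 0) - if p = j then 1 else 0) * (X : Mat m n) i j) •
        slUnit i j := by
    conv_lhs => rw [eq_sum_slUnit X]
    simp only [map_sum, map_smul, bracket_slUnit, zmod2_add_self, zero_mul, sgn_zero, one_smul]
    refine Finset.sum_congr rfl fun i _ => Finset.sum_congr rfl fun j _ => ?_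
    have e1 : (if p = i then slUnit p j else 0) = if p = i then slUnit i j else 0 := by
      split_ifs with e <;> simp [e]
    have e2 : (if p = j then slUnit i p else 0) = if p = j then slUnit i j else 0 := by
      split_ifs with e <;> simp [e]
    rw [e1, e2]
    generalize slUnit i j = Z
    split_ifs <;> module
  have h' := project_eq_sum (Matrix.of fun i j =>
    ((if p = i then 1 else 0) - if p = j then 1 else 0) * (X : Mat m n) i j)
  simp only [Matrix.of_apply] at h'
  rw [h, ← h', coe_project]
  simp [str]

/-- An ideal of `𝔤` that is not zero contains all matrix units. -/
theorem slUnit_mem_of_ne_zero (h3 : ∀ i j : Idx m n, ∃ r, r ≠ i ∧ r ≠ j)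
    {k : Submodule ℂ (sl m n)} (hk : ∀ p q, ∀ X ∈ k, bracket (slUnit p q) X ∈ k)
    {X : sl m n} (hX : X ∈ k) (hX0 : X ≠ 0) (p q : Idx m n) : slUnit p q ∈ k := by
  have step1 : ∃ i j, i ≠ j ∧ slUnit i j ∈ k := by
    by_cases hd : ∃ i j, i ≠ j ∧ (X : Mat m n) i j ≠ 0
    · obtain ⟨i, j, hij, hx⟩ := hd
      -- The brackets with `slUnit j j` and `slUnit i i` leave the entries at `(i, j)` and `(j, i)`,
      -- and another bracket with `slUnit i i` separates these two.
      refine ⟨i, j, hij, ?_⟩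
      have h1 := hk i i _ (hk j j X hX)
      have h2 := hk i i _ h1
      have h3 := k.smul_mem (-(2 * (X : Mat m n) i j)⁻¹) (k.add_mem h1 h2)
      convert h3 using 1
      apply Subtype.ext
      ext a b
      rw [coe_slUnit, if_neg hij, mul_zero, zero_smul, sub_zero, Submodule.coe_smul,
        Submodule.coe_add, Matrix.smul_apply, Matrix.add_apply, Matrix.single_apply, smul_eq_mul]
      simp only [coe_bracket_slUnit_self]
      by_cases ha : i = a
      · subst ha
        by_cases hb : j = b
        · subst hb
          simp [hij, hij.symm]
          field_simp
          norm_num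
        · by_cases hb' : i = b
          · simp [hb', hb]
          · simp [hij.symm, hb]
      · by_cases hb : i = b
        · subst hb
          simp [ha]
        · simp [ha, hb]
    · push Not at hd
      have hX1 : X = ∑ r, (X : Mat m n) r r • slUnit r r := by
        conv_lhs => rw [eq_sum_slUnit X]
        refine Finset.sum_congr rfl fun r _ => ?_
        rw [Finset.sum_eq_single r (fun s _ hs => by rw [hd r s hs.symm, zero_smul]) (by simp)]
      obtain ⟨i, j, hij, hx⟩ : ∃ i j, i ≠ j ∧ (X : Mat m n) i i ≠ (X : Mat m n) j j := by
        by_contra! hc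
        apply hX0
        have i : Idx m n := Sum.inl ⟨0, (Nat.zero_le n).trans_lt hmn.out⟩
        have : ∀ r, (X : Mat m n) r r = (X : Mat m n) i i := fun r => by
          by_cases h : r = i
          · rw [h]
          · exact hc r i h
        rw [hX1]
        simp only [this, ← Finset.smul_sum, sum_slUnit, smul_zero]
      refine ⟨i, j, hij, ?_⟩
      have h1 := hk i j X hX
      rw [hX1] at h1
      simp only [map_sum, map_smul, bracket_slUnit, zmod2_add_self, mul_zero, sgn_zero, one_smul,
        smul_sub, Finset.sum_sub_distrib, smul_ite, smul_zero, Finset.sum_ite_eq, Finset.mem_univ,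
        if_true, ← sub_smul] at h1
      have h2 := k.smul_mem ((X : Mat m n) j j - (X : Mat m n) i i)⁻¹ h1
      rwa [inv_smul_smul₀ (sub_ne_zero.2 hx.symm)] at h2
  have left : ∀ {i j}, slUnit i j ∈ k → ∀ r, r ≠ j → slUnit r j ∈ k := by
    intro i j h r hr
    have := hk r i _ h
    simpa [bracket_slUnit, hr] using this
  have right : ∀ {i j}, slUnit i j ∈ k → ∀ r, i ≠ r → slUnit i r ∈ k := by
    intro i j h r hr
    have := hk j r _ h
    rw [bracket_slUnit, if_neg hr.symm, if_pos rfl, zero_sub, Submodule.neg_mem_iff] at this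
    exact (Submodule.smul_mem_iff _ (sgn_ne_zero _)).1 this
  -- A third index `r` allows passing from the place `(i, j)` to any other one.
  have off : ∀ p q, p ≠ q → slUnit p q ∈ k := by
    intro p q hpq
    obtain ⟨i, j, hij, h⟩ := step1
    obtain ⟨r, hr, hr'⟩ := h3 j q
    exact left (right (left h r hr) q hr') p hpq
  by_cases hpq : p = q
  · subst hpq
    have h1 : ∀ r, slUnit r r - (sgn (par r) * sgn (par p)) • slUnit p p ∈ k := by
      intro r
      by_cases hr : r = p
      · rw [hr, sgn_mul_sgn, one_smul, sub_self]; exact k.zero_mem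
      · have := hk r p _ (off p r (Ne.symm hr))
        rwa [bracket_slUnit, if_pos rfl, if_pos rfl, add_comm (par p), zmod2_mul_self,
          sgn_add] at this
    -- The unit matrix vanishes in `𝔰𝔩(m|n)`, and its supertrace `m - n` is not zero.
    have h2 := k.sum_mem (t := Finset.univ) fun r _ => h1 r
    rw [Finset.sum_sub_distrib, sum_slUnit, zero_sub, Submodule.neg_mem_iff, ← Finset.sum_smul,
      ← Finset.sum_mul, sum_sgn_par] at h2
    exact (Submodule.smul_mem_iff _ (mul_ne_zero sub_ne_zero_of_fact (sgn_ne_zero _))).1 h2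
  · exact off p q hpq

/-- An ideal of infinite codimension does not meet `𝔤`. -/
theorem eq_zero_of_uι_mem (h3 : ∀ i j : Idx m n, ∃ r, r ≠ i ∧ r ≠ j) {K : TwoSidedIdeal (U m n)}
    (hK : InfiniteCodim K) {X : sl m n} (hX : uι X ∈ K) : X = 0 := by
  by_contra hX0
  have h1 : ∀ p q, slUnit p q ∈ (idealSubmodule K).comap (uι (m := m) (n := n)) :=
    slUnit_mem_of_ne_zero h3 (fun p q Y hY => by
      rw [Submodule.mem_comap] at hY ⊢
      rw [← sad_uι]
      exact sad_mem_idealSubmodule _ _ hY) (Submodule.mem_comap.2 (mem_idealSubmodule.2 hX)) hX0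
  refine not_infiniteCodim (K := K) (ℂ ∙ 1)
    (Submodule.mem_sup_right (Submodule.mem_span_singleton_self 1)) (fun i j v hv => ?_) hK
  refine Submodule.mem_sup_left (mem_idealSubmodule.2 (K.mul_mem_right _ _ ?_))
  exact mem_idealSubmodule.1 (h1 i j)

theorem isStable_grTwo (K : TwoSidedIdeal (U m n)) : IsStable (grTwo K) := by
  refine isStable_of_slUnit fun p q t ht => ⟨isStable_symSq _ _ ht.1, ?_⟩
  obtain ⟨x, hx, y, hy, hxy⟩ := Submodule.mem_sup.1 (Submodule.mem_comap.1 ht.2)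
  obtain ⟨c, X, rfl⟩ := mem_filt_one.1 hy
  change mulU m n (act (slUnit p q) t) ∈ idealSubmodule K ⊔ filt m n 1
  change _ = mulU m n t at hxy
  rw [← sad_mulU, ← hxy, map_add]
  refine add_mem (Submodule.mem_sup_left (sad_mem_idealSubmodule _ _ hx))
    (Submodule.mem_sup_right (mem_filt_one.2 ⟨0, bracket (slUnit p q) X, ?_⟩))
  rw [map_add, sad_uι, Algebra.algebraMap_eq_smul_one, map_smul, GLGenerators.sad_one, smul_zero,
    map_zero]

/-- If `gr(K)` contains all supersymmetric tensors, then `K` has finite codimension. -/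
theorem grTwo_ne_symSq {K : TwoSidedIdeal (U m n)} (hK : InfiniteCodim K) :
    grTwo K ≠ symSq m n := by
  intro h
  refine not_infiniteCodim (K := K) (filt m n 1)
    (Submodule.mem_sup_right (mem_filt_one.2 ⟨1, 0, by simp⟩)) (fun i j v hv => ?_) hK
  obtain ⟨c, X, rfl⟩ := mem_filt_one.1 hv
  rw [mul_add]
  refine add_mem (Submodule.mem_sup_right (mem_filt_one.2 ⟨0, c • slUnit i j, ?_⟩)) ?_
  · rw [← Algebra.commutes, ← Algebra.smul_def, map_smul, map_zero, zero_add]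
  · have h1 : slUnit i j ⊗ₜ X + superSwap m n (slUnit i j ⊗ₜ X) ∈ grTwo K := by
      rw [h, mem_symSq, map_add, superSwap_superSwap, add_comm]
    have h2 : mulU m n (slUnit i j ⊗ₜ X + superSwap m n (slUnit i j ⊗ₜ X)) ∈
      idealSubmodule K ⊔ filt m n 1 := h1.2
    rw [map_add, mulU_superSwap, mulU_tmul, bracketTensor_tmul] at h2
    have h3 : uι (bracket (slUnit i j) X) ∈ idealSubmodule K ⊔ filt m n 1 :=
      Submodule.mem_sup_right (mem_filt_one.2 ⟨0, _, by rw [map_zero, zero_add]⟩)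
    have h4 := Submodule.smul_mem _ (2 : ℂ)⁻¹ (add_mem h2 h3)
    convert h4 using 1
    module

end
end SLSuper

namespace SLSuper

/-! ### Invariant functionals on the second tensor power -/

variable {m n : ℕ}

/-- The Killing form as a functional on `𝔤 ⊗ 𝔤`. -/
def killingTensor (m n : ℕ) : sl m n ⊗[ℂ] sl m n →ₗ[ℂ] ℂ :=
  (2 * ((m : ℂ) - n)) • str m n ∘ₗ
    TensorProduct.lift ((LinearMap.mul ℂ (Mat m n)).compl₁₂ (sl m n).subtype (sl m n).subtype)

theorem killingTensor_tmul (X Y : sl m n) : killingTensor m n (X ⊗ₜ Y) = killing X Y := rfl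


/-- The product in `U(𝔤)` of the supersymmetric part of a tensor. -/
def mulSym (m n : ℕ) : sl m n ⊗[ℂ] sl m n →ₗ[ℂ] U m n :=
  mulU m n - (1 / 2 : ℂ) • uι ∘ₗ bracketTensor m n

theorem mulSym_apply (t : sl m n ⊗[ℂ] sl m n) :
    mulSym m n t = mulU m n t - (1 / 2 : ℂ) • uι (bracketTensor m n t) := rfl

section

variable [hmn : Fact (n < m)]

theorem killingTensor_slUnit (i j k l : Idx m n) : killingTensor m n (slUnit i j ⊗ₜ slUnit k l) =
    2 * ((m : ℂ) - n) * ((if j = k then 1 else 0) * (if i = l then 1 else 0) * sgn (par i) -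
      (if i = j then 1 else 0) * (if k = l then 1 else 0) * (sgn (par i) * sgn (par k)) *
        ((m : ℂ) - n)⁻¹) := by
  have hd := sub_ne_zero_of_fact (m := m) (n := n)
  have h1 : str m n (Matrix.single i j (1 : ℂ) * Matrix.single k l 1) =
      (if j = k then 1 else 0) * (if i = l then 1 else 0) * sgn (par i) := by
    by_cases h : j = k
    · subst h
      rw [Matrix.single_mul_single_same, mul_one, str_single]
      simp
    · rw [Matrix.single_mul_single_of_ne _ _ _ _ h, map_zero, if_neg h, zero_mul, zero_mul]
  rw [killingTensor_tmul, killing, coe_slUnit, coe_slUnit]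
  congr 1
  simp only [sub_mul, mul_sub, smul_mul_assoc, mul_smul_comm, mul_one, one_mul, map_sub, map_smul,
    h1, str_single, str_one, smul_eq_mul]
  by_cases h : i = j <;> by_cases h' : k = l <;> simp [h, h', -mul_eq_mul_left_iff]
  field_simp
  ring

/-- The invariant functionals on `𝔤 ⊗ 𝔤` are the multiples of the Killing form. -/
theorem exists_eq_smul_killingTensor (h3 : ∀ i j : Idx m n, ∃ r, r ≠ i ∧ r ≠ j)
    (ψ : sl m n ⊗[ℂ] sl m n →ₗ[ℂ] ℂ) (hψ : ∀ p q t, ψ (act (slUnit p q) t) = 0) :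
    ∃ c : ℂ, ψ = c • killingTensor m n := by
  have hd := sub_ne_zero_of_fact (m := m) (n := n)
  obtain ⟨b, hb⟩ : ∃ b : Idx m n → Idx m n → Idx m n → Idx m n → ℂ,
      ∀ i j k l, ψ (slUnit i j ⊗ₜ slUnit k l) = b i j k l := ⟨_, fun _ _ _ _ => rfl⟩
  have hite : ∀ (c : Prop) [Decidable c] (i j k l : Idx m n),
      ψ (if c then slUnit i j ⊗ₜ slUnit k l else 0) = if c then b i j k l else 0 := by
    intro c _ i j k l
    split_ifs
    · exact hb i j k l
    · exact map_zero ψ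
  have inv : ∀ p q i j k l : Idx m n, (if q = i then b p j k l else 0) -
      sgn ((par p + par q) * (par i + par j)) * (if p = j then b i q k l else 0) +
      sgn ((par p + par q) * (par i + par j)) * ((if q = k then b i j p l else 0) -
        sgn ((par p + par q) * (par k + par l)) * (if p = l then b i j k q else 0)) = 0 := by
    intro p q i j k l
    have := hψ p q (slUnit i j ⊗ₜ slUnit k l)
    rw [act_slUnit] at this
    simpa only [map_add, map_sub, map_smul, hite, smul_eq_mul] using this
  -- The weights confine `ψ` to the tensors of weight zero.
  have zero : ∀ i j k l : Idx m n, ¬ (i = j ∧ k = l) → ¬ (j = k ∧ i = l) → b i j k l = 0 := by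
    intro i j k l h1 h2
    by_contra h0
    have key : ∀ h : Idx m n → ℂ, h i - h j + h k - h l = 0 := by
      intro h
      have h4 := act_project_diagonal h i j k l
      have h5 : ψ (act (project m n (Matrix.diagonal h)) (slUnit i j ⊗ₜ slUnit k l)) = 0 := by
        rw [act_eq_sum]
        simp only [map_sum, map_smul, hψ, smul_zero, Finset.sum_const_zero]
      rw [h4, map_smul, hb, smul_eq_mul] at h5
      exact (mul_eq_zero.1 h5).resolve_right h0
    by_cases hij : i = j
    · have hkl : k ≠ l := fun e => h1 ⟨hij, e⟩
      have := key (fun r => if r = k then 1 else 0)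
      simp [hij, hkl.symm] at this
    · have h4 := key (fun r => if r = i then 1 else 0)
      by_cases hil : i = l
      · have hjk : j ≠ k := fun e => h2 ⟨e, hil⟩
        have h5 := key (fun r => if r = j then 1 else 0)
        simp [hij, ← hil, hjk.symm] at h5
      · by_cases hik : k = i
        · simp [Ne.symm hij, Ne.symm hil, hik] at h4
        · simp [Ne.symm hij, Ne.symm hil, hik] at h4
  -- The value on `slUnit i j ⊗ slUnit j i` does not depend on `i ≠ j` up to sign.
  have left : ∀ {i j p : Idx m n}, i ≠ j → p ≠ j →
      sgn (par i) * b i j j i = sgn (par p) * b p j j p := by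
    intro i j p hij hpj
    by_cases hip : i = p
    · rw [hip]
    have h := inv p i i j j p
    have hs : sgn ((par p + par i) * (par i + par j)) * sgn ((par p + par i) * (par j + par p)) =
        sgn (par p) * sgn (par i) := by
      generalize par p = x
      generalize par i = y
      generalize par j = z
      rw [← sgn_add, ← sgn_add]
      congr 1
      revert x y z; decide
    rw [if_pos rfl, if_neg hpj, if_neg hij, if_pos rfl] at h
    have h1 := sgn_mul_sgn (par p)
    linear_combination -sgn (par i) * h1 * b i j j i - sgn (par p) * h -
      sgn (par p) * b i j j i * hs
  have right : ∀ {i j p : Idx m n}, i ≠ j → i ≠ p → b i j j i = b i p p i := by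
    intro i j p hij hip
    by_cases hjp : j = p
    · rw [hjp]
    have h := inv j p i j p i
    rw [if_neg (Ne.symm hip), if_pos rfl, if_pos rfl, if_neg (Ne.symm hij)] at h
    have h1 := sgn_mul_sgn ((par j + par p) * (par i + par j))
    linear_combination sgn ((par j + par p) * (par i + par j)) * h - h1 * (b i j j i - b i p p i)
  obtain ⟨c, hc⟩ : ∃ c : ℂ, ∀ i j : Idx m n, i ≠ j → b i j j i = sgn (par i) * c := by
    have i₀ : Idx m n := Sum.inl ⟨0, (Nat.zero_le n).trans_lt hmn.out⟩
    obtain ⟨j₀, hj₀, -⟩ := h3 i₀ i₀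
    refine ⟨sgn (par i₀) * b i₀ j₀ j₀ i₀, fun i j hij => ?_⟩
    obtain ⟨r, hr, hr'⟩ := h3 j j₀
    rw [left hj₀.symm hr', right hr' hr, ← left hij hr, ← mul_assoc, sgn_mul_sgn, one_mul]
  have diag : ∀ i j k : Idx m n, sgn (par i) * b i i k k - (if i = k then c else 0) =
      sgn (par j) * b j j k k - if j = k then c else 0 := by
    intro i j k
    by_cases hij : i = j
    · rw [hij]
    have h := inv i j j i k k
    rw [if_pos rfl, if_pos rfl, zmod2_add_self, mul_zero, sgn_zero, one_mul, add_comm (par j),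
      zmod2_mul_self, sgn_add] at h
    have e1 : (if j = k then b j i i k else 0) = sgn (par j) * if j = k then c else 0 := by
      split_ifs with e
      · rw [← e, hc j i (Ne.symm hij)]
      · rw [mul_zero]
    have e2 : (if i = k then b j i k j else 0) = sgn (par j) * if i = k then c else 0 := by
      split_ifs with e
      · rw [← e, hc j i (Ne.symm hij)]
      · rw [mul_zero]
    rw [e1, e2] at h
    have h1 := sgn_mul_sgn (par i)
    have h2 := sgn_mul_sgn (par j)
    generalize (if i = k then c else 0) = x at *
    generalize (if j = k then c else 0) = y at *
    linear_combination sgn (par i) * h + h1 * (sgn (par j) * b j j k k) -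
      sgn (par i) * sgn (par i) * h2 * (y - x) - h1 * (y - x)
  have diag' : ∀ i k : Idx m n, b i i k k =
      sgn (par i) * ((if i = k then c else 0) - c * sgn (par k) * ((m : ℂ) - n)⁻¹) := by
    intro i k
    have h1 : ∀ j, b j j k k = sgn (par j) *
        (sgn (par i) * b i i k k - (if i = k then c else 0)) +
          if j = k then sgn (par k) * c else 0 := by
      intro j
      rw [diag i j k, mul_sub, ← mul_assoc, sgn_mul_sgn, one_mul]
      split_ifs with e
      · rw [e]; ring
      · ring
    have h2 : ∑ j, b j j k k = 0 := by
      have : ∑ j, ψ (slUnit j j ⊗ₜ slUnit k k) = 0 := by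
        rw [← map_sum, ← TensorProduct.sum_tmul, sum_slUnit, TensorProduct.zero_tmul, map_zero]
      simpa only [hb] using this
    rw [Finset.sum_congr rfl fun j _ => h1 j, Finset.sum_add_distrib, ← Finset.sum_mul,
      sum_sgn_par, Finset.sum_ite_eq', if_pos (Finset.mem_univ k)] at h2
    have h4 := sgn_mul_sgn (par i)
    have h5 : sgn (par i) * b i i k k =
        (if i = k then c else 0) - c * sgn (par k) * ((m : ℂ) - n)⁻¹ := by
      field_simp
      linear_combination h2
    rw [← h5, ← mul_assoc, h4, one_mul]
  refine ⟨c * (2 * ((m : ℂ) - n))⁻¹, tensor_ext fun i j k l => ?_⟩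
  rw [hb, LinearMap.smul_apply, killingTensor_slUnit, smul_eq_mul, ← mul_assoc,
    inv_mul_cancel_right₀ (mul_ne_zero two_ne_zero hd)]
  by_cases h1 : i = j ∧ k = l
  · obtain ⟨rfl, rfl⟩ := h1
    rw [diag']
    by_cases h : i = k <;> simp [h] <;> ring
  · by_cases h2 : j = k ∧ i = l
    · obtain ⟨rfl, rfl⟩ := h2
      have hij : i ≠ j := fun e => h1 ⟨e, e.symm⟩
      rw [hc i j hij]
      simp [hij]
      ring
    · rw [zero i j k l h1 h2]
      have e1 : (if j = k then (1 : ℂ) else 0) * (if i = l then 1 else 0) = 0 := by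
        by_contra! h0
        simp only [ne_eq, mul_eq_zero, ite_eq_right_iff, one_ne_zero, imp_false, not_or,
          not_not] at h0
        exact h2 h0
      have e2 : (if i = j then (1 : ℂ) else 0) * (if k = l then 1 else 0) = 0 := by
        by_contra! h0
        simp only [ne_eq, mul_eq_zero, ite_eq_right_iff, one_ne_zero, imp_false, not_or,
          not_not] at h0
        exact h1 h0
      rw [e1, e2]
      ring

/-! ### The quadratic part of an ideal stable under the antiautomorphism -/

theorem tau_mulU (t : sl m n ⊗[ℂ] sl m n) :
    tau m n (mulU m n t) = mulU m n (superSwap m n t) := by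
  have key : tau m n ∘ₗ mulU m n = mulU m n ∘ₗ superSwap m n := by
    refine tensor_ext fun i j k l => ?_
    rw [LinearMap.comp_apply, LinearMap.comp_apply, mulU_tmul,
      tau_mul (parityAut_of_isHomog (isHomog_slUnit i j))
        (parityAut_of_isHomog (isHomog_slUnit k l)),
      tau_ι, tau_ι, neg_mul_neg, superSwap_slUnit, map_smul, mulU_tmul]
  exact LinearMap.congr_fun key t

/-- An element of `gr(K)` of degree two lifts to an element of `K` without linear term, since the
antiautomorphism reverses the sign of the linear term. -/
theorem exists_mulU_sub_mem (h3 : ∀ i j : Idx m n, ∃ r, r ≠ i ∧ r ≠ j)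
    {K : TwoSidedIdeal (U m n)} (hK : InfiniteCodim K) (hτ : ∀ u ∈ K, tau m n u ∈ K)
    {t : sl m n ⊗[ℂ] sl m n} (ht : t ∈ grTwo K) :
    ∃ c : ℂ, mulU m n t - algebraMap ℂ (U m n) c ∈ idealSubmodule K := by
  obtain ⟨x, hx, y, hy, hxy⟩ := Submodule.mem_sup.1 (Submodule.mem_comap.1 ht.2)
  obtain ⟨c, X, rfl⟩ := mem_filt_one.1 hy
  change _ = mulU m n t at hxy
  have hx' : tau m n x = x + (2 : ℂ) • uι X := by
    have h1 := congrArg (tau m n) hxy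
    rw [tau_mulU, mem_symSq.1 ht.1, ← hxy, map_add, map_add, tau_ι,
      Algebra.algebraMap_eq_smul_one, map_smul, tau_one] at h1
    rw [two_smul]
    linear_combination (norm := abel) h1
  have h2 : uι X ∈ K := by
    have h4 := Submodule.sub_mem _ (mem_idealSubmodule.2 (hτ x (mem_idealSubmodule.1 hx))) hx
    rw [hx', add_sub_cancel_left] at h4
    exact mem_idealSubmodule.1 ((Submodule.smul_mem_iff _ two_ne_zero).1 h4)
  refine ⟨c, ?_⟩
  rw [← hxy, eq_zero_of_uι_mem h3 hK h2, map_zero, add_zero, add_sub_cancel_right]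
  exact hx

theorem mulSym_eq (t : sl m n ⊗[ℂ] sl m n) :
    mulSym m n t = (1 / 2 : ℂ) • mulU m n (t + superSwap m n t) := by
  rw [mulSym_apply, map_add, mulU_superSwap]
  module

theorem sad_mulSym (p q : Idx m n) (t : sl m n ⊗[ℂ] sl m n) :
    (envelopingGenerators m n).sad (par p + par q) (uι (slUnit p q)) (mulSym m n t) =
      mulSym m n (act (slUnit p q) t) := by
  rw [mulSym_eq, map_smul, sad_mulU, mulSym_eq, superSwap_act, map_add]

theorem exists_mulSym_sub_mem (h3 : ∀ i j : Idx m n, ∃ r, r ≠ i ∧ r ≠ j)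
    {K : TwoSidedIdeal (U m n)} (hK : InfiniteCodim K) (hτ : ∀ u ∈ K, tau m n u ∈ K)
    {t : sl m n ⊗[ℂ] sl m n} (ht : t ∈ grTwo K ⊔ altSq m n) :
    ∃ c : ℂ, mulSym m n t - algebraMap ℂ (U m n) c ∈ idealSubmodule K := by
  obtain ⟨g, hg, a, ha, rfl⟩ := Submodule.mem_sup.1 ht
  obtain ⟨c, hc⟩ := exists_mulU_sub_mem h3 hK hτ hg
  refine ⟨c, ?_⟩
  rw [mulSym_eq, map_add (superSwap m n), mem_symSq.1 hg.1, mem_altSq.1 ha,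
    show g + a + (g + -a) = (2 : ℂ) • g by module, map_smul, smul_smul]
  simpa using hc

/-- Modulo `K`, the elements of the complement of the Cartan product become multiples of the
Killing form, with one factor for all of them. -/
theorem exists_mulSym_sub_killingTensor_mem (h3 : ∀ i j : Idx m n, ∃ r, r ≠ i ∧ r ≠ j)
    {K : TwoSidedIdeal (U m n)} (hK : InfiniteCodim K) (hτ : ∀ u ∈ K, tau m n u ∈ K)
    {C : Submodule ℂ (sl m n ⊗[ℂ] sl m n)}
    (h : IsCartanDecomposition C (grTwo K ⊔ altSq m n)) :
    ∃ c : ℂ, (∀ t ∈ C, c * killingTensor m n t = 0) ∧ ∀ t ∈ grTwo K ⊔ altSq m n,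
      mulSym m n t - algebraMap ℂ (U m n) (c * killingTensor m n t) ∈ idealSubmodule K := by
  have h1 : (idealSubmodule K).mkQ 1 ≠ 0 := by
    rw [Submodule.mkQ_apply, Ne, Submodule.Quotient.mk_eq_zero]
    exact fun h => one_notMem hK (mem_idealSubmodule.1 h)
  obtain ⟨f, hf⟩ := Module.Projective.exists_dual_ne_zero ℂ h1
  -- The functional `ℓ` reads off the scalar; composed with the projection to the complement, it
  -- becomes an invariant functional on all of `𝔤 ⊗ 𝔤`.
  set ℓ : U m n →ₗ[ℂ] ℂ := (f ((idealSubmodule K).mkQ 1))⁻¹ • f ∘ₗ (idealSubmodule K).mkQ with hℓ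
  have hℓ1 : ℓ 1 = 1 := by
    rw [hℓ, LinearMap.smul_apply, LinearMap.comp_apply, smul_eq_mul, inv_mul_cancel₀ hf]
  have hℓK : ∀ u ∈ idealSubmodule K, ℓ u = 0 := by
    intro u hu
    rw [hℓ, LinearMap.smul_apply, LinearMap.comp_apply, Submodule.mkQ_apply _ u,
      (Submodule.Quotient.mk_eq_zero _).2 hu, map_zero, smul_zero]
  have hmem : ∀ t ∈ grTwo K ⊔ altSq m n,
      mulSym m n t - algebraMap ℂ (U m n) (ℓ (mulSym m n t)) ∈ idealSubmodule K := by
    intro t ht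
    obtain ⟨c, hc⟩ := exists_mulSym_sub_mem h3 hK hτ ht
    have h2 := hℓK _ hc
    rw [map_sub, Algebra.algebraMap_eq_smul_one, map_smul, hℓ1, smul_eq_mul, mul_one,
      sub_eq_zero] at h2
    rwa [h2]
  set P := C.projection _ h.isCompl with hP
  obtain ⟨c, hc⟩ := exists_eq_smul_killingTensor h3 (ℓ ∘ₗ mulSym m n ∘ₗ (LinearMap.id - P))
    fun p q t => by
      have h2 : t - P t ∈ grTwo K ⊔ altSq m n := sub_projection_mem h.isCompl t
      rw [LinearMap.comp_apply, LinearMap.comp_apply, LinearMap.sub_apply, LinearMap.id_apply,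
        projection_act h.stable_left h.stable_right h.isCompl, ← map_sub, ← sad_mulSym]
      apply hℓK
      have h4 := sad_mem_idealSubmodule (par p + par q) (uι (slUnit p q)) (hmem _ h2)
      rwa [map_sub, Algebra.algebraMap_eq_smul_one, map_smul, GLGenerators.sad_one, smul_zero,
        sub_zero] at h4
  have hc' : ∀ t, c * killingTensor m n t = ℓ (mulSym m n (t - P t)) := fun t =>
    (LinearMap.congr_fun hc t).symm
  refine ⟨c, fun t ht => ?_, fun t ht => ?_⟩
  · rw [hc', Submodule.projection_apply_of_mem_left _ ht, sub_self, map_zero, map_zero]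
  · rw [hc', (Submodule.projection_apply_eq_zero_iff _).2 ht, sub_zero]
    exact hmem t ht

theorem bracketTensor_eq_zero (h3 : ∀ i j : Idx m n, ∃ r, r ≠ i ∧ r ≠ j)
    {K : TwoSidedIdeal (U m n)} (hK : InfiniteCodim K) {t : sl m n ⊗[ℂ] sl m n}
    (ht : t ∈ symSq m n) : bracketTensor m n t = 0 := by
  refine eq_zero_of_uι_mem h3 hK ?_
  have h := mulU_superSwap t
  rw [mem_symSq.1 ht, eq_comm, sub_eq_self] at h
  rw [h]
  exact K.zero_mem

end
end SLSuper

namespace SLSuper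

/-! ### Quotients of the enveloping algebra in which the quadratic minors are scalars -/

variable {m n : ℕ}

theorem minorSign_of_eq_left {i j : Idx m n} (h : i = j) (k : Idx m n) :
    minorSign i j k = sgn (par i) := by
  subst h
  rw [minorSign]
  congr 1
  generalize par i = x
  generalize par k = y
  revert x y; decide

theorem minorSign_of_eq_right (i : Idx m n) {j k : Idx m n} (h : j = k) :
    minorSign i j k = sgn (par k) := by
  subst h
  rw [minorSign]
  congr 1
  generalize par i = x
  generalize par j = y
  revert x y; decide

section

variable [hmn : Fact (n < m)]

theorem bracketTensor_minorTensor (i j k l : Idx m n) :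
    bracketTensor m n (minorTensor i j k l) =
      (if j = k then (1 : ℂ) else 0) • slUnit i l -
        (sgn ((par i + par j) * (par k + par l)) * if i = l then 1 else 0) • slUnit k j -
      (minorSign i j k * if i = j then 1 else 0) • slUnit k l +
        (minorSign i j k * sgn ((par k + par j) * (par i + par l)) * if k = l then 1 else 0) •
          slUnit i j := by
  rw [minorTensor, map_sub, map_smul, bracketTensor_tmul, bracketTensor_tmul, bracket_slUnit,
    bracket_slUnit]
  simp only [ite_smul, one_smul, zero_smul, smul_sub, mul_ite, mul_one, mul_zero, smul_ite,
    smul_zero, smul_smul, eq_comm (a := j) (b := i)]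
  abel

theorem killingTensor_minorTensor (i j k l : Idx m n) :
    killingTensor m n (minorTensor i j k l) = 2 * ((m : ℂ) - n + 1) *
      ((if j = k then 1 else 0) * (if i = l then 1 else 0) * sgn (par i) -
        (if i = j then 1 else 0) * (if k = l then 1 else 0) * (sgn (par i) * sgn (par k))) := by
  have hd := sub_ne_zero_of_fact (m := m) (n := n)
  rw [minorTensor, map_sub, map_smul, killingTensor_slUnit, killingTensor_slUnit, smul_eq_mul]
  simp only [eq_comm (a := j) (b := i), eq_comm (a := k) (b := j)]
  have h1 : (if i = j then (1 : ℂ) else 0) * minorSign i j k =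
      (if i = j then 1 else 0) * sgn (par i) := by
    split_ifs with h
    · rw [minorSign_of_eq_left h]
    · simp
  have h2 : (if j = k then (1 : ℂ) else 0) * minorSign i j k =
      (if j = k then 1 else 0) * sgn (par k) := by
    split_ifs with h
    · rw [minorSign_of_eq_right i h]
    · simp
  have h3 := sgn_mul_sgn (par k)
  generalize (if i = j then (1 : ℂ) else 0) = a at *
  generalize (if j = k then (1 : ℂ) else 0) = b at *
  generalize (if i = l then (1 : ℂ) else 0) = e at *
  generalize (if k = l then (1 : ℂ) else 0) = f at *
  field_simp
  linear_combination -((m : ℂ) - n) * f * sgn (par k) * h1 + e * sgn (par k) * sgn (par i) * h2 +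
    b * e * sgn (par i) * h3

/-- The images of the matrix units in a quotient of `U(𝔤)`, shifted by scalars so that the
relations for the quadratic minors become homogeneous. -/
def shiftedGenerators (J : TwoSidedIdeal (U m n)) :
    GLGenerators m n (U m n ⧸ TwoSidedIdeal.asIdeal J) where
  F i j := Ideal.Quotient.mkₐ ℂ (TwoSidedIdeal.asIdeal J) (uι (slUnit i j)) -
    algebraMap ℂ _ (1 / 2 * ((if i = j then 1 else 0) * sgn (par i)))
  π := Ideal.Quotient.liftₐ (TwoSidedIdeal.asIdeal J)
    ((Ideal.Quotient.mkₐ ℂ (TwoSidedIdeal.asIdeal J)).comp (parityAut m n)) fun a ha =>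
      Ideal.Quotient.eq_zero_iff_mem.2
        ((envelopingGenerators m n).π_mem (TwoSidedIdeal.asIdeal J) ha)
  π_F i j := by
    rw [map_sub, AlgHom.commutes, smul_sub]
    congr 1
    · change Ideal.Quotient.mkₐ ℂ (TwoSidedIdeal.asIdeal J) (parityAut m n (uι (slUnit i j))) = _
      rw [parityAut_of_isHomog (isHomog_slUnit i j), map_smul]
    · split_ifs with h
      · rw [h, zmod2_add_self, sgn_zero, one_smul]
      · simp
  comm i j k l := by
    set q := Ideal.Quotient.mkₐ ℂ (TwoSidedIdeal.asIdeal J)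
    have h := congrArg q ((envelopingGenerators m n).comm i j k l)
    simp only [map_sub, map_smul, map_mul, apply_ite q, map_zero, envelopingGenerators_F] at h
    have h1 : sgn ((par i + par j) * (par k + par l)) * ((if i = j then 1 else 0) * sgn (par i)) =
        (if i = j then 1 else 0) * sgn (par i) := by
      split_ifs with e
      · rw [e, zmod2_add_self, zero_mul, sgn_zero]; ring
      · ring
    have h2 : sgn ((par i + par j) * (par k + par l)) * ((if k = l then 1 else 0) * sgn (par k)) =
        (if k = l then 1 else 0) * sgn (par k) := by
      split_ifs with e
      · rw [e, zmod2_add_self, mul_zero, sgn_zero]; ring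
      · ring
    have h3 : (if j = k then (1 : ℂ) else 0) * ((if i = l then 1 else 0) * sgn (par i)) =
        sgn ((par i + par j) * (par k + par l)) *
          ((if i = l then 1 else 0) * ((if k = j then 1 else 0) * sgn (par k))) := by
      by_cases e : j = k
      · subst e
        by_cases e' : i = l
        · subst e'
          have e'' : sgn ((par i + par j) * (par j + par i)) = sgn (par i) * sgn (par j) := by
            rw [add_comm (par j), zmod2_mul_self, sgn_add]
          have e3 := sgn_mul_sgn (par j)
          simp only [if_true]
          rw [e'']
          linear_combination -sgn (par i) * e3
        · simp [e']
      · simp [e, Ne.symm e]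
    have hite : ∀ (c : Prop) [Decidable c] (x : U m n ⧸ TwoSidedIdeal.asIdeal J),
        (if c then x else 0) = (if c then (1 : ℂ) else 0) • x := by
      intro c _ x
      split_ifs <;> simp
    rw [hite, hite (i = l)] at h
    rw [hite, hite (i = l)]
    simp only [Algebra.algebraMap_eq_smul_one, sub_mul, mul_sub, smul_mul_assoc, mul_smul_comm,
      mul_one, one_mul]
    generalize (if i = j then (1 : ℂ) else 0) * sgn (par i) = a at *
    generalize (if k = l then (1 : ℂ) else 0) * sgn (par k) = b at *
    linear_combination (norm := module) h +
      (1 / 2 : ℂ) • congrArg (· • q (uι (slUnit k l))) h1 +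
      (1 / 2 : ℂ) • congrArg (· • q (uι (slUnit i j))) h2 -
      (b / 4) • congrArg (· • (1 : U m n ⧸ TwoSidedIdeal.asIdeal J)) h1 +
      (1 / 2 : ℂ) • congrArg (· • (1 : U m n ⧸ TwoSidedIdeal.asIdeal J)) h3
  gen := by
    set q := Ideal.Quotient.mkₐ ℂ (TwoSidedIdeal.asIdeal J) with hq
    rw [eq_top_iff]
    rintro u -
    obtain ⟨u, rfl⟩ := Ideal.Quotient.mkₐ_surjective ℂ _ u
    rw [← hq]
    refine (envelopingGenerators m n).induction (P := fun u => q u ∈ _) ?_ ?_ ?_ ?_ u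
    · intro c
      rw [AlgHom.commutes]
      exact Subalgebra.algebraMap_mem _ c
    · intro i j
      rw [envelopingGenerators_F, ← sub_add_cancel (q (uι (slUnit i j)))
        (algebraMap ℂ _ (1 / 2 * ((if i = j then 1 else 0) * sgn (par i))))]
      exact add_mem (Algebra.subset_adjoin (Set.mem_range_self (i, j)))
        (Subalgebra.algebraMap_mem _ _)
    · intro x y hx hy
      rw [map_add]
      exact add_mem hx hy
    · intro x y hx hy
      rw [map_mul]
      exact mul_mem hx hy

theorem shiftedGenerators_F (J : TwoSidedIdeal (U m n)) (i j : Idx m n) :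
    (shiftedGenerators J).F i j =
      Ideal.Quotient.mkₐ ℂ (TwoSidedIdeal.asIdeal J) (uι (slUnit i j)) -
        (1 / 2 * ((if i = j then 1 else 0) * sgn (par i)) : ℂ) • 1 := by
  rw [← Algebra.algebraMap_eq_smul_one]
  rfl

/-- The relation between the shifted generators that results if the quadratic minors are
multiples of the Killing form. -/
theorem shiftedGenerators_minor (J : TwoSidedIdeal (U m n)) {c : ℂ}
    (hJ : ∀ i j k l : Idx m n, mulSym m n (minorTensor i j k l) -
      algebraMap ℂ (U m n) (c * killingTensor m n (minorTensor i j k l)) ∈ J)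
    (i j k l : Idx m n) :
    (shiftedGenerators J).F i j * (shiftedGenerators J).F k l -
        (if j = k then (shiftedGenerators J).F i l else 0) =
      minorSign i j k • ((shiftedGenerators J).F k j * (shiftedGenerators J).F i l -
        if i = j then (shiftedGenerators J).F k l else 0) +
      ((2 * ((m : ℂ) - n + 1) * c + 1 / 4) *
        ((if j = k then 1 else 0) * (if i = l then 1 else 0) * sgn (par i) -
          (if i = j then 1 else 0) * (if k = l then 1 else 0) * (sgn (par i) * sgn (par k)))) •
        (1 : U m n ⧸ TwoSidedIdeal.asIdeal J) := by
  set q := Ideal.Quotient.mkₐ ℂ (TwoSidedIdeal.asIdeal J) with hq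
  have h : q (mulSym m n (minorTensor i j k l) -
      algebraMap ℂ (U m n) (c * killingTensor m n (minorTensor i j k l))) = 0 :=
    Ideal.Quotient.eq_zero_iff_mem.2 (TwoSidedIdeal.mem_asIdeal.2 (hJ i j k l))
  have hite : ∀ (c : Prop) [Decidable c] (x : U m n ⧸ TwoSidedIdeal.asIdeal J),
      (if c then x else 0) = (if c then (1 : ℂ) else 0) • x := by
    intro c _ x
    split_ifs <;> simp
  have h1 : (if i = j then (1 : ℂ) else 0) * minorSign i j k =
      (if i = j then 1 else 0) * sgn (par i) := by
    split_ifs with h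
    · rw [minorSign_of_eq_left h]
    · simp
  have h2 : (if j = k then (1 : ℂ) else 0) * minorSign i j k =
      (if j = k then 1 else 0) * sgn (par k) := by
    split_ifs with h
    · rw [minorSign_of_eq_right i h]
    · simp
  have h3 : (if i = l then (1 : ℂ) else 0) * (sgn (par i) * minorSign i j k) =
      (if i = l then 1 else 0) * sgn ((par i + par j) * (par k + par l)) := by
    split_ifs with h
    · subst h
      rw [minorSign, ← sgn_add]
      congr 2
      generalize par i = x
      generalize par j = y
      generalize par k = z
      revert x y z; decide
    · simp
  have h4 : (if k = l then (1 : ℂ) else 0) * (minorSign i j k *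
      sgn ((par k + par j) * (par i + par l))) = (if k = l then 1 else 0) * sgn (par k) := by
    split_ifs with h
    · subst h
      rw [minorSign, ← sgn_add]
      congr 2
      generalize par i = x
      generalize par j = y
      generalize par k = z
      revert x y z; decide
    · simp
  have h5 := sgn_mul_sgn (par k)
  rw [mulSym_apply, bracketTensor_minorTensor, killingTensor_minorTensor, minorTensor,
    Algebra.algebraMap_eq_smul_one] at h
  simp only [map_sub, map_add, map_smul, map_mul, map_one, mulU_tmul] at h
  simp only [shiftedGenerators_F, ← hq]
  rw [hite, hite (i = j)]
  simp only [eq_comm (a := k) (b := j), sub_mul, mul_sub, smul_mul_assoc, mul_smul_comm, mul_one,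
    one_mul]
  generalize (if i = j then (1 : ℂ) else 0) = α at *
  generalize (if j = k then (1 : ℂ) else 0) = β at *
  generalize (if i = l then (1 : ℂ) else 0) = γ at *
  generalize (if k = l then (1 : ℂ) else 0) = δ at *
  generalize minorSign i j k = s at *
  generalize sgn (par i) = x at *
  generalize sgn (par k) = y at *
  generalize sgn ((par i + par j) * (par k + par l)) = z at *
  generalize sgn ((par k + par j) * (par i + par l)) = w at *
  generalize q (uι (slUnit i j)) = a at *
  generalize q (uι (slUnit k l)) = b at *
  generalize q (uι (slUnit k j)) = a' at *
  generalize q (uι (slUnit i l)) = b' at *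
  -- The identities between signs, as multiples of the elements whose coefficients they adjust.
  have r1 := congrArg (· • b) h1
  have r2 := congrArg (· • b') (show β * s * y = β by rw [h2, mul_assoc, h5, mul_one])
  have r3 := congrArg (· • a') h3
  have r4 := congrArg (· • a) h4
  have r5 := congrArg (· • (1 : U m n ⧸ TwoSidedIdeal.asIdeal J))
    (show β * γ * x * (s * y) = β * γ * x by
      linear_combination γ * x * y * h2 + β * γ * x * h5)
  have r6 := congrArg (· • (1 : U m n ⧸ TwoSidedIdeal.asIdeal J))
    (show α * δ * (s * y) = α * δ * (x * y) by linear_combination δ * y * h1)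
  beta_reduce at r1 r2 r3 r4 r5 r6
  linear_combination (norm := module) h + (1 / 2 : ℂ) • r1 + (1 / 2 : ℂ) • r2 +
    (1 / 2 : ℂ) • r3 + (1 / 2 : ℂ) • r4 + (-1 / 4 : ℂ) • r5 + (-1 / 2 : ℂ) • r6

/-- The generators of the quotient of `U(𝔤)` in which the quadratic minors are the multiples of the
Killing form given by the critical parameter. -/
def minorGenerators (J : TwoSidedIdeal (U m n))
    (hJ : ∀ i j k l : Idx m n, mulSym m n (minorTensor i j k l) -
      algebraMap ℂ (U m n) (criticalParam m n * killingTensor m n (minorTensor i j k l)) ∈ J) :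
    MinorGenerators m n (U m n ⧸ TwoSidedIdeal.asIdeal J) where
  toGLGenerators := shiftedGenerators J
  minor i j k l := by
    have hd : (m : ℂ) - n + 1 ≠ 0 := by
      have h : (m : ℂ) - n + 1 = ((m - n + 1 : ℕ) : ℂ) := by
        rw [Nat.cast_add, Nat.cast_sub hmn.out.le, Nat.cast_one]
      rw [h]
      exact Nat.cast_ne_zero.2 (Nat.succ_ne_zero _)
    have h := shiftedGenerators_minor J hJ i j k l
    have h0 : 2 * ((m : ℂ) - n + 1) * criticalParam m n + 1 / 4 = 0 := by
      rw [criticalParam]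
      field_simp
      norm_num
    rw [h0, zero_mul, zero_smul, add_zero] at h
    exact h
  trace := by
    have h1 : ∑ i : Idx m n, (1 / 2 * sgn (par i) : ℂ) = ((m : ℂ) - n) / 2 := by
      rw [← Finset.mul_sum, sum_sgn_par]
      ring
    simp only [shiftedGenerators_F, if_true, one_mul, Finset.sum_sub_distrib]
    rw [← map_sum, ← map_sum, sum_slUnit, map_zero, map_zero, ← Finset.sum_smul, h1,
      Algebra.algebraMap_eq_smul_one]
    module

/-- Only for the critical parameter are the relations for the quadratic minors consistent with
the injectivity of `𝔤 → U(𝔤) / K`: the two ways to reduce `F o r * F r t * F t o` differ by a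
multiple of `F r r - F t t`. -/
theorem eq_criticalParam (h3 : ∀ i j : Idx m n, ∃ r, r ≠ i ∧ r ≠ j) {o t r : Idx m n}
    (ho : par o = 0) (ht : par t = 0) (hr : par r = 0) (hot : o ≠ t) (hor : o ≠ r) (htr : t ≠ r)
    {K : TwoSidedIdeal (U m n)} (hK : InfiniteCodim K) {c : ℂ}
    (hc : ∀ i j k l : Idx m n, mulSym m n (minorTensor i j k l) -
      algebraMap ℂ (U m n) (c * killingTensor m n (minorTensor i j k l)) ∈ K) :
    c = criticalParam m n := by
  set D := shiftedGenerators K with hD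
  set e := 2 * ((m : ℂ) - n + 1) * c + 1 / 4 with he
  have hd : (m : ℂ) - n + 1 ≠ 0 := by
    have h : (m : ℂ) - n + 1 = ((m - n + 1 : ℕ) : ℂ) := by
      rw [Nat.cast_add, Nat.cast_sub hmn.out.le, Nat.cast_one]
    rw [h]
    exact Nat.cast_ne_zero.2 (Nat.succ_ne_zero _)
  have rel := shiftedGenerators_minor K hc
  rw [← hD, ← he] at rel
  have h1 : D.F o r * D.F r t = (D.F r r + 1) * D.F o t := by
    have := rel o r r t
    simp [minorSign, ho, hr, sgn_zero, hot, hor, htr.symm] at this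
    rw [add_mul, one_mul, ← this, sub_add_cancel]
  have h2 : D.F o t * D.F t o = (D.F t t + 1) * D.F o o + e • 1 := by
    have := rel o t t o
    simp [minorSign, ho, ht, sgn_zero, hot, hot.symm] at this
    rw [sub_eq_iff_eq_add] at this
    rw [this]
    noncomm_ring
  have h4 : D.F r t * D.F t o = (D.F t t + 1) * D.F r o := by
    have := rel r t t o
    simp [minorSign, ht, hr, sgn_zero, hot.symm, hor.symm, htr.symm] at this
    rw [add_mul, one_mul, ← this, sub_add_cancel]
  have h5 : D.F o r * D.F r o = (D.F r r + 1) * D.F o o + e • 1 := by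
    have := rel o r r o
    simp [minorSign, ho, hr, sgn_zero, hor, hor.symm] at this
    rw [sub_eq_iff_eq_add] at this
    rw [this]
    noncomm_ring
  have h6 : D.F o r * D.F t t = D.F t t * D.F o r := by
    have := D.comm_diag t o r
    simp [hot.symm, htr] at this
    exact (sub_eq_zero.1 this).symm
  have h7 : D.F r r * D.F t t = D.F t t * D.F r r := by
    have := D.comm_diag r t t
    simp [htr.symm] at this
    exact sub_eq_zero.1 this
  have h8 : (D.F r r + 1) * ((D.F t t + 1) * D.F o o + e • 1) =
      (D.F t t + 1) * ((D.F r r + 1) * D.F o o + e • 1) := by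
    rw [← h2, ← h5, ← mul_assoc, ← h1, mul_assoc, h4, ← mul_assoc, ← mul_assoc, mul_add, h6,
      mul_one, add_mul _ 1, one_mul]
  have h9 : e • (D.F r r - D.F t t) = 0 := by
    have h10 : (D.F r r + 1) * (D.F t t + 1) = (D.F t t + 1) * (D.F r r + 1) := by
      simp only [add_mul, mul_add, one_mul, mul_one, h7]
      abel
    rw [mul_add, mul_add, ← mul_assoc, ← mul_assoc, h10, add_left_cancel_iff, mul_smul_comm,
      mul_smul_comm, mul_one, mul_one] at h8
    rw [smul_sub, sub_eq_zero]
    simpa using h8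
  suffices h : e = 0 by
    rw [he] at h
    rw [criticalParam, eq_div_iff (mul_ne_zero (by norm_num) hd)]
    linear_combination 4 * h
  by_contra he0
  have h10 := (smul_eq_zero_iff_right he0).1 h9
  rw [hD, shiftedGenerators_F, shiftedGenerators_F, hr, ht, if_pos rfl, if_pos rfl,
    sub_sub_sub_cancel_right, ← map_sub, ← map_sub] at h10
  have h11 := eq_zero_of_uι_mem h3 hK
    (TwoSidedIdeal.mem_asIdeal.1 (Ideal.Quotient.eq_zero_iff_mem.1 h10))
  have h12 := coe_bracket_slUnit_self r (slUnit r t) r t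
  have h13 : bracket (slUnit r r - slUnit t t) (slUnit r t) = (2 : ℂ) • slUnit r t := by
    rw [map_sub, LinearMap.sub_apply, bracket_slUnit, bracket_slUnit]
    simp [htr, htr.symm, hr, ht, sgn_zero, two_smul]
  rw [h11, map_zero, LinearMap.zero_apply, eq_comm, smul_eq_zero_iff_right two_ne_zero] at h13
  exact slUnit_ne_zero htr.symm h13

end
end SLSuper

namespace SLSuper

/-! ### The Joseph ideal -/

variable {m n : ℕ}

/-- If the bracket and the form `c ⟨X, Y⟩` vanish on the Cartan product, then the quadratic ideal
with parameter `c` is contained in each ideal that contains the elements of the complement of the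
Cartan product, corrected by their linear and scalar parts. -/
theorem quadraticIdeal_le {C I : Submodule ℂ (sl m n ⊗[ℂ] sl m n)}
    (hC : cartanProduct m n = C) (hI : cartanComplement m n = I) {c : ℂ}
    {K : TwoSidedIdeal (U m n)} (hCb : ∀ t ∈ C, bracketTensor m n t = 0)
    (hCk : ∀ t ∈ C, c * killingTensor m n t = 0)
    (hIK : ∀ t ∈ I, mulSym m n t - algebraMap ℂ (U m n) (c * killingTensor m n t) ∈ K) :
    quadraticIdeal m n c ≤ K := by
  have h1 : tensorIdeal m n c ≤ TwoSidedIdeal.comap (toU m n) K := by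
    rw [tensorIdeal, TwoSidedIdeal.span_le]
    rintro _ ⟨X, Y, s, ⟨hs, hs'⟩, rfl⟩
    rw [hC] at hs
    rw [hI] at hs'
    rw [SetLike.mem_coe, TwoSidedIdeal.mem_comap]
    have h2 := hIK _ hs'
    rw [mulSym_apply, map_sub (bracketTensor m n), hCb s hs, map_sub (killingTensor m n), mul_sub,
      hCk s hs, sub_zero, sub_zero, bracketTensor_tmul, killingTensor_tmul] at h2
    rw [map_sub, map_sub, map_smul, AlgHom.commutes]
    exact h2
  rw [quadraticIdeal, TwoSidedIdeal.map, TwoSidedIdeal.span_le]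
  rintro _ ⟨t, ht, rfl⟩
  exact (TwoSidedIdeal.mem_comap (toU m n)).1 (h1 ht)

theorem mulSym_sub_mem_quadraticIdeal {C I : Submodule ℂ (sl m n ⊗[ℂ] sl m n)}
    (h : IsCompl C I) (hC : cartanProduct m n = C) (hI : cartanComplement m n = I) (c : ℂ)
    {t : sl m n ⊗[ℂ] sl m n} (ht : t ∈ I) :
    mulSym m n t - algebraMap ℂ (U m n) (c * killingTensor m n t) ∈ quadraticIdeal m n c := by
  set P := C.projection I h with hP
  have key : ∀ t, mulU m n (t - P t) - (1 / 2 : ℂ) • uι (bracketTensor m n t) -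
      algebraMap ℂ (U m n) (c * killingTensor m n t) ∈ idealSubmodule (quadraticIdeal m n c) := by
    intro t
    induction t using TensorProduct.induction_on with
    | zero => simp
    | tmul X Y =>
      rw [mem_idealSubmodule, bracketTensor_tmul, killingTensor_tmul]
      have h1 : tι₂ (X ⊗ₜ Y - P (X ⊗ₜ Y)) - (1 / 2 : ℂ) • tι (bracket X Y) -
          algebraMap ℂ (T m n) (c * killing X Y) ∈ tensorIdeal m n c := by
        refine TwoSidedIdeal.subset_span ⟨X, Y, P (X ⊗ₜ Y), ⟨?_, ?_⟩, rfl⟩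
        · rw [hC]; exact Submodule.projection_apply_mem _ _
        · rw [hI]; exact sub_projection_mem h _
      have h2 : toU m n (tι₂ (X ⊗ₜ Y - P (X ⊗ₜ Y)) - (1 / 2 : ℂ) • tι (bracket X Y) -
          algebraMap ℂ (T m n) (c * killing X Y)) ∈ quadraticIdeal m n c :=
        TwoSidedIdeal.subset_span ⟨_, h1, rfl⟩
      rw [map_sub, map_sub, map_smul, AlgHom.commutes] at h2
      exact h2
    | add x y hx hy =>
      have h1 := add_mem hx hy
      convert h1 using 1
      simp only [map_add, map_sub, mul_add, smul_add]
      abel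
  have h1 := key t
  rw [(Submodule.projection_apply_eq_zero_iff h).2 ht, sub_zero] at h1
  exact mem_idealSubmodule.1 h1

/-- The Joseph ideal is maximal, because the quotient of `U(𝔤)` by it is simple. -/
theorem eq_of_le [hmn : Fact (n < m)] {C I : Submodule ℂ (sl m n ⊗[ℂ] sl m n)}
    (h : IsCompl C I) (hC : cartanProduct m n = C) (hI : cartanComplement m n = I)
    (hminor : ∀ i j k l, minorTensor i j k l ∈ I) {K : TwoSidedIdeal (U m n)}
    (hle : josephIdeal m n ≤ K) (h1K : (1 : U m n) ∉ K) {o t : Idx m n} (ho : par o = 0)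
    (ht : par t = 0) (hot : o ≠ t) : K = josephIdeal m n := by
  refine le_antisymm (fun u hu => ?_) hle
  have D := minorGenerators (josephIdeal m n) fun i j k l =>
    mulSym_sub_mem_quadraticIdeal h hC hI _ (hminor i j k l)
  set q := Ideal.Quotient.mk (TwoSidedIdeal.asIdeal (josephIdeal m n)) with hq
  by_contra hu'
  have hqu : q u ≠ 0 := fun h0 =>
    hu' (TwoSidedIdeal.mem_asIdeal.1 (Ideal.Quotient.eq_zero_iff_mem.1 h0))
  have hsurj : Function.Surjective q := Ideal.Quotient.mk_surjective
  have : (Ideal.map q (TwoSidedIdeal.asIdeal K)).IsTwoSided := ⟨fun {a} b ha => by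
    obtain ⟨x, hx, rfl⟩ := (Ideal.mem_map_iff_of_surjective q hsurj).1 ha
    obtain ⟨y, rfl⟩ := hsurj b
    rw [← map_mul]
    exact Ideal.mem_map_of_mem q (Ideal.mul_mem_right _ _ hx)⟩
  have h1 := D.one_mem_of_ne_zero hmn.out ho ht hot (Ideal.map q (TwoSidedIdeal.asIdeal K))
    (Ideal.mem_map_of_mem q (TwoSidedIdeal.mem_asIdeal.2 hu)) hqu
  obtain ⟨k, hk, hk1⟩ := (Ideal.mem_map_iff_of_surjective q hsurj).1 h1
  have h2 : k - 1 ∈ K := hle (TwoSidedIdeal.mem_asIdeal.1 (Ideal.Quotient.eq_zero_iff_mem.1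
    (by rw [← hq, map_sub, hk1, map_one, sub_self])))
  apply h1K
  have h4 := K.sub_mem (TwoSidedIdeal.mem_asIdeal.1 hk) h2
  rwa [sub_sub_cancel] at h4

end SLSuper
end

theorem theorem4 (m n : ℕ) (hmn : n + 2 < m) (K : TwoSidedIdeal (SLSuper.U m n))
    (hcodim : SLSuper.InfiniteCodim K)
    (htau : SLSuper.tau m n '' (K : Set (SLSuper.U m n)) = (K : Set (SLSuper.U m n)))
    (hdisj : Disjoint (SLSuper.grTwo K) (SLSuper.cartanProduct m n))
    (hsum : SLSuper.grTwo K ⊔ SLSuper.cartanProduct m n = SLSuper.symSq m n) :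
    K = SLSuper.josephIdeal m n := by
  open SLSuper in
  have : Fact (n < m) := ⟨by omega⟩
  have hτ : ∀ u ∈ K, tau m n u ∈ K := fun u hu => by
    have : tau m n u ∈ tau m n '' (K : Set (U m n)) := ⟨u, hu, rfl⟩
    rw [htau] at this
    exact this
  have h3 : ∀ i j : Idx m n, ∃ r, r ≠ i ∧ r ≠ j := by
    intro i j
    have : ({i, j} : Finset (Idx m n)).card < Fintype.card (Idx m n) := by
      refine Finset.card_le_two.trans_lt ?_
      rw [Fintype.card_sum, Fintype.card_fin, Fintype.card_fin]
      omega
    obtain ⟨r, -, hr⟩ := Finset.exists_mem_notMem_of_card_lt_card this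
    exact ⟨r, by simpa using hr⟩
  obtain ⟨o, a, b, H⟩ := exists_cartanIndices hmn
  -- Without a Cartan decomposition, the Cartan product would be zero.
  obtain ⟨C₀, I₀, h₀⟩ : ∃ C I, IsCartanDecomposition (m := m) (n := n) C I := by
    by_contra! hno
    have h1 : cartanProduct m n = ⊥ := by
      rw [cartanProduct, Set.eq_empty_of_forall_notMem (s := {C | ∃ I, IsCartanDecomposition C I})
        fun C ⟨I, hI⟩ => hno C I hI, sSup_empty]
    rw [h1, sup_bot_eq] at hsum
    exact grTwo_ne_symSq hcodim hsum
  have hC := H.cartanProduct_eq h₀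
  rw [hC] at hdisj hsum
  have h := H.isCartanDecomposition_sup h₀ (isStable_grTwo K) hdisj hsum
  have hI := H.cartanComplement_eq h le_sup_right
  obtain ⟨c, hcC, hcI⟩ := exists_mulSym_sub_killingTensor_mem h3 hcodim hτ h
  have hc : c = criticalParam m n := by
    refine eq_criticalParam h3 (o := Sum.inl ⟨0, by omega⟩) (t := Sum.inl ⟨1, by omega⟩)
      (r := Sum.inl ⟨2, by omega⟩) rfl rfl rfl (by simp) (by simp) (by simp) hcodim
      fun i j k l => mem_idealSubmodule.1 (hcI _ (H.minorTensor_mem h i j k l))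
  subst hc
  have hle : josephIdeal m n ≤ K := quadraticIdeal_le hC hI
    (fun t ht => bracketTensor_eq_zero h3 hcodim (H.left_le_symSq h ht)) hcC
    fun t ht => mem_idealSubmodule.1 (hcI t ht)
  exact eq_of_le h.isCompl hC hI (fun i j k l => H.minorTensor_mem h i j k l) hle
    (one_notMem hcodim) (o := Sum.inl ⟨0, by omega⟩) (t := Sum.inl ⟨1, by omega⟩) rfl rfl (by simp)
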